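/- Let $U\subset\mathbb R^3$ be an open neighbourhood of $\Lambda=0$ with Cartesian coordinates $(x,y,z)$, and let $(\rho,\varphi,z)$ be the corresponding cylindrical coordinates. Let $\tilde h$ be a smooth Riemannian metric on $U$ that off the axis $\rho=0$ has the form $$\tilde h=e^{2\kappa}\left(\rho^2e^{-2\beta}\,d\varphi^2+d\rho^2+dz^2\right),$$ where $\beta,\kappa:U\to\mathbb R$ are real-analytic and axisymmetric (functions of $(z,\rho)$ only) and $\kappa(\Lambda)=0$. Let $\tilde\phi:U\to\mathbb C$ be real-analytic and axisymmetric. (For a stationary axisymmetric asymptotically flat spacetime, $\tilde h=\Omega^2h$ is the conformally rescaled metric on the space of Killing trajectories, and $\tilde\phi=\phi/\sqrt\Omega$ is the rescaled potential.) With $\tilde D$ the Levi-Civita connection and $\tilde R_{ab}$ the Ricci tensor of $\tilde h$, let $P=\tilde\phi$ and, for $n\ge1$, $$P_{a_1\dots a_n}=C\left[\tilde D_{a_1}P_{a_2\dots a_n}-\tfrac{(n-1)(2n-3)}{2}\tilde R_{a_1a_2}P_{a_3\dots a_n}\right],$$ where $C[\cdot]$ is the totally symmetric and $\tilde h$-trace-free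 part (the last term is absent for $n=1$). The multipole moments $m_n$ are defined by $P_{a_1\dots a_n}(\Lambda)=m_n\,C[z_{a_1}\cdots z_{a_n}]$ at $\Lambda$, with $z_a=(dz)_a$. On the meridian plane with coordinates $(z,\rho)$, extended to $\rho<0$, put $\eta=\partial_z-i\partial_\rho$ and $f_n(z,\rho)=\eta^{a_1}\cdots\eta^{a_n}P_{a_1\dots a_n}$, and likewise regard $\beta$ and $\kappa$ as (even in $\rho$) functions of $(z,\rho)$. For a function $g(z,\rho)$ that is real-analytic near the origin, let $g_L(r)=g(r,-ir)$, where $g$ is continued to complex arguments by its power series. Then there is $\delta>0$ such that $\beta$, $\kappa$ and all $f_n$ extend analytically to the complex polydisc $|z|,|\rho|<\delta$, so that $\beta_L$, $\kappa_L$ and $y_n:=(f_n)_L$ are defined and analytic on $(-\delta,\delta)$. The function $$M(r)=\beta_L''-(\beta_L')^2+\frac2r\beta_L'-\kappa_L''+(\kappa_L')^2$$ extends analytically across $r=0$ to $(-\delta,\delta)$, and for all $n\ge1$, on $(-\delta,\delta)$, $$y_n=y_{n-1}'-2(n-1)\kappa_L'\,y_{n-1}-\tfrac{(n-1)(2n-3)}{2}\,M\,y_{n-2}$$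 (the last term being absent for $n=1$). Moreover, for every $n\ge0$ the moment $m_n$ exists, is unique, and $m_n=y_n(0)$. -/

import Mathlib

open scoped ContDiff

noncomputable section

namespace Multipole

/-- The coordinate space of a Cartesian chart `(x, y, z)` around `Λ = 0`;
the symmetry axis is the `z`-axis. -/
abbrev Pt : Type := Fin 3 → ℝ

/-- Components of a complex covariant tensor of rank `n` at a point. -/
abbrev Tensor (n : ℕ) : Type := (Fin n → Fin 3) → ℂ

/-- Partial derivative in the `i`-th coordinate direction. -/
def pderiv {E : Type*} [NormedAddCommGroup E] [NormedSpace ℝ E]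
    (i : Fin 3) (g : Pt → E) (p : Pt) : E :=
  fderiv ℝ g p (Pi.single i 1)

/-- A smooth Riemannian metric on `U`, given by its component matrix. -/
def IsSmoothMetricOn (U : Set Pt) (h : Pt → Matrix (Fin 3) (Fin 3) ℝ) : Prop :=
  (∀ i j, ContDiffOn ℝ ∞ (fun p => h p i j) U) ∧ ∀ p ∈ U, (h p).PosDef

/-- Christoffel symbols `Γ^k_{ij}` of the Levi-Civita connection. -/
def christoffel (h : Pt → Matrix (Fin 3) (Fin 3) ℝ) (k i j : Fin 3) (p : Pt) : ℝ :=
  (1 / 2) * ∑ l, (h p)⁻¹ k l *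
    (pderiv i (fun q => h q j l) p + pderiv j (fun q => h q i l) p
      - pderiv l (fun q => h q i j) p)

/-- Ricci tensor `R_{ij}` (positive on round spheres). -/
def ricci (h : Pt → Matrix (Fin 3) (Fin 3) ℝ) (i j : Fin 3) (p : Pt) : ℝ :=
  ∑ k, (pderiv k (christoffel h k i j) p - pderiv j (christoffel h k k i) p)
    + ∑ k, ∑ l, (christoffel h k k l p * christoffel h l i j p
        - christoffel h k j l p * christoffel h l k i p)

/-- Covariant derivative `D_{a₀} T_{a₁ … aₙ}`. -/
def covD (h : Pt → Matrix (Fin 3) (Fin 3) ℝ) {n : ℕ} (T : Pt → Tensor n) :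
    Pt → Tensor (n + 1) := fun p a =>
  pderiv (a 0) (fun q => T q (Fin.tail a)) p
    - ∑ i : Fin n, ∑ k : Fin 3,
        (christoffel h k (a 0) (Fin.tail a i) p : ℂ) *
          T p (Function.update (Fin.tail a) i k)

/-- Total symmetrization `T_{(a₁ … aₙ)}`. -/
def symm {n : ℕ} (T : Tensor n) : Tensor n := fun a =>
  ((n.factorial : ℂ))⁻¹ * ∑ σ : Equiv.Perm (Fin n), T (fun i => a (σ i))

/-- Total symmetry. -/
def IsSymm {n : ℕ} (T : Tensor n) : Prop :=
  ∀ (σ : Equiv.Perm (Fin n)) (a : Fin n → Fin 3), T (fun i => a (σ i)) = T a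

/-- All traces with respect to the metric `h` vanish. -/
def IsTraceFree {n : ℕ} (h : Matrix (Fin 3) (Fin 3) ℝ) (T : Tensor n) : Prop :=
  ∀ i j : Fin n, i ≠ j → ∀ a : Fin n → Fin 3,
    ∑ k, ∑ l, ((h⁻¹ k l : ℝ) : ℂ) * T (Function.update (Function.update a i k) j l) = 0

/-- The span of the tensors `h_{a_i a_j} U`, where `U` is a tensor in the remaining indices. -/
def traceSpan (h : Matrix (Fin 3) (Fin 3) ℝ) (n : ℕ) : Submodule ℂ (Tensor n) :=
  Submodule.span ℂ {T | ∃ i j : Fin n, i ≠ j ∧ ∃ U : Tensor n,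
    (∀ a k l, U (Function.update (Function.update a i k) j l) = U a) ∧
    ∀ a, T a = (h (a i) (a j) : ℂ) * U a}

/-- `X` is the totally symmetric and trace-free part of `T`: it is symmetric and trace-free, and
arises from the symmetrization of `T` by subtracting terms that contain a factor `h_{a_i a_j}`. -/
def IsSTFPart {n : ℕ} (h : Matrix (Fin 3) (Fin 3) ℝ) (T X : Tensor n) : Prop :=
  IsSymm X ∧ IsTraceFree h X ∧ symm T - X ∈ traceSpan h n

/-- The totally symmetric and trace-free part `C[T]` (it exists and is unique for positive
definite `h`). -/
def stf {n : ℕ} (h : Matrix (Fin 3) (Fin 3) ℝ) (T : Tensor n) : Tensor n :=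
  Classical.epsilon (fun X => IsSTFPart h T X)

/-- The Geroch–Hansen recursion
`P_{a₁…aₙ} = C[D_{a₁} P_{a₂…aₙ} - ((n-1)(2n-3)/2) R_{a₁a₂} P_{a₃…aₙ}]` with `P = φ` for `n = 0`;
the last clause is the case of rank `n + 2`. -/
def gerochHansen (h : Pt → Matrix (Fin 3) (Fin 3) ℝ) (φ : Pt → ℂ) : (n : ℕ) → Pt → Tensor n
  | 0 => fun p _ => φ p
  | 1 => fun p => stf (h p) (covD h (gerochHansen h φ 0) p)
  | n + 2 => fun p => stf (h p) (fun a =>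
      covD h (gerochHansen h φ (n + 1)) p a
        - (((n : ℂ) + 1) * (2 * (n : ℂ) + 1) / 2) * (ricci h (a 0) (a 1) p : ℂ)
          * gerochHansen h φ n p (fun i => a i.succ.succ))

/-- `m` is the `n`-th moment: `P_{a₁…aₙ}(Λ) = m C[z_{a₁} ⋯ z_{aₙ}]`, where `z_a = (dz)_a`. -/
def IsMoment (h : Pt → Matrix (Fin 3) (Fin 3) ℝ) (φ : Pt → ℂ) (n : ℕ) (m : ℂ) : Prop :=
  gerochHansen h φ n 0 = m • stf (h 0) (fun a => ∏ i, if a i = 2 then (1 : ℂ) else 0)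

/-- Distance `ρ` from the axis. -/
def rho (p : Pt) : ℝ := Real.sqrt (p 0 ^ 2 + p 1 ^ 2)

/-- Components of `dρ` off the axis. -/
def dRho (p : Pt) : Fin 3 → ℝ := ![p 0 / rho p, p 1 / rho p, 0]

/-- Components of `dφ` (the azimuth) off the axis. -/
def dPhi (p : Pt) : Fin 3 → ℝ := ![-p 1 / rho p ^ 2, p 0 / rho p ^ 2, 0]

/-- Components of `dz`. -/
def dZ : Fin 3 → ℝ := ![0, 0, 1]

/-- Off the axis, `h = e^{2κ} (ρ² e^{-2β} dφ² + dρ² + dz²)`. -/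
def HasAxisymmetricForm (U : Set Pt) (h : Pt → Matrix (Fin 3) (Fin 3) ℝ)
    (β κ : Pt → ℝ) : Prop :=
  ∀ p ∈ U, rho p ≠ 0 → ∀ i j, h p i j = Real.exp (2 * κ p) *
    (rho p ^ 2 * Real.exp (-2 * β p) * dPhi p i * dPhi p j
      + dRho p i * dRho p j + dZ i * dZ j)

/-- A function that depends on `(z, ρ)` only. -/
def IsAxisymmetricOn {E : Type*} (U : Set Pt) (g : Pt → E) : Prop :=
  ∀ p ∈ U, ∀ q ∈ U, p 2 = q 2 → rho p = rho q → g p = g q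

/-- The point of the meridian plane with coordinates `(z, ρ)`, where also `ρ < 0` is allowed. -/
def meridian (w : ℝ × ℝ) : Pt := ![w.2, 0, w.1]

/-- The null vector `η = ∂_z - i ∂_ρ` on the meridian plane. -/
def eta : Fin 3 → ℂ := ![-Complex.I, 0, 1]

/-- `f_n = η^{a₁} ⋯ η^{aₙ} P_{a₁…aₙ}` as a function of `(z, ρ)`. -/
def fFun (h : Pt → Matrix (Fin 3) (Fin 3) ℝ) (φ : Pt → ℂ) (n : ℕ) (w : ℝ × ℝ) : ℂ :=
  ∑ a : Fin n → Fin 3, (∏ i, eta (a i)) * gerochHansen h φ n (meridian w) a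

/-- `G` is the complex-analytic continuation of `g` to the polydisc of radius `δ`
(balls in products carry the maximum norm). -/
def IsComplexification (δ : ℝ) (g : ℝ × ℝ → ℂ) (G : ℂ × ℂ → ℂ) : Prop :=
  AnalyticOnNhd ℂ G (Metric.ball 0 δ) ∧
    ∀ w ∈ Metric.ball (0 : ℝ × ℝ) δ, G ((w.1 : ℂ), (w.2 : ℂ)) = g w

open Classical in
/-- The leading order function `g_L(r) = g(r, -ir)`, through the continuation of `g` to some
polydisc that contains `(r, -ir)`; its value does not depend on the continuation. -/
def leadingOrder (g : ℝ × ℝ → ℂ) (r : ℝ) : ℂ :=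
  if H : ∃ G : ℂ × ℂ → ℂ, ∃ δ : ℝ, |r| < δ ∧ IsComplexification δ g G then
    H.choose ((r : ℂ), -Complex.I * (r : ℂ))
  else 0

/-- A real function on the chart as a complex-valued function of `(z, ρ)`. -/
def onMeridian (g : Pt → ℝ) (w : ℝ × ℝ) : ℂ := (g (meridian w) : ℂ)

end Multipole

end

noncomputable section

namespace Multipole

/-! ### Sums over multi-indices -/

/-! Everything is tested on null vectors. On the meridian plane of a given azimuth the field `η =
∂_z - i ∂_ρ` has constant Cartesian components and is null for `h`, so contracting every slot with
`η` sees neither symmetrization nor trace removal (`IsSTFPart.contract_eq`). Moreover `Γ^k_{ij} η^i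
η^j = 2 (ηκ) η^k` on that plane, so each slot of a covariantly differentiated tensor costs exactly
`2 ηκ` (`contract_covD`). The tensor recursion becomes a scalar one, f_n = η f_{n-1} - 2(n-1)(ηκ)
f_{n-1} - ((n-1)(2n-3)/2) Ric(η,η) f_{n-2}, where off the axis, by `ricci_planeVec`, Ric(η,η) = ηηβ
- (ηβ)² - (2i/ρ) ηβ - ηηκ + (ηκ)².

The complex line `ρ = -ir` has direction `(1, -i)`, so on it `η` restricts to `d/dr` and `-2i/ρ`
becomes `2/r`; this turns the scalar recursion into the asserted one. The singular coefficient is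
harmless: smoothness of the metric forces `β = 0` on the axis (`beta_axis`), evenness in `ρ` removes
`∂_ρ β` there, and a real-analytic function vanishing on the axis is divisible by `ρ`. The metric is
only assumed smooth, so analyticity of `f_n` is not read off the tensors. Instead `complexRec`
solves the recursion on one fixed polydisc, and its solution agrees with `f_n` at real points by
induction; identities known off the axis extend to it by density.

For the moments, `h 0 = 1`, and the complexified solution is the same for every azimuth. Hence the
rank `n` tensor at the origin has contraction `y_n(0)` with every null vector of the circle `nullVec
t`, whereas `C[z ⋯ z]` has contraction 1. A symmetric trace-free tensor is determined by its values
on this circle (`eq_zero_of_contract_nullVec`), which gives existence; contraction with a single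
null vector gives uniqueness.

Since `stf` is an arbitrary choice among admissible tensors, existence and uniqueness must come
first. For the flat metric this is an orthogonal decomposition. A factorization `h = Eᵀ E`
transports it to general `h`, and the smoothness of the Cholesky factor makes the tensors
differentiable. -/

lemma sum_sum_update {n : ℕ} (i : Fin n) (F : (Fin n → Fin 3) → ℂ) :
    ∑ b, ∑ k, F (Function.update b i k) = 3 * ∑ b, F b := by
  have h : ∑ x : (Fin n → Fin 3) × Fin 3, F (Function.update x.1 i x.2)
      = ∑ x : (Fin n → Fin 3) × Fin 3, F x.1 := by
    -- Exchanging the overwriting entry with the overwritten one is an involution on pairs `(b, k)`.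
    refine Finset.sum_bij' (fun x _ => (Function.update x.1 i x.2, x.1 i))
      (fun x _ => (Function.update x.1 i x.2, x.1 i)) ?_ ?_ ?_ ?_ ?_ <;> simp
  rw [Fintype.sum_prod_type, Fintype.sum_prod_type] at h
  rw [h, Finset.mul_sum]
  simp

/-- Isolates the summation over two slots without decomposing `Fin n`; the price is that every
multi-index is counted nine times. -/
lemma sum_sum_update_update {n : ℕ} (i j : Fin n) (F : (Fin n → Fin 3) → ℂ) :
    ∑ b, ∑ k, ∑ l, F (Function.update (Function.update b i k) j l) = 9 * ∑ b, F b := by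
  rw [sum_sum_update i (fun b => ∑ l, F (Function.update b j l)), sum_sum_update]
  ring

lemma prod_update_update {n : ℕ} {i j : Fin n} (hij : i ≠ j) (g : Fin n → Fin 3 → ℂ)
    (b : Fin n → Fin 3) (k l : Fin 3) :
    ∏ m, g m (Function.update (Function.update b i k) j l m)
      = g i k * g j l * ∏ m ∈ (Finset.univ.erase i).erase j, g m (b m) := by
  rw [← Finset.mul_prod_erase Finset.univ _ (Finset.mem_univ i),
    ← Finset.mul_prod_erase (Finset.univ.erase i) _
      (Finset.mem_erase.2 ⟨hij.symm, Finset.mem_univ j⟩), ← mul_assoc]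
  congr 1
  · simp [hij]
  · refine Finset.prod_congr rfl fun m hm => ?_
    simp only [Finset.mem_erase] at hm
    rw [Function.update_of_ne hm.1, Function.update_of_ne hm.2.1]

lemma prod_split {n : ℕ} {i j : Fin n} (hij : i ≠ j) (g : Fin n → ℂ) :
    ∏ m, g m = g i * g j * ∏ m ∈ (Finset.univ.erase i).erase j, g m := by
  rw [← Finset.mul_prod_erase Finset.univ _ (Finset.mem_univ i),
    ← Finset.mul_prod_erase (Finset.univ.erase i) _
      (Finset.mem_erase.2 ⟨hij.symm, Finset.mem_univ j⟩), ← mul_assoc]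

/-! ### Pullback of tensors by a matrix -/

/-- The pullback of a covariant tensor along the linear map with matrix `A`. -/
def pull {n : ℕ} (A : Matrix (Fin 3) (Fin 3) ℝ) (T : Tensor n) : Tensor n := fun a =>
  ∑ b, (∏ i, (A (b i) (a i) : ℂ)) * T b

lemma pull_one {n : ℕ} (T : Tensor n) : pull 1 T = T := by
  funext a
  rw [pull, Finset.sum_eq_single a]
  · simp
  · intro b _ hb
    obtain ⟨i, hi⟩ := Function.ne_iff.1 hb
    rw [Finset.prod_eq_zero (Finset.mem_univ i), zero_mul]
    simp [Matrix.one_apply_ne hi]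
  · simp

lemma pull_pull {n : ℕ} (A B : Matrix (Fin 3) (Fin 3) ℝ) (T : Tensor n) :
    pull A (pull B T) = pull (B * A) T := by
  funext a
  simp only [pull, Finset.mul_sum]
  rw [Finset.sum_comm]
  refine Finset.sum_congr rfl fun c _ => ?_
  have h : ∏ i, (((B * A) (c i) (a i) : ℝ) : ℂ)
      = ∑ b : Fin n → Fin 3, ∏ i, ((B (c i) (b i) : ℂ) * (A (b i) (a i) : ℂ)) := by
    have := Finset.prod_univ_sum (fun _ : Fin n => (Finset.univ : Finset (Fin 3)))
      (fun i j => (B (c i) j : ℂ) * (A j (a i) : ℂ))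
    rw [Fintype.piFinset_univ] at this
    rw [← this]
    simp [Matrix.mul_apply]
  rw [h, Finset.sum_mul]
  refine Finset.sum_congr rfl fun b _ => ?_
  rw [Finset.prod_mul_distrib]
  ring

lemma pull_add {n : ℕ} (A : Matrix (Fin 3) (Fin 3) ℝ) (T T' : Tensor n) :
    pull A (T + T') = pull A T + pull A T' := by
  funext a
  simp [pull, mul_add, Finset.sum_add_distrib]

lemma pull_smul {n : ℕ} (A : Matrix (Fin 3) (Fin 3) ℝ) (c : ℂ) (T : Tensor n) :
    pull A (c • T) = c • pull A T := by
  funext a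
  simp only [pull, Pi.smul_apply, smul_eq_mul, Finset.mul_sum]
  exact Finset.sum_congr rfl fun b _ => by ring

/-- Pullback as a linear map. -/
def pullₗ {n : ℕ} (A : Matrix (Fin 3) (Fin 3) ℝ) : Tensor n →ₗ[ℂ] Tensor n where
  toFun := pull A
  map_add' := pull_add A
  map_smul' := pull_smul A

lemma pull_perm {n : ℕ} (A : Matrix (Fin 3) (Fin 3) ℝ) (T : Tensor n)
    (σ : Equiv.Perm (Fin n)) (a : Fin n → Fin 3) :
    pull A T (fun i => a (σ i)) = pull A (fun b => T (fun i => b (σ i))) a := by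
  simp only [pull]
  refine Fintype.sum_equiv (Equiv.arrowCongr σ (Equiv.refl (Fin 3))) _ _ fun b => ?_
  congr 1
  · rw [← Equiv.prod_comp σ (fun x => ((A _ (a x) : ℝ) : ℂ))]
    simp [Equiv.arrowCongr]
  · simp [Equiv.arrowCongr]

lemma IsSymm.pull {n : ℕ} {T : Tensor n} (hT : IsSymm T) (A : Matrix (Fin 3) (Fin 3) ℝ) :
    IsSymm (pull A T) := by
  intro σ a
  rw [pull_perm]
  congr 1
  funext b
  exact hT σ b

lemma pull_symm {n : ℕ} (A : Matrix (Fin 3) (Fin 3) ℝ) (T : Tensor n) :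
    pull A (symm T) = symm (pull A T) := by
  funext a
  simp only [symm, pull_perm]
  simp only [pull, symm, Finset.mul_sum]
  rw [Finset.sum_comm]
  refine Finset.sum_congr rfl fun σ _ => Finset.sum_congr rfl fun b _ => ?_
  ring

/-- Because `A (Aᵀ h A)⁻¹ Aᵀ = h⁻¹`, taking the trace of a pullback amounts to pulling back the
trace. -/
lemma IsTraceFree.pull {n : ℕ} {h : Matrix (Fin 3) (Fin 3) ℝ} {T : Tensor n}
    (hT : IsTraceFree h T) {A : Matrix (Fin 3) (Fin 3) ℝ} (hA : IsUnit A.det) :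
    IsTraceFree (A.transpose * h * A) (pull A T) := by
  intro i j hij a
  have hAT : IsUnit A.transpose.det := by rwa [Matrix.det_transpose]
  have hinv : A * (A.transpose * h * A)⁻¹ * A.transpose = h⁻¹ := by
    rw [Matrix.mul_inv_rev, Matrix.mul_inv_rev, ← mul_assoc, ← mul_assoc,
      Matrix.mul_nonsing_inv A hA, one_mul, mul_assoc, Matrix.nonsing_inv_mul _ hAT, mul_one]
  set h' := A.transpose * h * A with hh'
  have key : ∀ b : Fin n → Fin 3, ∑ k, ∑ l, ((h'⁻¹ k l : ℝ) : ℂ) *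
      ((A (b i) k : ℂ) * (A (b j) l : ℂ)) = ((h⁻¹ (b i) (b j) : ℝ) : ℂ) := by
    intro b
    rw [← hinv]
    simp only [Matrix.mul_apply, Matrix.transpose_apply, Complex.ofReal_sum, Complex.ofReal_mul,
      Finset.sum_mul]
    rw [Finset.sum_comm]
    refine Finset.sum_congr rfl fun k _ => Finset.sum_congr rfl fun l _ => ?_
    ring
  simp only [Multipole.pull]
  have step : ∀ k l, ∑ b : Fin n → Fin 3,
      (∏ m, ((A (b m) (Function.update (Function.update a i k) j l m) : ℝ) : ℂ)) * T b
      = ∑ b : Fin n → Fin 3, ((A (b i) k : ℂ) * (A (b j) l : ℂ) *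
        ∏ m ∈ (Finset.univ.erase i).erase j, ((A (b m) (a m) : ℝ) : ℂ)) * T b := by
    intro k l
    refine Finset.sum_congr rfl fun b _ => ?_
    rw [prod_update_update hij (fun m x => ((A (b m) x : ℝ) : ℂ))]
  simp only [step, Finset.mul_sum]
  have swap : ∀ G : Fin 3 → Fin 3 → (Fin n → Fin 3) → ℂ,
      ∑ k, ∑ l, ∑ b, G k l b = ∑ b, ∑ k, ∑ l, G k l b := by
    intro G
    rw [Finset.sum_comm (s := (Finset.univ : Finset (Fin n → Fin 3)))]
    refine Finset.sum_congr rfl fun k _ => ?_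
    rw [Finset.sum_comm]
  rw [swap]
  set R : (Fin n → Fin 3) → ℂ := fun b =>
    ∏ m ∈ (Finset.univ.erase i).erase j, ((A (b m) (a m) : ℝ) : ℂ) with hR
  have h1 : ∀ b : Fin n → Fin 3, ∑ k, ∑ l, ((h'⁻¹ k l : ℝ) : ℂ) *
      (((A (b i) k : ℂ) * (A (b j) l : ℂ) * R b) * T b)
      = ((h⁻¹ (b i) (b j) : ℝ) : ℂ) * R b * T b := by
    intro b
    rw [← key b, Finset.sum_mul, Finset.sum_mul]
    refine Finset.sum_congr rfl fun k _ => ?_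
    rw [Finset.sum_mul, Finset.sum_mul]
    refine Finset.sum_congr rfl fun l _ => ?_
    ring
  have h2 : ∀ b k l, R (Function.update (Function.update b i k) j l) = R b := by
    intro b k l
    refine Finset.prod_congr rfl fun m hm => ?_
    simp only [Finset.mem_erase] at hm
    rw [Function.update_of_ne hm.1, Function.update_of_ne hm.2.1]
  rw [Finset.sum_congr rfl fun b _ => h1 b]
  have h9 := sum_sum_update_update i j (fun b => ((h⁻¹ (b i) (b j) : ℝ) : ℂ) * R b * T b)
  have h3 : ∀ b : Fin n → Fin 3, ∑ k, ∑ l,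
      ((h⁻¹ (Function.update (Function.update b i k) j l i)
        (Function.update (Function.update b i k) j l j) : ℝ) : ℂ)
        * R (Function.update (Function.update b i k) j l)
        * T (Function.update (Function.update b i k) j l) = 0 := by
    intro b
    have := hT i j hij b
    calc _ = R b * ∑ k, ∑ l, ((h⁻¹ k l : ℝ) : ℂ)
          * T (Function.update (Function.update b i k) j l) := by
          rw [Finset.mul_sum]
          refine Finset.sum_congr rfl fun k _ => ?_
          rw [Finset.mul_sum]
          refine Finset.sum_congr rfl fun l _ => ?_
          rw [h2]
          simp [hij]
          ring
      _ = 0 := by rw [this, mul_zero]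
  rw [Finset.sum_congr rfl fun b _ => h3 b] at h9
  simpa using h9.symm

lemma pull_mem_traceSpan {n : ℕ} {h : Matrix (Fin 3) (Fin 3) ℝ} {T : Tensor n}
    (hT : T ∈ traceSpan h n) (A : Matrix (Fin 3) (Fin 3) ℝ) :
    pull A T ∈ traceSpan (A.transpose * h * A) n := by
  have hle : (traceSpan h n).map (pullₗ A) ≤ traceSpan (A.transpose * h * A) n := by
    rw [traceSpan, Submodule.map_span, Submodule.span_le]
    rintro _ ⟨T, ⟨i, j, hij, V, hV, hTV⟩, rfl⟩
    -- `V` ignores the slots `i` and `j`, yet the sum still runs over them; `9⁻¹` compensates for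
    -- these repetitions.
    refine Submodule.subset_span ⟨i, j, hij, fun a => 9⁻¹ * ∑ b,
      (∏ m ∈ (Finset.univ.erase i).erase j, ((A (b m) (a m) : ℝ) : ℂ)) * V b, ?_, ?_⟩
    · intro a k l
      refine congrArg ((9⁻¹ : ℂ) * ·) (Finset.sum_congr rfl fun b _ =>
        congrArg (· * V b) (Finset.prod_congr rfl fun m hm => ?_))
      simp only [Finset.mem_erase] at hm
      rw [Function.update_of_ne hm.1, Function.update_of_ne hm.2.1]
    · intro a
      set R : (Fin n → Fin 3) → ℂ := fun b =>
        ∏ m ∈ (Finset.univ.erase i).erase j, ((A (b m) (a m) : ℝ) : ℂ) with hR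
      have h2 : ∀ b k l, R (Function.update (Function.update b i k) j l) = R b := by
        intro b k l
        refine Finset.prod_congr rfl fun m hm => ?_
        simp only [Finset.mem_erase] at hm
        rw [Function.update_of_ne hm.1, Function.update_of_ne hm.2.1]
      have e1 : pullₗ A T a = ∑ b, (A (b i) (a i) : ℂ) * (A (b j) (a j) : ℂ) * R b
          * ((h (b i) (b j) : ℂ) * V b) := by
        change pull A T a = _
        refine Finset.sum_congr rfl fun b _ => ?_
        rw [hTV, prod_split hij]
      have e2 := sum_sum_update_update i j (fun b => (A (b i) (a i) : ℂ) * (A (b j) (a j) : ℂ) * R b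
          * ((h (b i) (b j) : ℂ) * V b))
      have e3 : ∀ b, ∑ k, ∑ l, (fun b => (A (b i) (a i) : ℂ) * (A (b j) (a j) : ℂ) * R b
          * ((h (b i) (b j) : ℂ) * V b)) (Function.update (Function.update b i k) j l)
          = ((A.transpose * h * A) (a i) (a j) : ℂ) * (R b * V b) := by
        intro b
        simp only [h2, hV]
        simp only [Matrix.mul_apply, Matrix.transpose_apply, Complex.ofReal_sum,
          Complex.ofReal_mul, Finset.sum_mul]
        rw [Finset.sum_comm]
        refine Finset.sum_congr rfl fun k _ => Finset.sum_congr rfl fun l _ => ?_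
        simp [hij]
        ring
      rw [Finset.sum_congr rfl fun b _ => e3 b, ← Finset.mul_sum] at e2
      rw [e1]
      linear_combination (-1 / 9 : ℂ) * e2
  exact hle ⟨T, hT, rfl⟩

lemma IsSTFPart.pull {n : ℕ} {h : Matrix (Fin 3) (Fin 3) ℝ} {T X : Tensor n}
    (hX : IsSTFPart h T X) {A : Matrix (Fin 3) (Fin 3) ℝ} (hA : IsUnit A.det) :
    IsSTFPart (A.transpose * h * A) (pull A T) (pull A X) := by
  refine ⟨hX.1.pull A, hX.2.1.pull hA, ?_⟩
  rw [← pull_symm]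
  have := pull_mem_traceSpan hX.2.2 A
  rwa [show Multipole.pull A (symm T - X) = Multipole.pull A (symm T) - Multipole.pull A X from
    map_sub (pullₗ A) _ _] at this

/-! ### Existence and uniqueness of the symmetric trace-free part -/

lemma symm_add {n : ℕ} (T T' : Tensor n) : symm (T + T') = symm T + symm T' := by
  funext a
  simp [symm, Finset.sum_add_distrib, mul_add]

lemma symm_smul {n : ℕ} (c : ℂ) (T : Tensor n) : symm (c • T) = c • symm T := by
  funext a
  simp only [symm, Pi.smul_apply, smul_eq_mul, ← Finset.mul_sum]
  ring

lemma isSymm_symm {n : ℕ} (T : Tensor n) : IsSymm (symm T) := by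
  intro σ a
  simp only [symm]
  congr 1
  exact Fintype.sum_equiv (Equiv.mulLeft σ) _ _ fun τ => by simp

lemma IsSymm.add {n : ℕ} {T T' : Tensor n} (h : IsSymm T) (h' : IsSymm T') :
    IsSymm (T + T') := fun σ a => by simp [h σ a, h' σ a]

lemma IsSymm.smul {n : ℕ} {T : Tensor n} (h : IsSymm T) (c : ℂ) : IsSymm (c • T) :=
  fun σ a => by simp [h σ a]

lemma IsTraceFree.add {n : ℕ} {h : Matrix (Fin 3) (Fin 3) ℝ} {T T' : Tensor n}
    (hT : IsTraceFree h T) (hT' : IsTraceFree h T') : IsTraceFree h (T + T') := by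
  intro i j hij a
  simp only [Pi.add_apply, mul_add, Finset.sum_add_distrib, hT i j hij a, hT' i j hij a, add_zero]

lemma IsTraceFree.smul {n : ℕ} {h : Matrix (Fin 3) (Fin 3) ℝ} {T : Tensor n}
    (hT : IsTraceFree h T) (c : ℂ) : IsTraceFree h (c • T) := by
  intro i j hij a
  simp only [Pi.smul_apply, smul_eq_mul, mul_left_comm _ c, ← Finset.mul_sum, hT i j hij a,
    mul_zero]

lemma IsSTFPart.add {n : ℕ} {h : Matrix (Fin 3) (Fin 3) ℝ} {T T' X X' : Tensor n}
    (hX : IsSTFPart h T X) (hX' : IsSTFPart h T' X') : IsSTFPart h (T + T') (X + X') := by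
  refine ⟨hX.1.add hX'.1, hX.2.1.add hX'.2.1, ?_⟩
  rw [symm_add, add_sub_add_comm]
  exact add_mem hX.2.2 hX'.2.2

lemma IsSTFPart.smul {n : ℕ} {h : Matrix (Fin 3) (Fin 3) ℝ} {T X : Tensor n}
    (hX : IsSTFPart h T X) (c : ℂ) : IsSTFPart h (c • T) (c • X) := by
  refine ⟨hX.1.smul c, hX.2.1.smul c, ?_⟩
  rw [symm_smul, ← smul_sub]
  exact Submodule.smul_mem _ c hX.2.2

lemma trace_eq_zero_iff_one {n : ℕ} {T : Tensor n} : IsTraceFree 1 T ↔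
    ∀ i j : Fin n, i ≠ j → ∀ a : Fin n → Fin 3,
      ∑ k, T (Function.update (Function.update a i k) j k) = 0 := by
  have : ∀ (i j : Fin n) (a : Fin n → Fin 3), ∑ k, ∑ l,
      ((((1 : Matrix (Fin 3) (Fin 3) ℝ)⁻¹ k l : ℝ)) : ℂ)
      * T (Function.update (Function.update a i k) j l)
      = ∑ k, T (Function.update (Function.update a i k) j k) := by
    intro i j a
    refine Finset.sum_congr rfl fun k _ => ?_
    rw [Finset.sum_eq_single k]
    · simp
    · intro l _ hl
      simp [Matrix.one_apply_ne hl.symm]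
    · simp
  simp only [IsTraceFree, this]

/-- For the Hermitian product on tensors, multiplication by `δ_{a_i a_j}` is adjoint to the trace
over the slots `i, j`. Hence trace-free tensors are exactly the orthogonal complement of `traceSpan
1 n`. -/
lemma sum_conj_mul_eq {n : ℕ} {i j : Fin n} (hij : i ≠ j) {V : Tensor n}
    (hV : ∀ a k l, V (Function.update (Function.update a i k) j l) = V a) (X : Tensor n) :
    9 * ∑ a, starRingEnd ℂ (((1 : Matrix (Fin 3) (Fin 3) ℝ) (a i) (a j) : ℂ) * V a) * X a
      = ∑ a, starRingEnd ℂ (V a) * ∑ k, X (Function.update (Function.update a i k) j k) := by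
  rw [← sum_sum_update_update i j]
  refine Finset.sum_congr rfl fun a _ => ?_
  rw [Finset.mul_sum]
  refine Finset.sum_congr rfl fun k _ => ?_
  have hi : ∀ l, Function.update (Function.update a i k) j l i = k := by simp [hij]
  have hj : ∀ l, Function.update (Function.update a i k) j l j = l := by simp
  rw [Finset.sum_eq_single k]
  · rw [hi, hj, hV, Matrix.one_apply_eq]
    simp
  · intro l _ hl
    rw [hi, hj, Matrix.one_apply_ne hl.symm]
    simp
  · simp

lemma IsTraceFree.sum_conj_mul {n : ℕ} {T X : Tensor n} (hX : IsTraceFree 1 X)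
    (hT : T ∈ traceSpan 1 n) : ∑ a, starRingEnd ℂ (T a) * X a = 0 := by
  induction hT using Submodule.span_induction with
  | mem T hT =>
    obtain ⟨i, j, hij, V, hV, hTV⟩ := hT
    have := sum_conj_mul_eq hij hV X
    simp only [trace_eq_zero_iff_one.1 hX i j hij, mul_zero, Finset.sum_const_zero] at this
    simp only [hTV]
    simpa using this
  | zero => simp
  | add T T' _ _ h h' => simp [add_mul, Finset.sum_add_distrib, h, h']
  | smul c T _ h =>
    simp only [Pi.smul_apply, smul_eq_mul, map_mul, mul_assoc, ← Finset.mul_sum, h, mul_zero]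

/-- Testing `X` against `δ_{a_i a_j} V`, with `V` the trace of `X` itself, gives `∑ ‖V‖² = 0`. -/
lemma isTraceFree_of_sum_conj_mul {n : ℕ} {X : Tensor n}
    (hX : ∀ T ∈ traceSpan 1 n, ∑ a, starRingEnd ℂ (T a) * X a = 0) : IsTraceFree 1 X := by
  rw [trace_eq_zero_iff_one]
  intro i j hij
  set V : Tensor n := fun a => ∑ k, X (Function.update (Function.update a i k) j k) with hVdef
  have hV : ∀ a k l, V (Function.update (Function.update a i k) j l) = V a := by
    intro a k l
    refine Finset.sum_congr rfl fun m _ => congrArg X ?_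
    rw [Function.update_comm hij, Function.update_idem, Function.update_comm hij.symm,
      Function.update_idem]
  have h1 := hX (fun a => ((1 : Matrix (Fin 3) (Fin 3) ℝ) (a i) (a j) : ℂ) * V a)
    (Submodule.subset_span ⟨i, j, hij, V, hV, fun _ => rfl⟩)
  have h2 := sum_conj_mul_eq hij hV X
  rw [h1, mul_zero] at h2
  have h3 : ∑ a, ‖V a‖ ^ 2 = 0 := by
    have : ((∑ a, ‖V a‖ ^ 2 : ℝ) : ℂ) = 0 := by
      rw [h2]
      push_cast
      refine Finset.sum_congr rfl fun a _ => ?_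
      rw [← Complex.conj_mul']
    exact_mod_cast this
  intro a
  have := (Finset.sum_eq_zero_iff_of_nonneg (fun a _ => sq_nonneg ‖V a‖)).1 h3 a
    (Finset.mem_univ a)
  simpa using this

lemma traceSpan_perm {n : ℕ} {h : Matrix (Fin 3) (Fin 3) ℝ} {T : Tensor n}
    (hT : T ∈ traceSpan h n) (σ : Equiv.Perm (Fin n)) :
    (fun a => T (fun i => a (σ i))) ∈ traceSpan h n := by
  induction hT using Submodule.span_induction with
  | mem T hT =>
    obtain ⟨i, j, hij, V, hV, hTV⟩ := hT
    refine Submodule.subset_span ⟨σ i, σ j, σ.injective.ne hij, fun a => V fun i => a (σ i), ?_,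
      fun a => hTV _⟩
    intro a k l
    refine Eq.trans (congrArg V ?_) (hV (fun i => a (σ i)) k l)
    funext m
    simp [Function.update_apply, σ.injective.eq_iff]
  | zero => exact zero_mem _
  | add T T' _ _ h h' => exact add_mem h h'
  | smul c T _ h => exact Submodule.smul_mem _ c h

lemma IsTraceFree.perm {n : ℕ} {h : Matrix (Fin 3) (Fin 3) ℝ} {T : Tensor n}
    (hT : IsTraceFree h T) (σ : Equiv.Perm (Fin n)) :
    IsTraceFree h (fun a => T (fun i => a (σ i))) := by
  intro i j hij a
  have := hT (σ.symm i) (σ.symm j) (σ.symm.injective.ne hij) (fun m => a (σ m))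
  rw [← this]
  refine Finset.sum_congr rfl fun k _ => Finset.sum_congr rfl fun l _ => ?_
  refine congrArg (((h⁻¹ k l : ℝ) : ℂ) * ·) (congrArg T ?_)
  funext m
  simp [Function.update_apply, Equiv.eq_symm_apply]

lemma eq_zero_of_mem_traceSpan_one {n : ℕ} {X : Tensor n} (hX : IsTraceFree 1 X)
    (hX' : X ∈ traceSpan 1 n) : X = 0 := by
  have h2 := hX.sum_conj_mul hX'
  have h3 : ∑ a, ‖X a‖ ^ 2 = 0 := by
    have : ((∑ a, ‖X a‖ ^ 2 : ℝ) : ℂ) = 0 := by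
      rw [← h2]
      push_cast
      refine Finset.sum_congr rfl fun a _ => ?_
      rw [← Complex.conj_mul']
    exact_mod_cast this
  funext a
  have := (Finset.sum_eq_zero_iff_of_nonneg (fun a _ => sq_nonneg ‖X a‖)).1 h3 a
    (Finset.mem_univ a)
  simpa using this

/-- The component of `symm T` orthogonal to `traceSpan 1 n` is trace-free; only its symmetry needs
an argument. -/
lemma exists_isSTFPart_one {n : ℕ} (T : Tensor n) : ∃ X, IsSTFPart 1 T X := by
  let e := (WithLp.linearEquiv 2 ℂ (Tensor n)).symm
  let W : Submodule ℂ (EuclideanSpace ℂ (Fin n → Fin 3)) :=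
    (traceSpan 1 n).map (e : Tensor n →ₗ[ℂ] EuclideanSpace ℂ (Fin n → Fin 3))
  obtain ⟨y, hy, z, hz, hyz⟩ := W.exists_add_mem_mem_orthogonal (e (symm T))
  obtain ⟨w, hw, rfl⟩ := hy
  have hX : IsTraceFree 1 (e.symm z) := by
    refine isTraceFree_of_sum_conj_mul fun S hS => ?_
    have := (Submodule.mem_orthogonal _ _).1 hz (e S) ⟨S, hS, rfl⟩
    rw [PiLp.inner_apply] at this
    rw [← this]
    refine Finset.sum_congr rfl fun a _ => ?_
    rw [RCLike.inner_apply, mul_comm]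
    rfl
  have hsum : symm T = w + e.symm z := by
    have := congrArg e.symm hyz
    simpa using this
  refine ⟨e.symm z, fun σ a => ?_, hX, ?_⟩
  · set X := e.symm z
    -- The difference between `X` and its permutation is trace-free, and it lies in the trace span
    -- because `symm T` is invariant. It is therefore orthogonal to itself and zero.
    have h1 : IsTraceFree 1 ((fun a => X (fun i => a (σ i))) + (-1 : ℂ) • X) :=
      (hX.perm σ).add (hX.smul _)
    have h2 : (fun a => X (fun i => a (σ i))) + (-1 : ℂ) • X ∈ traceSpan 1 n := by
      have : (fun a => X (fun i => a (σ i))) + (-1 : ℂ) • X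
          = w - fun a => w (fun i => a (σ i)) := by
        funext a
        have e1 := congrFun hsum a
        have e2 := congrFun hsum (fun i => a (σ i))
        rw [isSymm_symm T σ a] at e2
        simp only [Pi.add_apply] at e1 e2
        simp only [Pi.add_apply, Pi.smul_apply, Pi.sub_apply, smul_eq_mul]
        linear_combination e1 - e2
      rw [this]
      exact sub_mem hw (traceSpan_perm hw σ)
    have := congrFun (eq_zero_of_mem_traceSpan_one h1 h2) a
    simp only [Pi.add_apply, Pi.smul_apply, smul_eq_mul, Pi.zero_apply] at this
    linear_combination this
  · rw [hsum]
    simpa using hw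

lemma IsSTFPart.unique_one {n : ℕ} {T X X' : Tensor n} (h : IsSTFPart 1 T X)
    (h' : IsSTFPart 1 T X') : X = X' := by
  have h1 : IsTraceFree 1 (X + (-1 : ℂ) • X') := h.2.1.add (h'.2.1.smul _)
  have h2 : X + (-1 : ℂ) • X' ∈ traceSpan 1 n := by
    have := sub_mem h'.2.2 h.2.2
    convert this using 1
    simp only [neg_smul, one_smul]
    abel
  have := eq_zero_of_mem_traceSpan_one h1 h2
  rw [neg_smul, one_smul] at this
  exact add_neg_eq_zero.1 this

/-- Pulling back by `E⁻¹` turns `Eᵀ E` into the identity and reduces the claim to the flat case. -/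
lemma IsSTFPart.unique {n : ℕ} {E : Matrix (Fin 3) (Fin 3) ℝ} (hE : IsUnit E.det)
    {T X X' : Tensor n} (h : IsSTFPart (E.transpose * E) T X)
    (h' : IsSTFPart (E.transpose * E) T X') : X = X' := by
  have hEi : IsUnit (E⁻¹).det := Matrix.isUnit_nonsing_inv_det E hE
  have e : (E⁻¹).transpose * (E.transpose * E) * E⁻¹ = 1 := by
    rw [mul_assoc, mul_assoc, Matrix.mul_nonsing_inv E hE, mul_one, ← Matrix.transpose_mul,
      Matrix.mul_nonsing_inv E hE, Matrix.transpose_one]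
  have h1 := h.pull hEi
  have h2 := h'.pull hEi
  rw [e] at h1 h2
  have := congrArg (Multipole.pull E) (h1.unique_one h2)
  rwa [pull_pull, pull_pull, Matrix.nonsing_inv_mul E hE, pull_one, pull_one] at this

lemma isSTFPart_pull_stf_one {n : ℕ} {E : Matrix (Fin 3) (Fin 3) ℝ} (hE : IsUnit E.det)
    (T : Tensor n) :
    IsSTFPart (E.transpose * E) T (pull E (stf 1 (pull E⁻¹ T))) := by
  have h := (Classical.epsilon_spec (exists_isSTFPart_one (pull E⁻¹ T))).pull hE
  rwa [pull_pull, Matrix.nonsing_inv_mul E hE, pull_one, mul_one] at h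

lemma isSTFPart_stf {n : ℕ} {E : Matrix (Fin 3) (Fin 3) ℝ} (hE : IsUnit E.det)
    (T : Tensor n) : IsSTFPart (E.transpose * E) T (stf (E.transpose * E) T) :=
  Classical.epsilon_spec (⟨_, isSTFPart_pull_stf_one hE T⟩ : ∃ X, IsSTFPart _ T X)

/-- Confines the arbitrary choice in `stf` to one fixed linear map, the flat projection, so that all
dependence on the metric is explicit through `E`. -/
lemma stf_eq_pull {n : ℕ} {E : Matrix (Fin 3) (Fin 3) ℝ} (hE : IsUnit E.det)
    (T : Tensor n) : stf (E.transpose * E) T = pull E (stf 1 (pull E⁻¹ T)) :=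
  (isSTFPart_stf hE T).unique hE (isSTFPart_pull_stf_one hE T)

lemma isSTFPart_stf_one {n : ℕ} (T : Tensor n) : IsSTFPart 1 T (stf 1 T) :=
  Classical.epsilon_spec (exists_isSTFPart_one T)

/-- The symmetric trace-free part for the flat metric, as a linear map. -/
def stfOneₗ (n : ℕ) : Tensor n →ₗ[ℂ] Tensor n where
  toFun := stf 1
  map_add' T T' := (isSTFPart_stf_one _).unique_one
    ((isSTFPart_stf_one T).add (isSTFPart_stf_one T'))
  map_smul' c T := (isSTFPart_stf_one _).unique_one ((isSTFPart_stf_one T).smul c)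

/-! ### Full contraction with a vector -/

/-- The full contraction `v^{a₁} ⋯ v^{aₙ} T_{a₁…aₙ}`. -/
def contract {n : ℕ} (T : Tensor n) (v : Fin 3 → ℂ) : ℂ := ∑ a, (∏ i, v (a i)) * T a

lemma contract_add {n : ℕ} (T T' : Tensor n) (v : Fin 3 → ℂ) :
    contract (T + T') v = contract T v + contract T' v := by
  simp [contract, mul_add, Finset.sum_add_distrib]

lemma contract_smul {n : ℕ} (c : ℂ) (T : Tensor n) (v : Fin 3 → ℂ) :
    contract (c • T) v = c * contract T v := by
  simp only [contract, Pi.smul_apply, smul_eq_mul, Finset.mul_sum]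
  exact Finset.sum_congr rfl fun a _ => by ring

lemma contract_perm {n : ℕ} (T : Tensor n) (v : Fin 3 → ℂ) (σ : Equiv.Perm (Fin n)) :
    contract (fun a => T (fun i => a (σ i))) v = contract T v := by
  refine (Fintype.sum_equiv (Equiv.arrowCongr σ (Equiv.refl (Fin 3))) _ _ fun b => ?_).symm
  congr 1
  · simp only [Equiv.arrowCongr_apply, Function.comp_apply, Equiv.refl_apply]
    exact (Equiv.prod_comp σ.symm (fun x => v (b x))).symm
  · simp [Equiv.arrowCongr]

lemma contract_symm {n : ℕ} (T : Tensor n) (v : Fin 3 → ℂ) :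
    contract (symm T) v = contract T v := by
  have h : contract (symm T) v = ((n.factorial : ℂ))⁻¹ *
      ∑ σ : Equiv.Perm (Fin n), contract (fun a => T (fun i => a (σ i))) v := by
    simp only [contract, symm, Finset.mul_sum]
    rw [Finset.sum_comm]
    exact Finset.sum_congr rfl fun σ _ => Finset.sum_congr rfl fun a _ => by ring
  rw [h]
  simp only [contract_perm, Finset.sum_const, Finset.card_univ, Fintype.card_perm,
    Fintype.card_fin, nsmul_eq_mul]
  rw [← mul_assoc, inv_mul_cancel₀ (by exact_mod_cast n.factorial_ne_zero), one_mul]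

/-- Each generator carries a factor `h_{a_i a_j}`, which contracts to `h(v, v) = 0`. -/
lemma contract_eq_zero_of_mem_traceSpan {n : ℕ} {h : Matrix (Fin 3) (Fin 3) ℝ} {T : Tensor n}
    (hT : T ∈ traceSpan h n) {v : Fin 3 → ℂ} (hv : ∑ k, ∑ l, (h k l : ℂ) * v k * v l = 0) :
    contract T v = 0 := by
  induction hT using Submodule.span_induction with
  | mem T hT =>
    obtain ⟨i, j, hij, V, hV, hTV⟩ := hT
    have h9 := sum_sum_update_update i j (fun a => (∏ i, v (a i)) * T a)
    have : ∀ b, ∑ k, ∑ l, (fun a => (∏ i, v (a i)) * T a)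
        (Function.update (Function.update b i k) j l)
        = (∏ m ∈ (Finset.univ.erase i).erase j, v (b m)) * V b
          * ∑ k, ∑ l, (h k l : ℂ) * v k * v l := by
      intro b
      rw [Finset.mul_sum]
      refine Finset.sum_congr rfl fun k _ => ?_
      rw [Finset.mul_sum]
      refine Finset.sum_congr rfl fun l _ => ?_
      simp only
      rw [hTV, hV, prod_update_update hij (fun _ x => v x)]
      simp [hij]
      ring
    simp only [this, hv, mul_zero, Finset.sum_const_zero] at h9
    simpa [contract] using h9.symm
  | zero => simp [contract]
  | add T T' _ _ h h' => rw [contract_add, h, h', add_zero]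
  | smul c T _ h => rw [contract_smul, h, mul_zero]

/-- This is what makes the recursion scalar: on null vectors the projection `C` can be omitted. -/
lemma IsSTFPart.contract_eq {n : ℕ} {h : Matrix (Fin 3) (Fin 3) ℝ} {T X : Tensor n}
    (hX : IsSTFPart h T X) {v : Fin 3 → ℂ} (hv : ∑ k, ∑ l, (h k l : ℂ) * v k * v l = 0) :
    contract X v = contract T v := by
  have h1 := contract_eq_zero_of_mem_traceSpan hX.2.2 hv
  have h2 : symm T = X + (symm T - X) := by abel
  rw [← contract_symm T, h2, contract_add, h1, add_zero]

/-! ### Smoothness of the Geroch–Hansen tensors -/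

lemma ContDiffOn.pderiv {E : Type*} [NormedAddCommGroup E] [NormedSpace ℝ E] {U : Set Pt}
    (hU : IsOpen U) {g : Pt → E} (hg : ContDiffOn ℝ ∞ g U) (i : Fin 3) :
    ContDiffOn ℝ ∞ (Multipole.pderiv i g) U :=
  (hg.fderiv_of_isOpen hU (m := ∞) (by simp)).clm_apply contDiffOn_const

lemma contDiffOn_inv_apply {U : Set Pt} {A : Pt → Matrix (Fin 3) (Fin 3) ℝ}
    (hA : ∀ i j, ContDiffOn ℝ ∞ (fun p => A p i j) U) (hdet : ∀ p ∈ U, (A p).det ≠ 0)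
    (i j : Fin 3) : ContDiffOn ℝ ∞ (fun p => (A p)⁻¹ i j) U := by
  have hd : ContDiffOn ℝ ∞ (fun p => (A p).det) U := by
    simp only [Matrix.det_fin_three]
    fun_prop (disch := exact hA _ _)
  have e : (fun p => (A p)⁻¹ i j) = fun p => ((A p).det)⁻¹ * (A p).adjugate i j := by
    funext p
    rw [Matrix.inv_def]
    simp
  rw [e]
  refine (hd.inv hdet).mul ?_
  simp only [Matrix.adjugate_fin_three]
  fin_cases i <;> fin_cases j <;> simp <;> fun_prop (disch := exact hA _ _)

lemma contDiffOn_christoffel {U : Set Pt} (hU : IsOpen U) {h : Pt → Matrix (Fin 3) (Fin 3) ℝ}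
    (hh : IsSmoothMetricOn U h) (k i j : Fin 3) : ContDiffOn ℝ ∞ (christoffel h k i j) U := by
  refine contDiffOn_const.mul (ContDiffOn.sum fun l _ => ContDiffOn.mul
    (contDiffOn_inv_apply hh.1 (fun p hp => (hh.2 p hp).det_pos.ne') k l) ?_)
  exact ((ContDiffOn.pderiv hU (hh.1 _ _) _).add (ContDiffOn.pderiv hU (hh.1 _ _) _)).sub
    (ContDiffOn.pderiv hU (hh.1 _ _) _)

lemma contDiffOn_ricci {U : Set Pt} (hU : IsOpen U) {h : Pt → Matrix (Fin 3) (Fin 3) ℝ}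
    (hh : IsSmoothMetricOn U h) (i j : Fin 3) : ContDiffOn ℝ ∞ (ricci h i j) U := by
  have hΓ := contDiffOn_christoffel hU hh
  refine (ContDiffOn.sum fun k _ => (ContDiffOn.pderiv hU (hΓ _ _ _) _).sub
    (ContDiffOn.pderiv hU (hΓ _ _ _) _)).add (ContDiffOn.sum fun k _ => ContDiffOn.sum fun l _ =>
      ((hΓ _ _ _).mul (hΓ _ _ _)).sub ((hΓ _ _ _).mul (hΓ _ _ _)))

lemma contDiffOn_ofReal {U : Set Pt} {g : Pt → ℝ} (hg : ContDiffOn ℝ ∞ g U) :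
    ContDiffOn ℝ ∞ (fun p => (g p : ℂ)) U :=
  Complex.ofRealCLM.contDiff.comp_contDiffOn hg

lemma contDiffOn_covD {U : Set Pt} (hU : IsOpen U) {h : Pt → Matrix (Fin 3) (Fin 3) ℝ}
    (hh : IsSmoothMetricOn U h) {n : ℕ} {T : Pt → Tensor n}
    (hT : ∀ a, ContDiffOn ℝ ∞ (fun p => T p a) U) (a : Fin (n + 1) → Fin 3) :
    ContDiffOn ℝ ∞ (fun p => covD h T p a) U :=
  (ContDiffOn.pderiv hU (hT _) _).sub (ContDiffOn.sum fun _ _ => ContDiffOn.sum fun _ _ =>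
    (contDiffOn_ofReal (contDiffOn_christoffel hU hh _ _ _)).mul (hT _))

lemma contDiffOn_pull {U : Set Pt} {A : Pt → Matrix (Fin 3) (Fin 3) ℝ}
    (hA : ∀ i j, ContDiffOn ℝ ∞ (fun p => A p i j) U) {n : ℕ} {T : Pt → Tensor n}
    (hT : ∀ a, ContDiffOn ℝ ∞ (fun p => T p a) U) (a : Fin n → Fin 3) :
    ContDiffOn ℝ ∞ (fun p => pull (A p) (T p) a) U :=
  ContDiffOn.sum fun _ _ => (contDiffOn_prod fun _ _ => contDiffOn_ofReal (hA _ _)).mul (hT _)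

/-- The upper triangular matrix `E` with `Eᵀ E = A` for a positive definite matrix `A`. -/
def cholesky (A : Matrix (Fin 3) (Fin 3) ℝ) : Matrix (Fin 3) (Fin 3) ℝ :=
  let a := √(A 0 0)
  let d := √((A 0 0 * A 1 1 - A 0 1 ^ 2) / A 0 0)
  !![a, A 0 1 / a, A 0 2 / a;
    0, d, (A 1 2 - A 0 1 * A 0 2 / A 0 0) / d;
    0, 0, √(A.det / (A 0 0 * A 1 1 - A 0 1 ^ 2))]

lemma posDef_minors {A : Matrix (Fin 3) (Fin 3) ℝ} (hA : A.PosDef) :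
    0 < A 0 0 ∧ 0 < A 0 0 * A 1 1 - A 0 1 ^ 2 ∧ 0 < A.det := by
  refine ⟨hA.diag_pos, ?_, hA.det_pos⟩
  have h := (hA.submatrix (e := ![0, 1]) (by decide)).det_pos
  have hs : A 1 0 = A 0 1 := hA.1.apply 0 1
  rw [Matrix.det_fin_two] at h
  simp [hs] at h
  linarith

lemma det_cholesky_ne_zero {A : Matrix (Fin 3) (Fin 3) ℝ} (hA : A.PosDef) :
    (cholesky A).det ≠ 0 := by
  obtain ⟨h1, h2, h3⟩ := posDef_minors hA
  have : (cholesky A).det = √(A 0 0) * √((A 0 0 * A 1 1 - A 0 1 ^ 2) / A 0 0)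
      * √(A.det / (A 0 0 * A 1 1 - A 0 1 ^ 2)) := by
    rw [Matrix.det_fin_three]
    simp [cholesky]
  rw [this]
  positivity

lemma cholesky_transpose_mul {A : Matrix (Fin 3) (Fin 3) ℝ} (hA : A.PosDef) :
    (cholesky A).transpose * cholesky A = A := by
  obtain ⟨h1, h2, h3⟩ := posDef_minors hA
  have s1 : A 1 0 = A 0 1 := hA.1.apply 0 1
  have s2 : A 2 0 = A 0 2 := hA.1.apply 0 2
  have s3 : A 2 1 = A 1 2 := hA.1.apply 1 2
  have hd := Matrix.det_fin_three A
  rw [s1, s2, s3] at hd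
  have q1 : √(A 0 0) ^ 2 = A 0 0 := Real.sq_sqrt h1.le
  have q2 : √((A 0 0 * A 1 1 - A 0 1 ^ 2) / A 0 0) ^ 2 = (A 0 0 * A 1 1 - A 0 1 ^ 2) / A 0 0 :=
    Real.sq_sqrt (by positivity)
  have q3 : √(A.det / (A 0 0 * A 1 1 - A 0 1 ^ 2)) ^ 2
      = A.det / (A 0 0 * A 1 1 - A 0 1 ^ 2) := Real.sq_sqrt (by positivity)
  have p1 : √(A 0 0) ≠ 0 := by positivity
  have p2 : √((A 0 0 * A 1 1 - A 0 1 ^ 2) / A 0 0) ≠ 0 := by positivity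
  have h1' := h1.ne'
  have h2' := h2.ne'
  unfold cholesky
  generalize √(A.det / (A 0 0 * A 1 1 - A 0 1 ^ 2)) = f at *
  generalize √((A 0 0 * A 1 1 - A 0 1 ^ 2) / A 0 0) = d at *
  generalize √(A 0 0) = a at *
  ext i j
  rw [Matrix.mul_apply, Fin.sum_univ_three]
  fin_cases i <;> fin_cases j <;> simp [s1, s2, s3]
  · rw [← q1]; ring
  · field_simp
  · field_simp
  · field_simp
  · rw [div_mul_div_comm, ← sq, ← sq, ← sq, q1, q2]
    field_simp
    ring
  · rw [div_mul_div_comm, ← sq, q1]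
    field_simp
    ring
  · field_simp
  · rw [div_mul_div_comm, ← sq, q1]
    field_simp
    ring
  · rw [div_mul_div_comm, div_mul_div_comm, ← sq, ← sq, ← sq, ← sq, ← sq, q1, q2, q3, hd]
    field_simp
    ring

lemma contDiffOn_cholesky {U : Set Pt} {h : Pt → Matrix (Fin 3) (Fin 3) ℝ}
    (hh : IsSmoothMetricOn U h) (i j : Fin 3) :
    ContDiffOn ℝ ∞ (fun p => cholesky (h p) i j) U := by
  have hs := hh.1
  have m1 : ∀ p ∈ U, h p 0 0 ≠ 0 := fun p hp => (posDef_minors (hh.2 p hp)).1.ne'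
  have m2 : ∀ p ∈ U, h p 0 0 * h p 1 1 - h p 0 1 ^ 2 ≠ 0 :=
    fun p hp => (posDef_minors (hh.2 p hp)).2.1.ne'
  have m3 : ∀ p ∈ U, (h p).det ≠ 0 := fun p hp => (posDef_minors (hh.2 p hp)).2.2.ne'
  have hd : ContDiffOn ℝ ∞ (fun p => (h p).det) U := by
    simp only [Matrix.det_fin_three]
    fun_prop (disch := exact hs _ _)
  have hm : ContDiffOn ℝ ∞ (fun p => h p 0 0 * h p 1 1 - h p 0 1 ^ 2) U := by
    fun_prop (disch := exact hs _ _)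
  have ha : ContDiffOn ℝ ∞ (fun p => √(h p 0 0)) U := (hs 0 0).sqrt m1
  have hd' : ContDiffOn ℝ ∞ (fun p => √((h p 0 0 * h p 1 1 - h p 0 1 ^ 2) / h p 0 0)) U :=
    (hm.div (hs 0 0) m1).sqrt fun p hp => div_ne_zero (m2 p hp) (m1 p hp)
  have pa : ∀ p ∈ U, √(h p 0 0) ≠ 0 := fun p hp =>
    (Real.sqrt_pos.2 (posDef_minors (hh.2 p hp)).1).ne'
  have pd : ∀ p ∈ U, √((h p 0 0 * h p 1 1 - h p 0 1 ^ 2) / h p 0 0) ≠ 0 := fun p hp =>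
    (Real.sqrt_pos.2 (div_pos (posDef_minors (hh.2 p hp)).2.1 (posDef_minors (hh.2 p hp)).1)).ne'
  unfold cholesky
  fin_cases i <;> fin_cases j <;> simp
  · exact ha
  · exact (hs 0 1).div ha pa
  · exact (hs 0 2).div ha pa
  · exact contDiffOn_const
  · exact hd'
  · exact ((hs 1 2).sub (((hs 0 1).mul (hs 0 2)).div (hs 0 0) m1)).div hd' pd
  · exact contDiffOn_const
  · exact contDiffOn_const
  · exact (hd.div hm m2).sqrt fun p hp => div_ne_zero (m3 p hp) (m2 p hp)

lemma isSTFPart_stf_of_posDef {n : ℕ} {A : Matrix (Fin 3) (Fin 3) ℝ} (hA : A.PosDef)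
    (T : Tensor n) : IsSTFPart A T (stf A T) := by
  have := isSTFPart_stf (isUnit_iff_ne_zero.2 (det_cholesky_ne_zero hA)) T
  rwa [cholesky_transpose_mul hA] at this

/-- By `stf_eq_pull` the projection is a pullback by `E⁻¹`, a constant linear map and a pullback by
`E`; with the Cholesky factor as `E` all of these depend smoothly on the point. -/
lemma contDiffOn_stf {U : Set Pt} {h : Pt → Matrix (Fin 3) (Fin 3) ℝ}
    (hh : IsSmoothMetricOn U h) {n : ℕ} {T : Pt → Tensor n}
    (hT : ∀ a, ContDiffOn ℝ ∞ (fun p => T p a) U) (a : Fin n → Fin 3) :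
    ContDiffOn ℝ ∞ (fun p => stf (h p) (T p) a) U := by
  have hE := contDiffOn_cholesky hh
  have hE' := contDiffOn_inv_apply hE fun p hp => det_cholesky_ne_zero (hh.2 p hp)
  have h1 : ContDiffOn ℝ ∞ (fun p => pull (cholesky (h p))⁻¹ (T p)) U :=
    contDiffOn_pi.2 fun a => contDiffOn_pull hE' hT a
  have h2 : ContDiffOn ℝ ∞ (fun p => stfOneₗ n (pull (cholesky (h p))⁻¹ (T p))) U :=
    ((LinearMap.toContinuousLinearMap (stfOneₗ n)).restrictScalars ℝ).contDiff.comp_contDiffOn h1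
  refine (contDiffOn_pull hE (contDiffOn_pi.1 h2) a).congr fun p hp => ?_
  have := stf_eq_pull (isUnit_iff_ne_zero.2 (det_cholesky_ne_zero (hh.2 p hp))) (T p)
  rw [cholesky_transpose_mul (hh.2 p hp)] at this
  rw [this]
  rfl

lemma contDiffOn_gerochHansen {U : Set Pt} (hU : IsOpen U) {h : Pt → Matrix (Fin 3) (Fin 3) ℝ}
    (hh : IsSmoothMetricOn U h) {φ : Pt → ℂ} (hφ : ContDiffOn ℝ ∞ φ U) (n : ℕ) :
    ∀ a, ContDiffOn ℝ ∞ (fun p => gerochHansen h φ n p a) U := by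
  induction n using Nat.twoStepInduction with
  | zero => exact fun _ => hφ
  | one => exact contDiffOn_stf hh (contDiffOn_covD hU hh fun _ => hφ)
  | more n h0 h1 =>
    refine contDiffOn_stf hh fun a => (contDiffOn_covD hU hh h1 a).sub ?_
    exact (contDiffOn_const.mul (contDiffOn_ofReal (contDiffOn_ricci hU hh _ _))).mul (h0 _)

lemma isSymm_isTraceFree_gerochHansen {U : Set Pt} {h : Pt → Matrix (Fin 3) (Fin 3) ℝ}
    (hh : IsSmoothMetricOn U h) (φ : Pt → ℂ) (n : ℕ) {p : Pt} (hp : p ∈ U) :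
    IsSymm (gerochHansen h φ n p) ∧ IsTraceFree (h p) (gerochHansen h φ n p) := by
  match n with
  | 0 => exact ⟨fun _ _ => rfl, fun i => i.elim0⟩
  | 1 =>
    have := isSTFPart_stf_of_posDef (hh.2 p hp) (covD h (gerochHansen h φ 0) p)
    exact ⟨this.1, this.2.1⟩
  | n + 2 =>
    have := isSTFPart_stf_of_posDef (hh.2 p hp) (fun a =>
      covD h (gerochHansen h φ (n + 1)) p a
        - (((n : ℂ) + 1) * (2 * (n : ℂ) + 1) / 2) * (ricci h (a 0) (a 1) p : ℂ)
          * gerochHansen h φ n p (fun i => a i.succ.succ))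
    exact ⟨this.1, this.2.1⟩

/-! ### Contracting the recursion with a vector -/

lemma sum_cons {n : ℕ} (F : (Fin (n + 1) → Fin 3) → ℂ) :
    ∑ a, F a = ∑ m, ∑ b : Fin n → Fin 3, F (Fin.cons m b) := by
  rw [← Fintype.sum_prod_type']
  exact (Fintype.sum_equiv (Fin.consEquiv fun _ => Fin 3) _ _ fun x => rfl).symm

lemma contract_succ {n : ℕ} (T : Tensor (n + 1)) (v : Fin 3 → ℂ) :
    contract T v = ∑ m, v m * contract (fun b => T (Fin.cons m b)) v := by
  rw [contract, sum_cons]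
  refine Finset.sum_congr rfl fun m _ => ?_
  rw [contract, Finset.mul_sum]
  refine Finset.sum_congr rfl fun b _ => ?_
  rw [Fin.prod_univ_succ]
  simp [mul_assoc]

lemma prod_update {n : ℕ} (i : Fin n) (v : Fin 3 → ℂ) (b : Fin n → Fin 3) (k : Fin 3) :
    ∏ m, v (Function.update b i k m) = v k * ∏ m ∈ Finset.univ.erase i, v (b m) := by
  rw [← Finset.mul_prod_erase Finset.univ _ (Finset.mem_univ i)]
  congr 1
  · simp
  · refine Finset.prod_congr rfl fun m hm => ?_
    rw [Function.update_of_ne (Finset.mem_erase.1 hm).1]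

/-- Summing slot `i` first applies `G` to `v`, which is an eigenvector with eigenvalue `c`; the
remaining sum is the full contraction. -/
lemma sum_prod_mul_update {n : ℕ} (i : Fin n) (T : Tensor n) {v : Fin 3 → ℂ}
    {G : Fin 3 → Fin 3 → ℂ} {c : ℂ} (hG : ∀ k, ∑ j, G k j * v j = c * v k) :
    ∑ b : Fin n → Fin 3, (∏ m, v (b m)) * ∑ k, G k (b i) * T (Function.update b i k)
      = c * contract T v := by
  have h1 := sum_sum_update i
    (fun b => (∏ m, v (b m)) * ∑ k, G k (b i) * T (Function.update b i k))
  have h2 := sum_sum_update i (fun b => (∏ m, v (b m)) * T b)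
  have h3 : ∀ b, ∑ j, (fun b => (∏ m, v (b m)) * ∑ k, G k (b i) * T (Function.update b i k))
      (Function.update b i j)
      = c * ∑ k, (fun b => (∏ m, v (b m)) * T b) (Function.update b i k) := by
    intro b
    simp only [prod_update, Function.update_idem, Function.update_self, Finset.mul_sum]
    rw [Finset.sum_comm]
    refine Finset.sum_congr rfl fun k _ => ?_
    have := hG k
    calc _ = (∑ j, G k j * v j) * ((∏ m ∈ Finset.univ.erase i, v (b m))
          * T (Function.update b i k)) := by
          rw [Finset.sum_mul]
          exact Finset.sum_congr rfl fun j _ => by ring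
      _ = _ := by rw [this]; ring
  rw [Finset.sum_congr rfl fun b _ => h3 b, ← Finset.mul_sum, h2] at h1
  rw [contract]
  linear_combination (-1 / 3 : ℂ) * h1

lemma pderiv_finset_sum {E ι : Type*} [NormedAddCommGroup E] [NormedSpace ℝ E] (s : Finset ι)
    {g : ι → Pt → E} {p : Pt} (hg : ∀ a ∈ s, DifferentiableAt ℝ (g a) p) (i : Fin 3) :
    pderiv i (fun q => ∑ a ∈ s, g a q) p = ∑ a ∈ s, pderiv i (g a) p := by
  simp only [pderiv]
  rw [fderiv_fun_sum hg, sum_apply]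

lemma pderiv_const_mul {g : Pt → ℂ} {p : Pt} (hg : DifferentiableAt ℝ g p) (c : ℂ) (i : Fin 3) :
    pderiv i (fun q => c * g q) p = c * pderiv i g p := by
  simp only [pderiv]
  rw [fderiv_const_mul hg]
  simp

lemma pderiv_contract {n : ℕ} {T : Pt → Tensor n} {p : Pt}
    (hT : ∀ a, DifferentiableAt ℝ (fun q => T q a) p) (v : Fin 3 → ℂ) (i : Fin 3) :
    pderiv i (fun q => contract (T q) v) p
      = contract (fun a => pderiv i (fun q => T q a) p) v := by
  simp only [contract]
  rw [pderiv_finset_sum _ fun a _ => (hT a).const_mul _]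
  exact Finset.sum_congr rfl fun a _ => pderiv_const_mul (hT a) _ _

/-- The components of `v` are constant, so contraction commutes with `∂_i`. By `hv` each of the `n`
connection terms contributes `c` times the full contraction. -/
lemma contract_covD {n : ℕ} {h : Pt → Matrix (Fin 3) (Fin 3) ℝ} {T : Pt → Tensor n} {p : Pt}
    (hT : ∀ a, DifferentiableAt ℝ (fun q => T q a) p) {v : Fin 3 → ℂ} {c : ℂ}
    (hv : ∀ k, ∑ i, ∑ j, (christoffel h k i j p : ℂ) * v i * v j = c * v k) :
    contract (covD h T p) v
      = ∑ i, v i * pderiv i (fun q => contract (T q) v) p - n * c * contract (T p) v := by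
  have hG : ∀ k, ∑ j, (∑ m, v m * (christoffel h k m j p : ℂ)) * v j = c * v k := by
    intro k
    rw [← hv k, Finset.sum_comm]
    refine Finset.sum_congr rfl fun j _ => ?_
    rw [Finset.sum_mul]
    exact Finset.sum_congr rfl fun m _ => by ring
  have h2 : ∀ m, contract (fun b => covD h T p (Fin.cons m b)) v
      = pderiv m (fun q => contract (T q) v) p
        - ∑ i, ∑ b : Fin n → Fin 3, (∏ x, v (b x)) *
          ∑ k, (christoffel h k m (b i) p : ℂ) * T p (Function.update b i k) := by
    intro m
    rw [pderiv_contract hT, Finset.sum_comm]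
    simp only [contract]
    rw [← Finset.sum_sub_distrib]
    refine Finset.sum_congr rfl fun b _ => ?_
    rw [← Finset.mul_sum, ← mul_sub]
    simp [covD]
  rw [contract_succ]
  simp only [h2, mul_sub, Finset.sum_sub_distrib]
  congr 1
  have h3 : ∀ i : Fin n, ∑ b : Fin n → Fin 3, (∏ x, v (b x)) *
      ∑ k, (∑ m, v m * (christoffel h k m (b i) p : ℂ)) * T p (Function.update b i k)
      = c * contract (T p) v := fun i =>
    sum_prod_mul_update i (T p) (G := fun k j => ∑ m, v m * (christoffel h k m j p : ℂ)) hG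
  calc _ = ∑ i : Fin n, ∑ b : Fin n → Fin 3, (∏ x, v (b x)) *
      ∑ k, (∑ m, v m * (christoffel h k m (b i) p : ℂ)) * T p (Function.update b i k) := by
        simp only [Finset.mul_sum, Finset.sum_mul]
        rw [Finset.sum_comm]
        refine Finset.sum_congr rfl fun i _ => ?_
        rw [Finset.sum_comm]
        refine Finset.sum_congr rfl fun b _ => ?_
        rw [Finset.sum_comm]
        refine Finset.sum_congr rfl fun k _ => Finset.sum_congr rfl fun m _ => ?_
        ring
    _ = _ := by simp [h3, mul_assoc]

lemma contract_ricci_term {n : ℕ} (r : ℂ) (R : Fin 3 → Fin 3 → ℂ) (P : Tensor n)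
    (v : Fin 3 → ℂ) :
    contract (n := n + 2) (fun a => r * R (a 0) (a 1) * P (fun i => a i.succ.succ)) v
      = r * (∑ i, ∑ j, R i j * v i * v j) * contract P v := by
  rw [contract_succ]
  simp only [contract_succ (n := n)]
  simp only [Finset.mul_sum, Finset.sum_mul]
  refine Finset.sum_congr rfl fun i _ => Finset.sum_congr rfl fun j _ => ?_
  have : (fun b : Fin n → Fin 3 => r * R ((Fin.cons i (Fin.cons j b) : Fin (n + 2) → Fin 3) 0)
      ((Fin.cons i (Fin.cons j b) : Fin (n + 2) → Fin 3) 1)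
      * P (fun m => (Fin.cons i (Fin.cons j b) : Fin (n + 2) → Fin 3) m.succ.succ))
      = (r * R i j) • P := by
    funext b
    rfl
  rw [this, contract_smul]
  ring

lemma contract_gerochHansen_one {U : Set Pt} (hU : IsOpen U)
    {h : Pt → Matrix (Fin 3) (Fin 3) ℝ} (hh : IsSmoothMetricOn U h) {φ : Pt → ℂ}
    (hφ : ContDiffOn ℝ ∞ φ U) {p : Pt} (hp : p ∈ U) {v : Fin 3 → ℂ}
    (hnull : ∑ k, ∑ l, (h p k l : ℂ) * v k * v l = 0) {c : ℂ}
    (hv : ∀ k, ∑ i, ∑ j, (christoffel h k i j p : ℂ) * v i * v j = c * v k) :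
    contract (gerochHansen h φ 1 p) v
      = ∑ i, v i * pderiv i (fun q => contract (gerochHansen h φ 0 q) v) p := by
  have hd := fun a => ((contDiffOn_gerochHansen hU hh hφ 0 a).contDiffAt
    (hU.mem_nhds hp)).differentiableAt (by simp)
  have h1 := (isSTFPart_stf_of_posDef (hh.2 p hp)
    (covD h (gerochHansen h φ 0) p)).contract_eq hnull
  rw [contract_covD hd hv] at h1
  rw [Nat.cast_zero, zero_mul, zero_mul, sub_zero] at h1
  exact h1

lemma contract_gerochHansen_add_two {U : Set Pt} (hU : IsOpen U)
    {h : Pt → Matrix (Fin 3) (Fin 3) ℝ} (hh : IsSmoothMetricOn U h) {φ : Pt → ℂ}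
    (hφ : ContDiffOn ℝ ∞ φ U) {p : Pt} (hp : p ∈ U) {v : Fin 3 → ℂ}
    (hnull : ∑ k, ∑ l, (h p k l : ℂ) * v k * v l = 0) {c : ℂ}
    (hv : ∀ k, ∑ i, ∑ j, (christoffel h k i j p : ℂ) * v i * v j = c * v k) (n : ℕ) :
    contract (gerochHansen h φ (n + 2) p) v
      = ∑ i, v i * pderiv i (fun q => contract (gerochHansen h φ (n + 1) q) v) p
        - ((n : ℂ) + 1) * c * contract (gerochHansen h φ (n + 1) p) v
        - (((n : ℂ) + 1) * (2 * (n : ℂ) + 1) / 2)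
          * (∑ i, ∑ j, (ricci h i j p : ℂ) * v i * v j) * contract (gerochHansen h φ n p) v := by
  have hd := fun a => ((contDiffOn_gerochHansen hU hh hφ (n + 1) a).contDiffAt
    (hU.mem_nhds hp)).differentiableAt (by simp)
  have h1 := (isSTFPart_stf_of_posDef (hh.2 p hp) (fun a =>
      covD h (gerochHansen h φ (n + 1)) p a
        - (((n : ℂ) + 1) * (2 * (n : ℂ) + 1) / 2) * (ricci h (a 0) (a 1) p : ℂ)
          * gerochHansen h φ n p (fun i => a i.succ.succ))).contract_eq hnull
  have h2 := contract_add (covD h (gerochHansen h φ (n + 1)) p)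
    ((-1 : ℂ) • fun a => (((n : ℂ) + 1) * (2 * (n : ℂ) + 1) / 2) * (ricci h (a 0) (a 1) p : ℂ)
          * gerochHansen h φ n p (fun i => a i.succ.succ)) v
  rw [contract_smul, contract_ricci_term _ (fun i j => (ricci h i j p : ℂ)),
    contract_covD hd hv] at h2
  refine (h1.trans ?_).trans (h2.trans ?_)
  · congr 1
    funext a
    simp [sub_eq_add_neg]
  · push_cast
    ring

/-! ### The Levi-Civita connection off the axis -/

/-- The rotation field `x ∂_y - y ∂_x`, which is `ρ² dφ` with its index lowered by the flat
metric. -/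
def rotField (q : Pt) : Fin 3 → ℝ := ![-q 1, q 0, 0]

/-- The derivative `∂_i v_k` of the rotation field. -/
def rotDeriv (k i : Fin 3) : ℝ := ![![0, -1, 0], ![1, 0, 0], ![0, 0, 0]] k i

/-- The horizontal position `(x, y, 0)`. -/
def horiz (q : Pt) : Fin 3 → ℝ := ![q 0, q 1, 0]

/-- The Kronecker delta. -/
def kron (i j : Fin 3) : ℝ := if i = j then 1 else 0

/-- The function `S` with `h = e^{2κ} (δ + S v ⊗ v)` off the axis. -/
def twist (β : Pt → ℝ) (q : Pt) : ℝ := (Real.exp (-2 * β q) - 1) / (q 0 ^ 2 + q 1 ^ 2)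

lemma rho_sq (q : Pt) : rho q ^ 2 = q 0 ^ 2 + q 1 ^ 2 := Real.sq_sqrt (by positivity)

lemma rho_ne_zero {q : Pt} (hq : q 0 ^ 2 + q 1 ^ 2 ≠ 0) : rho q ≠ 0 := by
  intro h
  apply hq
  rw [← rho_sq, h]
  simp

/-- The flat metric is the case `β = κ = 0`, so the bracket differs from it by `(e^{-2β} - 1) ρ²
dφ²`, and `dφ = v / ρ²` for the rotation field `v`. This presents `h` as a conformal rank-one
perturbation of the Cartesian metric. -/
lemma metric_eq {U : Set Pt} {h : Pt → Matrix (Fin 3) (Fin 3) ℝ} {β κ : Pt → ℝ}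
    (hform : HasAxisymmetricForm U h β κ) {q : Pt} (hq : q ∈ U) (hq' : q 0 ^ 2 + q 1 ^ 2 ≠ 0)
    (i j : Fin 3) :
    h q i j = Real.exp (2 * κ q) * (kron i j + twist β q * rotField q i * rotField q j) := by
  have hr := rho_ne_zero hq'
  rw [hform q hq hr]
  congr 1
  have e := rho_sq q
  have hx : q 0 ^ 2 = rho q ^ 2 - q 1 ^ 2 := by rw [e]; ring
  rw [twist, ← e, dPhi, dRho]
  generalize rho q = r at *
  fin_cases i <;> fin_cases j <;> simp [dZ, kron, rotField] <;> field_simp <;>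
    first | ring1 | linear_combination hx

lemma one_add_twist (β : Pt → ℝ) {q : Pt} (hq : q 0 ^ 2 + q 1 ^ 2 ≠ 0) :
    1 + twist β q * (q 0 ^ 2 + q 1 ^ 2) = Real.exp (-2 * β q) := by
  rw [twist, div_mul_cancel₀ _ hq]
  ring

lemma exp_mul_one_add_twist (β : Pt → ℝ) {q : Pt} (hq : q 0 ^ 2 + q 1 ^ 2 ≠ 0) :
    Real.exp (2 * β q) * (1 + twist β q * (q 0 ^ 2 + q 1 ^ 2)) = 1 := by
  rw [one_add_twist β hq, ← Real.exp_add]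
  simp

/-- The Sherman–Morrison formula, with `|v|² = ρ²` and `(1 + S ρ²)⁻¹ = e^{2β}`. -/
lemma inv_metric_eq {U : Set Pt} {h : Pt → Matrix (Fin 3) (Fin 3) ℝ} {β κ : Pt → ℝ}
    (hform : HasAxisymmetricForm U h β κ) {q : Pt} (hq : q ∈ U) (hq' : q 0 ^ 2 + q 1 ^ 2 ≠ 0)
    (i j : Fin 3) :
    (h q)⁻¹ i j = Real.exp (-(2 * κ q)) *
      (kron i j - twist β q * Real.exp (2 * β q) * rotField q i * rotField q j) := by
  have e : (h q)⁻¹ = Matrix.of fun i j => Real.exp (-(2 * κ q)) *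
      (kron i j - twist β q * Real.exp (2 * β q) * rotField q i * rotField q j) := by
    refine Matrix.inv_eq_right_inv ?_
    have hD := exp_mul_one_add_twist β hq'
    have hK : Real.exp (2 * κ q) * Real.exp (-(2 * κ q)) = 1 := by
      rw [← Real.exp_add]
      simp
    ext i j
    rw [Matrix.mul_apply, Fin.sum_univ_three]
    simp only [metric_eq hform hq hq', Matrix.of_apply]
    generalize twist β q = S at *
    generalize Real.exp (2 * β q) = D at *
    generalize Real.exp (2 * κ q) = A at *
    generalize Real.exp (-(2 * κ q)) = B at *
    trans (A * B) * (kron i j + S * rotField q i * rotField q j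
      * (1 - D * (1 + S * (q 0 ^ 2 + q 1 ^ 2))))
    · fin_cases i <;> fin_cases j <;> simp [kron, rotField] <;> ring
    · rw [hK, hD]
      simp [kron, Matrix.one_apply]
  rw [e, Matrix.of_apply]

/-- An axisymmetric function is constant along the rotation orbit `γ` through `q`, whose velocity at
`q` is the rotation field. -/
lemma fderiv_rotField_eq_zero {U : Set Pt} (hU : IsOpen U) {g : Pt → ℝ}
    (hg : IsAxisymmetricOn U g) {q : Pt} (hq : q ∈ U) (hd : DifferentiableAt ℝ g q) :
    -q 1 * pderiv 0 g q + q 0 * pderiv 1 g q = 0 := by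
  let γ : ℝ → Pt := fun t => ![q 0 * Real.cos t - q 1 * Real.sin t,
    q 0 * Real.sin t + q 1 * Real.cos t, q 2]
  have hγ0 : γ 0 = q := by
    funext i
    fin_cases i <;> simp [γ]
  have hγ : HasDerivAt γ ![-q 1, q 0, 0] 0 := by
    rw [hasDerivAt_pi]
    intro i
    fin_cases i
    · have := ((Real.hasDerivAt_cos 0).const_mul (q 0)).fun_sub
        ((Real.hasDerivAt_sin 0).const_mul (q 1))
      simpa [γ] using this
    · have := ((Real.hasDerivAt_sin 0).const_mul (q 0)).fun_add
        ((Real.hasDerivAt_cos 0).const_mul (q 1))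
      simpa [γ] using this
    · simpa [γ] using hasDerivAt_const (0 : ℝ) (q 2)
  have h1 : HasDerivAt (g ∘ γ) (fderiv ℝ g q ![-q 1, q 0, 0]) 0 := by
    have h2 : HasFDerivAt g (fderiv ℝ g q) (γ 0) := by
      rw [hγ0]
      exact hd.hasFDerivAt
    exact h2.comp_hasDerivAt 0 hγ
  have h3 : (g ∘ γ) =ᶠ[nhds 0] fun _ => g q := by
    have : ∀ᶠ t in nhds (0 : ℝ), γ t ∈ U := by
      refine hγ.continuousAt.eventually_mem ?_
      rw [hγ0]
      exact hU.mem_nhds hq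
    filter_upwards [this] with t ht
    refine hg _ ht _ hq (by simp [γ]) ?_
    simp only [rho]
    congr 1
    simp only [γ, Matrix.cons_val_zero, Matrix.cons_val_one]
    linear_combination (q 0 ^ 2 + q 1 ^ 2) * Real.sin_sq_add_cos_sq t
  have h4 := h1.unique ((hasDerivAt_const (0 : ℝ) (g q)).congr_of_eventuallyEq h3)
  have e : (![-q 1, q 0, 0] : Pt) = -q 1 • Pi.single 0 1 + q 0 • Pi.single 1 1 := by
    funext i
    fin_cases i <;> simp
  rw [e, map_add, map_smul, map_smul] at h4
  simpa [pderiv] using h4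

/-- The coefficients `c_i` of the Christoffel symbols. -/
def connCoeff (G : Fin 3 → ℝ) (S D : ℝ) (q : Pt) (i : Fin 3) : ℝ :=
  1 / 2 * D * G i - S ^ 2 * D * horiz q i

/-- The Christoffel symbols `Γ^k_{ij}` of `e^{2κ} (δ + S v ⊗ v)` in terms of the gradients
`K` of `κ` and `G` of `S`, where `D = (1 + S ρ²)⁻¹`. -/
def connForm (K G : Fin 3 → ℝ) (S D : ℝ) (q : Pt) (k i j : Fin 3) : ℝ :=
  K i * kron k j + K j * kron k i - K k * (kron i j + S * rotField q i * rotField q j)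
    + rotField q k * (connCoeff G S D q i * rotField q j + connCoeff G S D q j * rotField q i)
    - 1 / 2 * G k * rotField q i * rotField q j
    + S * (rotField q j * rotDeriv k i + rotField q i * rotDeriv k j)

/-- The Koszul formula with the conformal factors cancelled. Axisymmetry makes the gradients of `κ`
and `S` orthogonal to `v`, so the `v ⊗ v` part of the inverse metric annihilates them, and `hD`
absorbs the remaining denominators. -/
lemma connForm_eq_sum {K G : Fin 3 → ℝ} {S D : ℝ} {q : Pt}
    (hK : -q 1 * K 0 + q 0 * K 1 = 0) (hG : -q 1 * G 0 + q 0 * G 1 = 0)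
    (hD : D * (1 + S * (q 0 ^ 2 + q 1 ^ 2)) = 1) (k i j : Fin 3) :
    (1 / 2) * ∑ l, (kron k l - S * D * rotField q k * rotField q l) *
      ((2 * K i * (kron j l + S * rotField q j * rotField q l) + G i * rotField q j * rotField q l
          + S * (rotDeriv j i * rotField q l + rotField q j * rotDeriv l i))
        + (2 * K j * (kron i l + S * rotField q i * rotField q l)
          + G j * rotField q i * rotField q l
          + S * (rotDeriv i j * rotField q l + rotField q i * rotDeriv l j))
        - (2 * K l * (kron i j + S * rotField q i * rotField q j)
          + G l * rotField q i * rotField q j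
          + S * (rotDeriv i l * rotField q j + rotField q i * rotDeriv j l)))
      = connForm K G S D q k i j := by
  -- The multipliers are uniform in the indices; normalization is postponed until the components
  -- have been split.
  linear_combination (norm := skip)
    -(rotField q k * (S * (K i * rotField q j + K j * rotField q i)
      + 1 / 2 * (G i * rotField q j + G j * rotField q i))) * hD
    + S * D * rotField q k * (kron i j + S * rotField q i * rotField q j) * hK
    + 1 / 2 * S * D * rotField q k * rotField q i * rotField q j * hG
  rw [Fin.sum_univ_three]
  unfold connForm connCoeff
  fin_cases k <;> fin_cases i <;> fin_cases j <;>
    simp [kron, rotField, rotDeriv, horiz] <;> ring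

lemma hasFDerivAt_coord (q : Pt) (i : Fin 3) :
    HasFDerivAt (fun q : Pt => q i) (ContinuousLinearMap.proj (R := ℝ) i : Pt →L[ℝ] ℝ) q :=
  (ContinuousLinearMap.proj (R := ℝ) i : Pt →L[ℝ] ℝ).hasFDerivAt

lemma pderiv_mul {𝔸 : Type*} [NormedCommRing 𝔸] [NormedAlgebra ℝ 𝔸] {g f : Pt → 𝔸}
    {q : Pt} (hg : DifferentiableAt ℝ g q)
    (hf : DifferentiableAt ℝ f q) (i : Fin 3) :
    pderiv i (fun p => g p * f p) q = pderiv i g q * f q + g q * pderiv i f q := by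
  simp only [pderiv]
  rw [fderiv_fun_mul hg hf]
  simp
  ring

lemma pderiv_add {E : Type*} [NormedAddCommGroup E] [NormedSpace ℝ E] {g f : Pt → E}
    {q : Pt} (hg : DifferentiableAt ℝ g q)
    (hf : DifferentiableAt ℝ f q) (i : Fin 3) :
    pderiv i (fun p => g p + f p) q = pderiv i g q + pderiv i f q := by
  simp only [pderiv]
  rw [fderiv_fun_add hg hf]
  simp

lemma pderiv_exp {g : Pt → ℝ} {q : Pt} (hg : DifferentiableAt ℝ g q) (c : ℝ) (i : Fin 3) :
    pderiv i (fun p => Real.exp (c * g p)) q = Real.exp (c * g q) * (c * pderiv i g q) := by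
  simp only [pderiv]
  rw [fderiv_exp (hg.const_mul c), fderiv_const_mul hg]
  simp

lemma pderiv_const {E : Type*} [NormedAddCommGroup E] [NormedSpace ℝ E] (c : E) (q : Pt)
    (i : Fin 3) : pderiv i (fun _ => c) q = 0 := by
  simp [pderiv]

lemma pderiv_congr {E : Type*} [NormedAddCommGroup E] [NormedSpace ℝ E] {g f : Pt → E} {q : Pt}
    (h : g =ᶠ[nhds q] f) (i : Fin 3) : pderiv i g q = pderiv i f q := by
  simp only [pderiv, h.fderiv_eq]

lemma differentiable_rotField (k : Fin 3) : Differentiable ℝ (fun q => rotField q k) := by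
  fin_cases k <;> simp [rotField] <;> fun_prop

lemma pderiv_rotField (q : Pt) (k i : Fin 3) :
    pderiv i (fun q => rotField q k) q = rotDeriv k i := by
  fin_cases k
  · have : (fun q : Pt => rotField q 0) = fun q => -q 1 := by funext q; simp [rotField]
    change fderiv ℝ (fun q : Pt => rotField q 0) q _ = _
    rw [this, (hasFDerivAt_coord q 1).fun_neg.fderiv]
    fin_cases i <;> simp [rotDeriv]
  · have : (fun q : Pt => rotField q 1) = fun q => q 0 := by funext q; simp [rotField]
    change fderiv ℝ (fun q : Pt => rotField q 1) q _ = _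
    rw [this, (hasFDerivAt_coord q 0).fderiv]
    fin_cases i <;> simp [rotDeriv]
  · have : (fun q : Pt => rotField q 2) = fun q => 0 := by funext q; simp [rotField]
    change pderiv i (fun q : Pt => rotField q 2) q = _
    rw [this, pderiv_const]
    fin_cases i <;> simp [rotDeriv]

/-- The part of `U` off the axis. -/
def offAxis (U : Set Pt) : Set Pt := {q ∈ U | q 0 ^ 2 + q 1 ^ 2 ≠ 0}

lemma isOpen_offAxis {U : Set Pt} (hU : IsOpen U) : IsOpen (offAxis U) :=
  hU.inter (isOpen_ne_fun (by fun_prop) continuous_const)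

lemma contDiffOn_twist {U : Set Pt} {β : Pt → ℝ} (hβ : ContDiffOn ℝ ∞ β U) :
    ContDiffOn ℝ ∞ (twist β) (offAxis U) := by
  have h1 : ContDiffOn ℝ ∞ (fun q => Real.exp (-2 * β q) - 1) (offAxis U) :=
    (contDiffOn_const.mul (hβ.mono fun q hq => hq.1)).exp.sub contDiffOn_const
  exact h1.div (by fun_prop) fun q hq => hq.2

lemma isAxisymmetricOn_twist {U : Set Pt} {β : Pt → ℝ} (hβ : IsAxisymmetricOn U β) :
    IsAxisymmetricOn U (twist β) := by
  intro p hp q hq h1 h2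
  rw [twist, twist, hβ p hp q hq h1 h2, ← rho_sq, ← rho_sq, h2]

lemma IsAxisymmetricOn.mono {E : Type*} {U V : Set Pt} {g : Pt → E} (hg : IsAxisymmetricOn U g)
    (hVU : V ⊆ U) : IsAxisymmetricOn V g :=
  fun p hp q hq => hg p (hVU hp) q (hVU hq)

lemma pderiv_metric {U : Set Pt} (hU : IsOpen U) {h : Pt → Matrix (Fin 3) (Fin 3) ℝ}
    {β κ : Pt → ℝ} (hform : HasAxisymmetricForm U h β κ) (hβ : ContDiffOn ℝ ∞ β U)
    (hκ : ContDiffOn ℝ ∞ κ U) {q : Pt} (hq : q ∈ offAxis U) (i j l : Fin 3) :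
    pderiv i (fun p => h p j l) q = Real.exp (2 * κ q) *
      (2 * pderiv i κ q * (kron j l + twist β q * rotField q j * rotField q l)
        + pderiv i (twist β) q * rotField q j * rotField q l
        + twist β q * (rotDeriv j i * rotField q l + rotField q j * rotDeriv l i)) := by
  have hO := (isOpen_offAxis hU).mem_nhds hq
  have e : (fun p => h p j l) =ᶠ[nhds q] fun p => Real.exp (2 * κ p) *
      (kron j l + twist β p * rotField p j * rotField p l) := by
    filter_upwards [hO] with p hp using metric_eq hform hp.1 hp.2 j l
  have dκ : DifferentiableAt ℝ κ q :=
    (hκ.contDiffAt (hU.mem_nhds hq.1)).differentiableAt (by simp)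
  have dS : DifferentiableAt ℝ (twist β) q :=
    ((contDiffOn_twist hβ).contDiffAt hO).differentiableAt (by simp)
  have dj := (differentiable_rotField j).differentiableAt (x := q)
  have dl := (differentiable_rotField l).differentiableAt (x := q)
  rw [pderiv_congr e, pderiv_mul (by fun_prop) (by fun_prop), pderiv_exp dκ,
    pderiv_add (by fun_prop) (by fun_prop), pderiv_const, pderiv_mul (by fun_prop) dl,
    pderiv_mul dS dj, pderiv_rotField, pderiv_rotField]
  ring

lemma christoffel_eq {U : Set Pt} (hU : IsOpen U) {h : Pt → Matrix (Fin 3) (Fin 3) ℝ}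
    {β κ : Pt → ℝ} (hform : HasAxisymmetricForm U h β κ) (hβ : ContDiffOn ℝ ∞ β U)
    (hκ : ContDiffOn ℝ ∞ κ U) (hβs : IsAxisymmetricOn U β) (hκs : IsAxisymmetricOn U κ)
    {q : Pt} (hq : q ∈ offAxis U) (k i j : Fin 3) :
    christoffel h k i j q = connForm (fun i => pderiv i κ q) (fun i => pderiv i (twist β) q)
      (twist β q) (Real.exp (2 * β q)) q k i j := by
  have hO := (isOpen_offAxis hU).mem_nhds hq
  have dκ : DifferentiableAt ℝ κ q :=
    (hκ.contDiffAt (hU.mem_nhds hq.1)).differentiableAt (by simp)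
  have dS : DifferentiableAt ℝ (twist β) q :=
    ((contDiffOn_twist hβ).contDiffAt hO).differentiableAt (by simp)
  rw [← connForm_eq_sum (fderiv_rotField_eq_zero hU hκs hq.1 dκ)
    (fderiv_rotField_eq_zero hU (isAxisymmetricOn_twist hβs) hq.1 dS)
    (exp_mul_one_add_twist β hq.2)]
  simp only [christoffel, pderiv_metric hU hform hβ hκ hq, inv_metric_eq hform hq.1 hq.2]
  congr 1
  refine Finset.sum_congr rfl fun l _ => ?_
  have hA : Real.exp (-(2 * κ q)) * Real.exp (2 * κ q) = 1 := by
    rw [← Real.exp_add]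
    simp
  rw [← mul_add, ← mul_sub, mul_mul_mul_comm, hA, one_mul]

/-! ### Contraction of the connection and the curvature with null vectors -/

/-- The derivative of `g` in the direction of the constant complex vector field `v`. -/
def dirDeriv (v : Fin 3 → ℂ) (g : Pt → ℂ) (q : Pt) : ℂ := ∑ i, v i * pderiv i g q

/-- The null vector `∂_z - i ∂_ρ` on the meridian half-plane with azimuth `(c, s)`. -/
def planeVec (c s : ℝ) : Fin 3 → ℂ := ![-Complex.I * c, -Complex.I * s, 1]

/-- The point with coordinates `(z, ρ)` in the meridian plane with azimuth `(c, s)`. -/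
def planePt (c s : ℝ) (w : ℝ × ℝ) : Pt := ![w.2 * c, w.2 * s, w.1]

lemma planeVec_null {c s : ℝ} (hcs : c ^ 2 + s ^ 2 = 1) :
    planeVec c s 0 ^ 2 + planeVec c s 1 ^ 2 + planeVec c s 2 ^ 2 = 0 := by
  have : (c : ℂ) ^ 2 + (s : ℂ) ^ 2 = 1 := by exact_mod_cast hcs
  simp only [planeVec, Matrix.cons_val_zero, Matrix.cons_val_one, Matrix.cons_val]
  linear_combination ((c : ℂ) ^ 2 + (s : ℂ) ^ 2) * Complex.I_sq - this

lemma pderiv_ofReal {g : Pt → ℝ} {q : Pt} (hg : DifferentiableAt ℝ g q) (i : Fin 3) :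
    pderiv i (fun p => (g p : ℂ)) q = ((pderiv i g q : ℝ) : ℂ) := by
  have := (Complex.ofRealCLM.hasFDerivAt (x := g q)).comp q hg.hasFDerivAt
  have h2 : HasFDerivAt (fun p => (g p : ℂ)) (Complex.ofRealCLM.comp (fderiv ℝ g q)) q := this
  simp [pderiv, h2.fderiv]

lemma differentiableAt_ofReal {g : Pt → ℝ} {q : Pt} (hg : DifferentiableAt ℝ g q) :
    DifferentiableAt ℝ (fun p => (g p : ℂ)) q :=
  Complex.ofRealCLM.differentiableAt.comp q hg

lemma dirDeriv_ofReal {g : Pt → ℝ} {q : Pt} (hg : DifferentiableAt ℝ g q) (v : Fin 3 → ℂ) :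
    dirDeriv v (fun p => (g p : ℂ)) q = ∑ i, v i * ((pderiv i g q : ℝ) : ℂ) := by
  simp only [dirDeriv, pderiv_ofReal hg]

/-- The transverse remainder of the contracted Christoffel symbols. -/
def transverse (K G : Fin 3 → ℝ) (S D : ℝ) (q : Pt) (v : Fin 3 → ℂ) (k : Fin 3) : ℂ :=
  -(K k * S * ∑ i, (rotField q i : ℂ) * v i)
    + 2 * rotField q k * ∑ i, (connCoeff G S D q i : ℂ) * v i
    - 1 / 2 * G k * ∑ i, (rotField q i : ℂ) * v i
    + 2 * S * ∑ i, (rotDeriv k i : ℂ) * v i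

/-- The remainder is kept as a product whose factor `v · η` vanishes on the meridian plane but has a
nonzero gradient there. It is invisible to the geodesic property, yet it contributes when the
Christoffel symbols are differentiated for the Ricci tensor. -/
lemma connForm_contract (K G : Fin 3 → ℝ) (S D : ℝ) (q : Pt) {v : Fin 3 → ℂ}
    (hv : v 0 ^ 2 + v 1 ^ 2 + v 2 ^ 2 = 0) (k : Fin 3) :
    ∑ i, ∑ j, (connForm K G S D q k i j : ℂ) * v i * v j
      = 2 * (∑ i, v i * (K i : ℂ)) * v k
        + (∑ i, (rotField q i : ℂ) * v i) * transverse K G S D q v k := by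
  linear_combination (norm := skip) -(K k : ℂ) * hv
  unfold connForm transverse
  simp only [Fin.sum_univ_three]
  generalize connCoeff G S D q = C
  fin_cases k <;> simp [kron, rotField, rotDeriv] <;> ring

/-- The trace `Γ^k_{ki}` is `∂_i log √det h`, and `det h = e^{6κ - 2β}`. The hypothesis `hB` is the
derivative of `1 + S ρ² = e^{-2β}`. -/
lemma connForm_trace {K G B : Fin 3 → ℝ} {S D : ℝ} {q : Pt}
    (hK : -q 1 * K 0 + q 0 * K 1 = 0) (hG : -q 1 * G 0 + q 0 * G 1 = 0)
    (hD : D * (1 + S * (q 0 ^ 2 + q 1 ^ 2)) = 1)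
    (hB : ∀ i, G i * (q 0 ^ 2 + q 1 ^ 2) + 2 * S * horiz q i
      = -2 * B i * (1 + S * (q 0 ^ 2 + q 1 ^ 2))) (i : Fin 3) :
    ∑ k, connForm K G S D q k k i = 3 * K i - B i := by
  linear_combination (norm := skip) -S * rotField q i * hK
    + (1 / 2 * D - 1 / 2) * rotField q i * hG + 1 / 2 * D * hB i - (S * horiz q i + B i) * hD
  unfold connForm connCoeff
  simp only [Fin.sum_univ_three]
  fin_cases i <;> simp [kron, rotField, rotDeriv, horiz] <;> ring

/-- Trades the gradient of `S` for that of `β`; the factor `ρ²` avoids a division. -/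
lemma connCoeff_mul {G B : Fin 3 → ℝ} {S D : ℝ} {q : Pt}
    (hD : D * (1 + S * (q 0 ^ 2 + q 1 ^ 2)) = 1)
    (hB : ∀ i, G i * (q 0 ^ 2 + q 1 ^ 2) + 2 * S * horiz q i
      = -2 * B i * (1 + S * (q 0 ^ 2 + q 1 ^ 2))) (i : Fin 3) :
    (q 0 ^ 2 + q 1 ^ 2) * connCoeff G S D q i = -B i - S * horiz q i := by
  unfold connCoeff
  linear_combination 1 / 2 * D * hB i - (S * horiz q i + B i) * hD

lemma sum_rotField_planeVec {c s : ℝ} (w : ℝ × ℝ) :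
    ∑ i, (rotField (planePt c s w) i : ℂ) * planeVec c s i = 0 := by
  simp only [Fin.sum_univ_three]
  simp [rotField, planePt, planeVec]
  ring

lemma connForm_comm (K G : Fin 3 → ℝ) (S D : ℝ) (q : Pt) (k i j : Fin 3) :
    connForm K G S D q k i j = connForm K G S D q k j i := by
  have : kron i j = kron j i := by simp [kron, eq_comm]
  unfold connForm
  rw [this]
  ring

/-- The unit vector normal to the meridian plane with azimuth `(c, s)`. -/
def planeNormal (c s : ℝ) : Fin 3 → ℂ := ![-s, c, 0]

/-- On a meridian plane `v = ρ e` with `e` the unit normal. The matrix `η^j Γ^k_{jl}` is then a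
conformal part depending on `κ` only, plus a multiple of `e ⊗ e` that carries all of `β`. Its square
enters the quadratic part of the Ricci tensor. -/
lemma connForm_contract_one {K G B : Fin 3 → ℝ} {S D c s : ℝ} {w : ℝ × ℝ}
    (hcs : c ^ 2 + s ^ 2 = 1)
    (hD : D * (1 + S * (planePt c s w 0 ^ 2 + planePt c s w 1 ^ 2)) = 1)
    (hB : ∀ i, G i * (planePt c s w 0 ^ 2 + planePt c s w 1 ^ 2)
        + 2 * S * horiz (planePt c s w) i
      = -2 * B i * (1 + S * (planePt c s w 0 ^ 2 + planePt c s w 1 ^ 2))) (k l : Fin 3) :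
    ∑ j, (connForm K G S D (planePt c s w) k j l : ℂ) * planeVec c s j
      = (∑ i, planeVec c s i * (K i : ℂ)) * kron k l + K l * planeVec c s k - K k * planeVec c s l
        - (∑ i, planeVec c s i * (B i : ℂ)) * (planeNormal c s k * planeNormal c s l) := by
  have hC := connCoeff_mul hD hB
  have hr : planePt c s w 0 ^ 2 + planePt c s w 1 ^ 2 = w.2 ^ 2 := by
    simp only [planePt, Matrix.cons_val_zero, Matrix.cons_val_one]
    linear_combination w.2 ^ 2 * hcs
  rw [hr] at hC
  have hC' : ∀ i, (w.2 : ℂ) ^ 2 * (connCoeff G S D (planePt c s w) i : ℂ)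
      = -(B i : ℂ) - S * horiz (planePt c s w) i := fun i => by exact_mod_cast hC i
  have hcs' : (c : ℂ) ^ 2 + (s : ℂ) ^ 2 = 1 := by exact_mod_cast hcs
  unfold connForm
  generalize connCoeff G S D (planePt c s w) = C at *
  -- The product `v_k v_l` supplies the `ρ²` required by `hC'`. The term left over from `S horiz`
  -- cancels against the one from `rotDeriv`, since `horiz · η = -iρ` and `rotDeriv` maps `η` to `-i
  -- e`.
  linear_combination (norm := skip)
    (planeNormal c s k * planeNormal c s l) * (planeVec c s 0 * hC' 0 + planeVec c s 1 * hC' 1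
      + planeVec c s 2 * hC' 2 + S * Complex.I * w.2 * hcs')
  simp only [Fin.sum_univ_three]
  fin_cases k <;> fin_cases l <;>
    simp [kron, rotField, rotDeriv, horiz, planePt, planeVec, planeNormal] <;> ring

/-- For `η` null, `e` of unit length and `η · K = a` the right side is `5a² - 2am + m²`, the
quadratic connection term of the Ricci tensor. -/
lemma trace_sq_eq (K η e : Fin 3 → ℂ) (a m : ℂ) :
    ∑ k, ∑ l, (a * kron k l + K l * η k - K k * η l - m * (e k * e l))
      * (a * kron l k + K k * η l - K l * η k - m * (e l * e k))
      = 3 * a ^ 2 - 2 * a * m * (e 0 ^ 2 + e 1 ^ 2 + e 2 ^ 2)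
        + m ^ 2 * (e 0 ^ 2 + e 1 ^ 2 + e 2 ^ 2) ^ 2
        + 2 * (∑ i, η i * K i) ^ 2
        - 2 * (K 0 ^ 2 + K 1 ^ 2 + K 2 ^ 2) * (η 0 ^ 2 + η 1 ^ 2 + η 2 ^ 2) := by
  simp [Fin.sum_univ_three, kron]
  ring

lemma pderiv_horizSq (q : Pt) (i : Fin 3) :
    pderiv i (fun q : Pt => q 0 ^ 2 + q 1 ^ 2) q = 2 * horiz q i := by
  have := (((hasFDerivAt_coord q 0).pow 2).fun_add ((hasFDerivAt_coord q 1).pow 2))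
  rw [pderiv, this.fderiv]
  fin_cases i <;> simp [horiz]

/-- Differentiating `1 + S ρ² = e^{-2β}` gives the gradient of the twist without dividing by `ρ²`.
-/
lemma pderiv_twist {U : Set Pt} (hU : IsOpen U) {β : Pt → ℝ} (hβ : ContDiffOn ℝ ∞ β U) {q : Pt}
    (hq : q ∈ offAxis U) (i : Fin 3) :
    pderiv i (twist β) q * (q 0 ^ 2 + q 1 ^ 2) + 2 * twist β q * horiz q i
      = -2 * pderiv i β q * (1 + twist β q * (q 0 ^ 2 + q 1 ^ 2)) := by
  have hO := (isOpen_offAxis hU).mem_nhds hq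
  have dβ : DifferentiableAt ℝ β q :=
    (hβ.contDiffAt (hU.mem_nhds hq.1)).differentiableAt (by simp)
  have dS : DifferentiableAt ℝ (twist β) q :=
    ((contDiffOn_twist hβ).contDiffAt hO).differentiableAt (by simp)
  have e : (fun p : Pt => 1 + twist β p * (p 0 ^ 2 + p 1 ^ 2)) =ᶠ[nhds q]
      fun p => Real.exp (-2 * β p) := by
    filter_upwards [hO] with p hp using one_add_twist β hp.2
  have h1 := pderiv_congr e i
  rw [pderiv_add (by fun_prop) (by fun_prop), pderiv_const, pderiv_mul dS (by fun_prop),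
    pderiv_exp dβ, pderiv_horizSq] at h1
  rw [one_add_twist β hq.2]
  linear_combination h1

lemma planePt_mem_offAxis {U : Set Pt} {c s : ℝ} (hcs : c ^ 2 + s ^ 2 = 1) {w : ℝ × ℝ}
    (hw : planePt c s w ∈ U) (hw' : w.2 ≠ 0) : planePt c s w ∈ offAxis U := by
  refine ⟨hw, ?_⟩
  have hr : planePt c s w 0 ^ 2 + planePt c s w 1 ^ 2 = w.2 ^ 2 := by
    simp only [planePt, Matrix.cons_val_zero, Matrix.cons_val_one]
    linear_combination w.2 ^ 2 * hcs
  rw [hr]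
  positivity

lemma metric_planeVec {U : Set Pt} {h : Pt → Matrix (Fin 3) (Fin 3) ℝ} {β κ : Pt → ℝ}
    (hform : HasAxisymmetricForm U h β κ) {c s : ℝ} (hcs : c ^ 2 + s ^ 2 = 1) {w : ℝ × ℝ}
    (hw : planePt c s w ∈ offAxis U) :
    ∑ k, ∑ l, (h (planePt c s w) k l : ℂ) * planeVec c s k * planeVec c s l = 0 := by
  simp only [metric_eq hform hw.1 hw.2]
  have hu := sum_rotField_planeVec (c := c) (s := s) w
  have hn := planeVec_null hcs
  generalize planePt c s w = q at *
  generalize planeVec c s = η at *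
  push_cast
  linear_combination (norm := skip) Complex.exp (2 * (κ q : ℂ)) * (hn
    + twist β q * (∑ i, (rotField q i : ℂ) * η i) * hu)
  simp [Fin.sum_univ_three, kron]
  ring

lemma christoffel_planeVec {U : Set Pt} (hU : IsOpen U) {h : Pt → Matrix (Fin 3) (Fin 3) ℝ}
    {β κ : Pt → ℝ} (hform : HasAxisymmetricForm U h β κ) (hβ : ContDiffOn ℝ ∞ β U)
    (hκ : ContDiffOn ℝ ∞ κ U) (hβs : IsAxisymmetricOn U β) (hκs : IsAxisymmetricOn U κ)
    {c s : ℝ} (hcs : c ^ 2 + s ^ 2 = 1) {w : ℝ × ℝ} (hw : planePt c s w ∈ offAxis U)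
    (k : Fin 3) :
    ∑ i, ∑ j, (christoffel h k i j (planePt c s w) : ℂ) * planeVec c s i * planeVec c s j
      = 2 * dirDeriv (planeVec c s) (fun q => (κ q : ℂ)) (planePt c s w) * planeVec c s k := by
  simp only [christoffel_eq hU hform hβ hκ hβs hκs hw]
  rw [connForm_contract _ _ _ _ _ (planeVec_null hcs), sum_rotField_planeVec, zero_mul, add_zero,
    dirDeriv_ofReal ((hκ.contDiffAt (hU.mem_nhds hw.1)).differentiableAt (by simp))]

/-- The factor multiplying `transverse` is the gradient of `v · η`. The value `-(2i/ρ) ηβ` is the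
only source of the singular term in the Ricci contraction, hence of `2/r` in `M`. -/
lemma sum_mul_transverse {G B : Fin 3 → ℝ} (K : Fin 3 → ℝ) {S D c s : ℝ} {w : ℝ × ℝ}
    (hcs : c ^ 2 + s ^ 2 = 1) (hw : w.2 ≠ 0)
    (hD : D * (1 + S * (planePt c s w 0 ^ 2 + planePt c s w 1 ^ 2)) = 1)
    (hB : ∀ i, G i * (planePt c s w 0 ^ 2 + planePt c s w 1 ^ 2)
        + 2 * S * horiz (planePt c s w) i
      = -2 * B i * (1 + S * (planePt c s w 0 ^ 2 + planePt c s w 1 ^ 2))) :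
    ∑ k, (∑ j, (rotDeriv j k : ℂ) * planeVec c s j)
        * transverse K G S D (planePt c s w) (planeVec c s) k
      = -(2 * Complex.I / w.2) * ∑ i, planeVec c s i * (B i : ℂ) := by
  have hC := connCoeff_mul hD hB
  have hr : planePt c s w 0 ^ 2 + planePt c s w 1 ^ 2 = w.2 ^ 2 := by
    simp only [planePt, Matrix.cons_val_zero, Matrix.cons_val_one]
    linear_combination w.2 ^ 2 * hcs
  rw [hr] at hC
  have hC' : ∀ i, (w.2 : ℂ) ^ 2 * (connCoeff G S D (planePt c s w) i : ℂ)
      = -(B i : ℂ) - S * horiz (planePt c s w) i := fun i => by exact_mod_cast hC i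
  have hcs' : (c : ℂ) ^ 2 + (s : ℂ) ^ 2 = 1 := by exact_mod_cast hcs
  have hw' : (w.2 : ℂ) ≠ 0 := by exact_mod_cast hw
  unfold transverse
  rw [sum_rotField_planeVec]
  generalize connCoeff G S D (planePt c s w) = C at *
  have key : ∑ k, (∑ j, (rotDeriv j k : ℂ) * planeVec c s j)
      * (2 * (rotField (planePt c s w) k : ℂ) * ∑ i, (C i : ℂ) * planeVec c s i
        + 2 * S * ∑ i, (rotDeriv k i : ℂ) * planeVec c s i)
      = 2 * Complex.I * w.2 * (∑ i, (C i : ℂ) * planeVec c s i) + 2 * S := by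
    linear_combination (norm := skip)
      (2 * Complex.I * w.2 * (∑ i, (C i : ℂ) * planeVec c s i) + 2 * S) * hcs'
    simp only [Fin.sum_univ_three]
    simp [rotField, rotDeriv, planePt, planeVec]
    ring_nf
    simp only [Complex.I_sq]
    ring
  have e : ∀ k, -((K k : ℂ) * S * 0) + 2 * (rotField (planePt c s w) k : ℂ)
      * ∑ i, (C i : ℂ) * planeVec c s i - 1 / 2 * G k * 0
      + 2 * S * ∑ i, (rotDeriv k i : ℂ) * planeVec c s i
      = 2 * (rotField (planePt c s w) k : ℂ) * ∑ i, (C i : ℂ) * planeVec c s i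
        + 2 * S * ∑ i, (rotDeriv k i : ℂ) * planeVec c s i := fun k => by ring
  simp only [e, key]
  field_simp
  simp only [Fin.sum_univ_three]
  linear_combination (norm := skip) Complex.I * (planeVec c s 0 * hC' 0 +
    planeVec c s 1 * hC' 1 + planeVec c s 2 * hC' 2) - S * w.2 * hcs'
  simp [horiz, planePt, planeVec]
  ring_nf
  simp only [Complex.I_sq]
  ring

/-! ### The Ricci tensor contracted with `∂_z - i ∂_ρ` -/

lemma differentiableAt_pderiv {E : Type*} [NormedAddCommGroup E] [NormedSpace ℝ E] {U : Set Pt}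
    (hU : IsOpen U) {g : Pt → E} (hg : ContDiffOn ℝ ∞ g U) {q : Pt} (hq : q ∈ U) (i : Fin 3) :
    DifferentiableAt ℝ (pderiv i g) q :=
  ((ContDiffOn.pderiv hU hg i).contDiffAt (hU.mem_nhds hq)).differentiableAt (by simp)

lemma dirDeriv_congr {g f : Pt → ℂ} {q : Pt} (h : g =ᶠ[nhds q] f) (v : Fin 3 → ℂ) :
    dirDeriv v g q = dirDeriv v f q := by
  simp only [dirDeriv, pderiv_congr h]

lemma dirDeriv_add {g f : Pt → ℂ} {q : Pt} (hg : DifferentiableAt ℝ g q)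
    (hf : DifferentiableAt ℝ f q) (v : Fin 3 → ℂ) :
    dirDeriv v (fun p => g p + f p) q = dirDeriv v g q + dirDeriv v f q := by
  simp only [dirDeriv, pderiv_add hg hf, mul_add, Finset.sum_add_distrib]

lemma dirDeriv_const_mul {g : Pt → ℂ} {q : Pt} (hg : DifferentiableAt ℝ g q) (c : ℂ)
    (v : Fin 3 → ℂ) : dirDeriv v (fun p => c * g p) q = c * dirDeriv v g q := by
  simp only [dirDeriv, pderiv_const_mul hg, mul_left_comm _ c, ← Finset.mul_sum]

lemma pderiv_sum_sum {Γ : Fin 3 → Fin 3 → Pt → ℝ} {q : Pt}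
    (hΓ : ∀ i j, DifferentiableAt ℝ (Γ i j) q) (v : Fin 3 → ℂ) (k : Fin 3) :
    pderiv k (fun q => ∑ i, ∑ j, (Γ i j q : ℂ) * v i * v j) q
      = ∑ i, ∑ j, ((pderiv k (Γ i j) q : ℝ) : ℂ) * v i * v j := by
  have hd : ∀ i j, DifferentiableAt ℝ (fun q => (Γ i j q : ℂ) * v i * v j) q := fun i j =>
    ((differentiableAt_ofReal (hΓ i j)).mul_const _).mul_const _
  rw [pderiv_finset_sum _ fun i _ => DifferentiableAt.fun_sum fun j _ => hd i j]
  refine Finset.sum_congr rfl fun i _ => ?_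
  rw [pderiv_finset_sum _ fun j _ => hd i j]
  refine Finset.sum_congr rfl fun j _ => ?_
  have e : (fun q => (Γ i j q : ℂ) * v i * v j) = fun q => (v i * v j) * (Γ i j q : ℂ) := by
    funext q
    ring
  rw [e, pderiv_const_mul (differentiableAt_ofReal (hΓ i j)), pderiv_ofReal (hΓ i j)]
  ring

/-- Near the plane `Γ^k_{ij} η^i η^j = 2 (ηκ) η^k + u X^k` with `u = v · η`. As `u = 0` on the
plane, the divergence there is `2 ηηκ + X^k ∂_k u`. -/
lemma sum_pderiv_christoffel {U : Set Pt} (hU : IsOpen U) {h : Pt → Matrix (Fin 3) (Fin 3) ℝ}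
    (hh : IsSmoothMetricOn U h)
    {β κ : Pt → ℝ} (hform : HasAxisymmetricForm U h β κ) (hβ : ContDiffOn ℝ ∞ β U)
    (hκ : ContDiffOn ℝ ∞ κ U) (hβs : IsAxisymmetricOn U β) (hκs : IsAxisymmetricOn U κ)
    {c s : ℝ} (hcs : c ^ 2 + s ^ 2 = 1) {w : ℝ × ℝ} (hw : planePt c s w ∈ offAxis U)
    (hw' : w.2 ≠ 0) :
    ∑ k, ∑ i, ∑ j, ((pderiv k (christoffel h k i j) (planePt c s w) : ℝ) : ℂ)
        * planeVec c s i * planeVec c s j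
      = 2 * dirDeriv (planeVec c s) (dirDeriv (planeVec c s) (fun q => (κ q : ℂ))) (planePt c s w)
        - 2 * Complex.I / w.2
          * dirDeriv (planeVec c s) (fun q => (β q : ℂ)) (planePt c s w) := by
  set p := planePt c s w with hp
  set η := planeVec c s with hη
  have hO := (isOpen_offAxis hU).mem_nhds hw
  have hΓ : ∀ k i j, DifferentiableAt ℝ (christoffel h k i j) p := fun k i j =>
    ((contDiffOn_christoffel hU hh k i j).contDiffAt (hU.mem_nhds hw.1)).differentiableAt (by simp)
  have dκ : ∀ q ∈ U, DifferentiableAt ℝ κ q := fun q hq =>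
    (hκ.contDiffAt (hU.mem_nhds hq)).differentiableAt (by simp)
  have dβ : ∀ q ∈ U, DifferentiableAt ℝ β q := fun q hq =>
    (hβ.contDiffAt (hU.mem_nhds hq)).differentiableAt (by simp)
  have dS : DifferentiableAt ℝ (twist β) p :=
    ((contDiffOn_twist hβ).contDiffAt hO).differentiableAt (by simp)
  have dK : ∀ i, DifferentiableAt ℝ (fun q => ((pderiv i κ q : ℝ) : ℂ)) p := fun i =>
    differentiableAt_ofReal (differentiableAt_pderiv hU hκ hw.1 i)
  have dG : ∀ i, DifferentiableAt ℝ (pderiv i (twist β)) p := fun i =>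
    differentiableAt_pderiv (isOpen_offAxis hU) (contDiffOn_twist hβ) hw i
  have dv : ∀ i, DifferentiableAt ℝ (fun q => (rotField q i : ℂ)) p := fun i =>
    differentiableAt_ofReal (differentiable_rotField i).differentiableAt
  let u : Pt → ℂ := fun q => ∑ i, (rotField q i : ℂ) * η i
  have du : DifferentiableAt ℝ u p := DifferentiableAt.fun_sum fun i _ => (dv i).mul_const _
  let X : Fin 3 → Pt → ℂ := fun k q => transverse (fun i => pderiv i κ q)
    (fun i => pderiv i (twist β) q) (twist β q) (Real.exp (2 * β q)) q η k
  have dC : ∀ i, DifferentiableAt ℝ (fun q => (connCoeff (fun i => pderiv i (twist β) q)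
      (twist β q) (Real.exp (2 * β q)) q i : ℂ)) p := by
    intro i
    refine differentiableAt_ofReal ?_
    have d1 := dβ p hw.1
    have d2 := dG i
    have d3 : DifferentiableAt ℝ (fun q => horiz q i) p := by
      fin_cases i <;> simp [horiz] <;> fun_prop
    unfold connCoeff
    fun_prop
  have dX : ∀ k, DifferentiableAt ℝ (X k) p := by
    intro k
    have d1 := dK k
    have d2 := differentiableAt_ofReal dS
    have d3 := dv k
    have d4 := differentiableAt_ofReal (dG k)
    have d5 : DifferentiableAt ℝ (fun q => ∑ i, (connCoeff (fun i => pderiv i (twist β) q)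
      (twist β q) (Real.exp (2 * β q)) q i : ℂ) * η i) p :=
      DifferentiableAt.fun_sum fun i _ => (dC i).mul_const _
    have d6 : DifferentiableAt ℝ (fun q => ∑ i, (rotField q i : ℂ) * η i) p := du
    simp only [X, transverse]
    fun_prop
  have dA : DifferentiableAt ℝ (dirDeriv η (fun q => (κ q : ℂ))) p := by
    have : dirDeriv η (fun q => (κ q : ℂ)) =ᶠ[nhds p]
        fun q => ∑ i, η i * ((pderiv i κ q : ℝ) : ℂ) := by
      filter_upwards [hU.mem_nhds hw.1] with q hq using dirDeriv_ofReal (dκ q hq) η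
    refine DifferentiableAt.congr_of_eventuallyEq ?_ this
    exact DifferentiableAt.fun_sum fun i _ => (dK i).const_mul _
  have hu0 : u p = 0 := sum_rotField_planeVec w
  have hpu : ∀ k, pderiv k u p = ∑ j, (rotDeriv j k : ℂ) * η j := by
    intro k
    have : u = fun q => ∑ i, η i * (rotField q i : ℂ) := by
      funext q
      exact Finset.sum_congr rfl fun i _ => mul_comm _ _
    rw [this, pderiv_finset_sum _ fun i _ => (dv i).const_mul _]
    refine Finset.sum_congr rfl fun i _ => ?_
    rw [pderiv_const_mul (dv i), pderiv_ofReal (differentiable_rotField i).differentiableAt,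
      pderiv_rotField, mul_comm]
  have e1 : ∀ k, (fun q => ∑ i, ∑ j, (christoffel h k i j q : ℂ) * η i * η j) =ᶠ[nhds p]
      fun q => (2 * η k) * dirDeriv η (fun q => (κ q : ℂ)) q + u q * X k q := by
    intro k
    filter_upwards [hO] with q hq
    simp only [christoffel_eq hU hform hβ hκ hβs hκs hq]
    rw [connForm_contract _ _ _ _ _ (planeVec_null hcs), dirDeriv_ofReal (dκ q hq.1)]
    simp only [u, X]
    ring
  have e2 : ∀ k, ∑ i, ∑ j, ((pderiv k (christoffel h k i j) p : ℝ) : ℂ) * η i * η j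
      = 2 * (η k * pderiv k (dirDeriv η (fun q => (κ q : ℂ))) p)
        + (∑ j, (rotDeriv j k : ℂ) * η j) * X k p := by
    intro k
    rw [← pderiv_sum_sum (hΓ k), pderiv_congr (e1 k),
      pderiv_add (dA.const_mul _) (du.fun_mul (dX k)), pderiv_const_mul dA, pderiv_mul du (dX k),
      hu0, hpu]
    ring
  simp only [e2, Finset.sum_add_distrib, ← Finset.mul_sum]
  rw [sum_mul_transverse _ hcs hw' (exp_mul_one_add_twist β hw.2) (pderiv_twist hU hβ hw),
    ← dirDeriv_ofReal (dβ p hw.1)]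
  simp only [dirDeriv]
  ring

/-- The four groups of terms in the Ricci tensor contribute `2ηηκ - (2i/ρ)ηβ`, `-(3ηηκ -
ηβ-derivative)` with that derivative equal to `ηηβ`, then `2(ηκ)(3ηκ - ηβ)`, and finally `-(5(ηκ)² -
2(ηκ)(ηβ) + (ηβ)²)`. -/
lemma ricci_planeVec {U : Set Pt} (hU : IsOpen U) {h : Pt → Matrix (Fin 3) (Fin 3) ℝ}
    (hh : IsSmoothMetricOn U h)
    {β κ : Pt → ℝ} (hform : HasAxisymmetricForm U h β κ) (hβ : ContDiffOn ℝ ∞ β U)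
    (hκ : ContDiffOn ℝ ∞ κ U) (hβs : IsAxisymmetricOn U β) (hκs : IsAxisymmetricOn U κ)
    {c s : ℝ} (hcs : c ^ 2 + s ^ 2 = 1) {w : ℝ × ℝ} (hw : planePt c s w ∈ offAxis U)
    (hw' : w.2 ≠ 0) :
    ∑ i, ∑ j, (ricci h i j (planePt c s w) : ℂ) * planeVec c s i * planeVec c s j
      = dirDeriv (planeVec c s) (dirDeriv (planeVec c s) (fun q => (β q : ℂ))) (planePt c s w)
        - dirDeriv (planeVec c s) (fun q => (β q : ℂ)) (planePt c s w) ^ 2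
        - 2 * Complex.I / w.2 * dirDeriv (planeVec c s) (fun q => (β q : ℂ)) (planePt c s w)
        - dirDeriv (planeVec c s) (dirDeriv (planeVec c s) (fun q => (κ q : ℂ))) (planePt c s w)
        + dirDeriv (planeVec c s) (fun q => (κ q : ℂ)) (planePt c s w) ^ 2 := by
  have hdiv := sum_pderiv_christoffel hU hh hform hβ hκ hβs hκs hcs hw hw'
  have hgeo := christoffel_planeVec hU hform hβ hκ hβs hκs hcs hw
  have hO := (isOpen_offAxis hU).mem_nhds hw
  have dκ : ∀ q ∈ U, DifferentiableAt ℝ κ q := fun q hq =>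
    (hκ.contDiffAt (hU.mem_nhds hq)).differentiableAt (by simp)
  have dβ : ∀ q ∈ U, DifferentiableAt ℝ β q := fun q hq =>
    (hβ.contDiffAt (hU.mem_nhds hq)).differentiableAt (by simp)
  have hΓ : ∀ k i j, DifferentiableAt ℝ (christoffel h k i j) (planePt c s w) := fun k i j =>
    ((contDiffOn_christoffel hU hh k i j).contDiffAt (hU.mem_nhds hw.1)).differentiableAt (by simp)
  have htr : ∀ q ∈ offAxis U, ∀ i, ∑ k, christoffel h k k i q
      = 3 * pderiv i κ q - pderiv i β q := by
    intro q hq i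
    simp only [christoffel_eq hU hform hβ hκ hβs hκs hq]
    exact connForm_trace (fderiv_rotField_eq_zero hU hκs hq.1 (dκ q hq.1))
      (fderiv_rotField_eq_zero hU (isAxisymmetricOn_twist hβs) hq.1
        (((contDiffOn_twist hβ).contDiffAt ((isOpen_offAxis hU).mem_nhds hq)).differentiableAt
          (by simp)))
      (exp_mul_one_add_twist β hq.2) (pderiv_twist hU hβ hq) i
  have hA : ∀ k l, ∑ j, (christoffel h k j l (planePt c s w) : ℂ) * planeVec c s j
      = dirDeriv (planeVec c s) (fun q => (κ q : ℂ)) (planePt c s w) * kron k l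
        + ((pderiv l κ (planePt c s w) : ℝ) : ℂ) * planeVec c s k
        - ((pderiv k κ (planePt c s w) : ℝ) : ℂ) * planeVec c s l
        - dirDeriv (planeVec c s) (fun q => (β q : ℂ)) (planePt c s w)
          * (planeNormal c s k * planeNormal c s l) := by
    intro k l
    simp only [christoffel_eq hU hform hβ hκ hβs hκs hw]
    rw [connForm_contract_one hcs (exp_mul_one_add_twist β hw.2) (pderiv_twist hU hβ hw),
      dirDeriv_ofReal (dκ _ hw.1), dirDeriv_ofReal (dβ _ hw.1)]
  have hA' : ∀ l k, ∑ i, (christoffel h l k i (planePt c s w) : ℂ) * planeVec c s i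
      = ∑ j, (christoffel h l j k (planePt c s w) : ℂ) * planeVec c s j := by
    intro l k
    refine Finset.sum_congr rfl fun i _ => ?_
    simp only [christoffel_eq hU hform hβ hκ hβs hκs hw]
    rw [connForm_comm]
  have hnull := planeVec_null hcs
  have hnorm : planeNormal c s 0 ^ 2 + planeNormal c s 1 ^ 2 + planeNormal c s 2 ^ 2 = 1 := by
    have : (c : ℂ) ^ 2 + (s : ℂ) ^ 2 = 1 := by exact_mod_cast hcs
    simp [planeNormal]
    linear_combination this
  have hsub : dirDeriv (planeVec c s) (fun q => ∑ i, planeVec c s i *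
      ((∑ k, christoffel h k k i q : ℝ) : ℂ)) (planePt c s w)
      = 3 * dirDeriv (planeVec c s) (dirDeriv (planeVec c s) (fun q => (κ q : ℂ))) (planePt c s w)
        - dirDeriv (planeVec c s) (dirDeriv (planeVec c s) (fun q => (β q : ℂ)))
          (planePt c s w) := by
    have dd : ∀ g : Pt → ℝ, ContDiffOn ℝ ∞ g U →
        DifferentiableAt ℝ (dirDeriv (planeVec c s) (fun q => (g q : ℂ))) (planePt c s w) := by
      intro g hg
      have : dirDeriv (planeVec c s) (fun q => (g q : ℂ)) =ᶠ[nhds (planePt c s w)]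
          fun q => ∑ i, planeVec c s i * ((pderiv i g q : ℝ) : ℂ) := by
        filter_upwards [hU.mem_nhds hw.1] with q hq using dirDeriv_ofReal
          ((hg.contDiffAt (hU.mem_nhds hq)).differentiableAt (by simp)) _
      refine DifferentiableAt.congr_of_eventuallyEq ?_ this
      exact DifferentiableAt.fun_sum fun i _ =>
        (differentiableAt_ofReal (differentiableAt_pderiv hU hg hw.1 i)).const_mul _
    have e : (fun q => ∑ i, planeVec c s i * ((∑ k, christoffel h k k i q : ℝ) : ℂ))
        =ᶠ[nhds (planePt c s w)] fun q => 3 * dirDeriv (planeVec c s) (fun q => (κ q : ℂ)) q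
          + (-1) * dirDeriv (planeVec c s) (fun q => (β q : ℂ)) q := by
      filter_upwards [hO] with q hq
      rw [dirDeriv_ofReal (dκ q hq.1), dirDeriv_ofReal (dβ q hq.1)]
      simp only [htr q hq, Finset.mul_sum, ← Finset.sum_add_distrib]
      refine Finset.sum_congr rfl fun i _ => ?_
      push_cast
      ring
    rw [dirDeriv_congr e]
    rw [dirDeriv_add ((dd κ hκ).const_mul 3) ((dd β hβ).const_mul (-1)),
      dirDeriv_const_mul (dd κ hκ), dirDeriv_const_mul (dd β hβ)]
    ring
  have hsub' : dirDeriv (planeVec c s) (fun q => ∑ i, planeVec c s i *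
      ((∑ k, christoffel h k k i q : ℝ) : ℂ)) (planePt c s w)
      = ∑ i, ∑ j, (∑ k, ((pderiv j (christoffel h k k i) (planePt c s w) : ℝ) : ℂ))
        * planeVec c s i * planeVec c s j := by
    have d : ∀ i, DifferentiableAt ℝ (fun q => ∑ k, christoffel h k k i q) (planePt c s w) :=
      fun i => DifferentiableAt.fun_sum fun k _ => hΓ k k i
    rw [Finset.sum_comm]
    refine Finset.sum_congr rfl fun j _ => ?_
    rw [pderiv_finset_sum _ fun i _ => (differentiableAt_ofReal (d i)).const_mul _, Finset.mul_sum]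
    refine Finset.sum_congr rfl fun i _ => ?_
    rw [pderiv_const_mul (differentiableAt_ofReal (d i)), pderiv_ofReal (d i),
      pderiv_finset_sum _ fun k _ => hΓ k k i]
    push_cast
    ring
  have h3 : ∑ l, ((∑ k, christoffel h k k l (planePt c s w) : ℝ) : ℂ)
      * ∑ i, ∑ j, (christoffel h l i j (planePt c s w) : ℂ) * planeVec c s i * planeVec c s j
      = 2 * dirDeriv (planeVec c s) (fun q => (κ q : ℂ)) (planePt c s w)
        * (3 * dirDeriv (planeVec c s) (fun q => (κ q : ℂ)) (planePt c s w)
          - dirDeriv (planeVec c s) (fun q => (β q : ℂ)) (planePt c s w)) := by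
    simp only [hgeo, htr _ hw]
    rw [dirDeriv_ofReal (dβ _ hw.1), dirDeriv_ofReal (dκ _ hw.1)]
    simp only [Fin.sum_univ_three]
    push_cast
    ring
  have h4 : ∑ k, ∑ l, (∑ j, (christoffel h k j l (planePt c s w) : ℂ) * planeVec c s j)
      * (∑ i, (christoffel h l k i (planePt c s w) : ℂ) * planeVec c s i)
      = 5 * dirDeriv (planeVec c s) (fun q => (κ q : ℂ)) (planePt c s w) ^ 2
        - 2 * dirDeriv (planeVec c s) (fun q => (κ q : ℂ)) (planePt c s w)
          * dirDeriv (planeVec c s) (fun q => (β q : ℂ)) (planePt c s w)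
        + dirDeriv (planeVec c s) (fun q => (β q : ℂ)) (planePt c s w) ^ 2 := by
    simp only [hA', hA]
    rw [trace_sq_eq (fun i => ((pderiv i κ (planePt c s w) : ℝ) : ℂ)), hnull, hnorm,
      ← dirDeriv_ofReal (dκ _ hw.1)]
    ring
  rw [hsub'] at hsub
  have main : ∑ i, ∑ j, (ricci h i j (planePt c s w) : ℂ) * planeVec c s i * planeVec c s j
      = ∑ k, ∑ i, ∑ j, ((pderiv k (christoffel h k i j) (planePt c s w) : ℝ) : ℂ)
          * planeVec c s i * planeVec c s j
        - ∑ i, ∑ j, (∑ k, ((pderiv j (christoffel h k k i) (planePt c s w) : ℝ) : ℂ))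
          * planeVec c s i * planeVec c s j
        + ∑ l, ((∑ k, christoffel h k k l (planePt c s w) : ℝ) : ℂ)
          * ∑ i, ∑ j, (christoffel h l i j (planePt c s w) : ℂ) * planeVec c s i * planeVec c s j
        - ∑ k, ∑ l, (∑ j, (christoffel h k j l (planePt c s w) : ℂ) * planeVec c s j)
          * (∑ i, (christoffel h l k i (planePt c s w) : ℂ) * planeVec c s i) := by
    generalize planePt c s w = p
    generalize planeVec c s = η
    simp only [ricci]
    generalize christoffel h = Γ
    simp only [Fin.sum_univ_three]
    push_cast
    ring
  rw [main, hdiv, hsub, h3, h4]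
  ring

/-! ### Complexification of real-analytic functions of two variables -/

/-- Each multilinear term of the real power series is expanded in the standard basis; `a n k`
collects the placements with `k` copies of the second basis vector. There are at most `2 ^ n` of
them, which replaces the growth rate `A` by `2 * A`. -/
lemma exists_doubleSeries {g : ℝ × ℝ → ℂ} (hg : AnalyticAt ℝ g 0) :
    ∃ (a : ℕ → ℕ → ℂ) (A C r : ℝ), 0 < A ∧ 0 < r ∧ (∀ n k, ‖a n k‖ ≤ C * A ^ n) ∧
      ∀ w ∈ Metric.ball (0 : ℝ × ℝ) r,
        HasSum (fun n => ∑ k ∈ Finset.range (n + 1),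
          a n k * (w.1 : ℂ) ^ (n - k) * (w.2 : ℂ) ^ k) (g w) := by
  obtain ⟨p, R, hp⟩ := hg
  obtain ⟨C, A, hC, hA, hb⟩ := p.le_mul_pow_of_radius_pos (hp.r_pos.trans_le hp.r_le)
  obtain ⟨r, hr0, hrR⟩ := ENNReal.lt_iff_exists_nnreal_btwn.1 hp.r_pos
  let e : (n : ℕ) → Finset (Fin n) → (Fin n → ℝ × ℝ) := fun n s =>
    s.piecewise (fun _ => (1, 0)) (fun _ => (0, 1))
  have he : ∀ n s, ‖p n (e n s)‖ ≤ C * A ^ n := by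
    intro n s
    refine ((p n).le_of_opNorm_le (hb n) _).trans ?_
    have : ∏ i, ‖e n s i‖ ≤ 1 := by
      refine Finset.prod_le_one (fun _ _ => norm_nonneg _) fun i _ => ?_
      by_cases hi : i ∈ s <;> simp [e, hi, Prod.norm_def]
    exact mul_le_of_le_one_right (by positivity) this
  refine ⟨fun n k => ∑ s : Finset (Fin n) with sᶜ.card = k, p n (e n s), 2 * A, C, r,
    by positivity, by exact_mod_cast hr0, fun n k => ?_, fun w hw => ?_⟩
  · refine (norm_sum_le _ _).trans ((Finset.sum_le_sum fun s _ => he n s).trans ?_)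
    rw [Finset.sum_const, nsmul_eq_mul, mul_pow]
    have : ((Finset.univ.filter fun s : Finset (Fin n) => sᶜ.card = k).card : ℝ) ≤ 2 ^ n := by
      have h1 := Finset.card_filter_le (Finset.univ : Finset (Finset (Fin n)))
        (fun s => sᶜ.card = k)
      rw [Finset.card_univ, Fintype.card_finset, Fintype.card_fin] at h1
      exact_mod_cast h1
    calc _ ≤ 2 ^ n * (C * A ^ n) := mul_le_mul_of_nonneg_right this (by positivity)
      _ = _ := by ring
  · have hs := hp.hasSum (y := w) (by
      rw [Metric.mem_eball, edist_zero_right]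
      rw [mem_ball_zero_iff] at hw
      refine lt_trans ?_ hrR
      rw [← ofReal_norm, ENNReal.ofReal_lt_coe_iff (norm_nonneg _)]
      exact hw)
    rw [zero_add] at hs
    refine hs.congr_fun ?_
    intro n
    have hw' : (fun _ : Fin n => w) = (fun _ => w.1 • ((1 : ℝ), (0 : ℝ)))
        + fun _ => w.2 • ((0 : ℝ), (1 : ℝ)) := by
      funext i
      ext <;> simp
    rw [hw', ContinuousMultilinearMap.map_add_univ]
    have hterm : ∀ s : Finset (Fin n), p n (s.piecewise (fun _ => w.1 • ((1 : ℝ), (0 : ℝ)))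
        (fun _ => w.2 • ((0 : ℝ), (1 : ℝ))))
        = p n (e n s) * (w.1 : ℂ) ^ (n - sᶜ.card) * (w.2 : ℂ) ^ sᶜ.card := by
      intro s
      have h1 : s.piecewise (fun _ => w.1 • ((1 : ℝ), (0 : ℝ)))
          (fun _ => w.2 • ((0 : ℝ), (1 : ℝ)))
          = fun i => (s.piecewise (fun _ => w.1) (fun _ => w.2) i) • e n s i := by
        funext i
        by_cases hi : i ∈ s <;> simp [e, hi]
      have h2 : n - sᶜ.card = s.card := by
        have := Finset.card_add_card_compl s
        rw [Fintype.card_fin] at this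
        omega
      rw [h1, ContinuousMultilinearMap.map_smul_univ, Finset.prod_piecewise, h2]
      simp only [Finset.univ_inter, Finset.prod_const, Complex.real_smul]
      rw [← Finset.compl_eq_univ_sdiff]
      push_cast
      ring
    simp only [hterm, Finset.sum_mul]
    rw [← Finset.sum_fiberwise_of_maps_to (s := Finset.univ) (t := Finset.range (n + 1))
      (g := fun s : Finset (Fin n) => sᶜ.card) (fun s _ => by
        have := Finset.card_le_univ sᶜ
        rw [Fintype.card_fin] at this
        simpa using Nat.lt_succ_of_le this)]
    refine Finset.sum_congr rfl fun k _ => Finset.sum_congr rfl fun s hs => ?_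
    rw [(Finset.mem_filter.1 hs).2]

/-- The same coefficients define a power series over `ℂ`. Degree `n` has `n + 1 ≤ 2 ^ n` monomials,
so radius `(2A)⁻¹` suffices. -/
lemma exists_analytic_doubleSeries {a : ℕ → ℕ → ℂ} {A C : ℝ} (hA : 0 < A)
    (ha : ∀ n k, ‖a n k‖ ≤ C * A ^ n) :
    ∃ δ : ℝ, 0 < δ ∧ ∃ G : ℂ × ℂ → ℂ, AnalyticOnNhd ℂ G (Metric.ball 0 δ) ∧
      ∀ w ∈ Metric.ball (0 : ℂ × ℂ) δ,
        HasSum (fun n => ∑ k ∈ Finset.range (n + 1), a n k * w.1 ^ (n - k) * w.2 ^ k) (G w) := by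
  have hC : 0 ≤ C := by simpa using (norm_nonneg _).trans (ha 0 0)
  -- The monomial is realized by a multilinear map that need not be symmetric: the second coordinate
  -- is read in the first `k` slots and the first coordinate in the others.
  let M : (n k : ℕ) → (ℂ × ℂ) [×n]→L[ℂ] ℂ := fun n k =>
    (ContinuousMultilinearMap.mkPiAlgebra ℂ (Fin n) ℂ).compContinuousLinearMap
      (fun i => if (i : ℕ) < k then ContinuousLinearMap.snd ℂ ℂ ℂ
        else ContinuousLinearMap.fst ℂ ℂ ℂ)
  have hM : ∀ n k, ‖M n k‖ ≤ 1 := by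
    intro n k
    refine (ContinuousMultilinearMap.norm_compContinuousLinearMap_le _ _).trans ?_
    rw [ContinuousMultilinearMap.norm_mkPiAlgebra, one_mul]
    refine Finset.prod_le_one (fun _ _ => norm_nonneg _) fun i _ => ?_
    split_ifs
    · exact ContinuousLinearMap.norm_snd_le ℂ ℂ ℂ
    · exact ContinuousLinearMap.norm_fst_le ℂ ℂ ℂ
  have hMw : ∀ n k, k ≤ n → ∀ w : ℂ × ℂ, M n k (fun _ => w) = w.1 ^ (n - k) * w.2 ^ k := by
    intro n k hk w
    simp only [M, ContinuousMultilinearMap.compContinuousLinearMap_apply,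
      ContinuousMultilinearMap.mkPiAlgebra_apply]
    have h1 : ∀ i : Fin n, (if (i : ℕ) < k then ContinuousLinearMap.snd ℂ ℂ ℂ
        else ContinuousLinearMap.fst ℂ ℂ ℂ) w = (fun i : ℕ => if i < k then w.2 else w.1) i := by
      intro i
      by_cases hi : (i : ℕ) < k <;> simp [hi]
    rw [Finset.prod_congr rfl fun i _ => h1 i,
      Fin.prod_univ_eq_prod_range (fun i : ℕ => if i < k then w.2 else w.1) n]
    obtain ⟨m, rfl⟩ := Nat.exists_eq_add_of_le hk
    rw [Finset.prod_range_add, Finset.prod_congr rfl (g := fun _ => w.2)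
      (fun i hi => if_pos (Finset.mem_range.1 hi))]
    simp [mul_comm]
  let P : FormalMultilinearSeries ℂ (ℂ × ℂ) ℂ := fun n =>
    ∑ k ∈ Finset.range (n + 1), a n k • M n k
  have hP : ∀ n, ‖P n‖ ≤ C * (2 * A) ^ n := by
    intro n
    have h1 : ∀ k ∈ Finset.range (n + 1), ‖a n k • M n k‖ ≤ C * A ^ n := fun k _ => by
      rw [norm_smul]
      exact (mul_le_of_le_one_right (norm_nonneg _) (hM n k)).trans (ha n k)
    refine (norm_sum_le_of_le _ h1).trans ?_
    rw [Finset.sum_const, Finset.card_range, nsmul_eq_mul, mul_pow]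
    have h2 : ((n + 1 : ℕ) : ℝ) ≤ 2 ^ n := by
      exact_mod_cast Nat.succ_le_of_lt n.lt_two_pow_self
    calc _ ≤ 2 ^ n * (C * A ^ n) := mul_le_mul_of_nonneg_right h2 (by positivity)
      _ = _ := by ring
  let r : NNReal := ⟨(2 * A)⁻¹, by positivity⟩
  have hr0 : 0 < r := by
    rw [← NNReal.coe_pos]
    change 0 < (2 * A)⁻¹
    positivity
  have hrad : (r : ENNReal) ≤ P.radius := by
    refine P.le_radius_of_bound C fun n => ?_
    calc ‖P n‖ * (r : ℝ) ^ n ≤ C * (2 * A) ^ n * ((2 * A)⁻¹) ^ n :=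
          mul_le_mul_of_nonneg_right (hP n) (by positivity)
      _ = C := by
          rw [mul_assoc, ← mul_pow, mul_inv_cancel₀ (by positivity), one_pow, mul_one]
  have hball : ∀ w ∈ Metric.ball (0 : ℂ × ℂ) r, w ∈ Metric.eball (0 : ℂ × ℂ) P.radius := by
    intro w hw
    rw [Metric.mem_eball, edist_zero_right]
    refine lt_of_lt_of_le ?_ hrad
    rw [← ofReal_norm, ENNReal.ofReal_lt_coe_iff (norm_nonneg _)]
    simpa using hw
  have hF := P.hasFPowerSeriesOnBall (lt_of_lt_of_le (by exact_mod_cast hr0) hrad)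
  refine ⟨r, by exact_mod_cast hr0, P.sum, fun w hw => hF.analyticOnNhd w (hball w hw),
    fun w hw => ?_⟩
  have hs := hF.hasSum (y := w) (hball w hw)
  rw [zero_add] at hs
  refine hs.congr_fun fun n => ?_
  simp only [P, sum_apply, smul_apply, smul_eq_mul]
  refine Finset.sum_congr rfl fun k hk => ?_
  rw [hMw n k (Nat.lt_succ_iff.1 (Finset.mem_range.1 hk))]
  ring

lemma ofReal_mem_ball {w : ℝ × ℝ} {δ : ℝ} (hw : w ∈ Metric.ball 0 δ) :
    ((w.1 : ℂ), (w.2 : ℂ)) ∈ Metric.ball (0 : ℂ × ℂ) δ := by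
  simpa [Prod.norm_def] using hw

lemma exists_isComplexification {g : ℝ × ℝ → ℂ} (hg : AnalyticAt ℝ g 0) :
    ∃ δ : ℝ, 0 < δ ∧ ∃ G, IsComplexification δ g G := by
  obtain ⟨a, A, C, r, hA, hr, ha, hs⟩ := exists_doubleSeries hg
  obtain ⟨δ, hδ, G, hG, hGs⟩ := exists_analytic_doubleSeries hA ha
  refine ⟨min δ r, lt_min hδ hr, G, hG.mono (Metric.ball_subset_ball (min_le_left _ _)),
    fun w hw => ?_⟩
  have h1 := hGs _ (ofReal_mem_ball (Metric.ball_subset_ball (min_le_left _ _) hw))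
  exact h1.unique (hs w (Metric.ball_subset_ball (min_le_right _ _) hw))

/-- A real-analytic function that vanishes on the axis is divisible by `ρ`. -/
lemma exists_eq_mul_of_axis_eq_zero {g : ℝ × ℝ → ℂ} (hg : AnalyticAt ℝ g 0) {ε : ℝ} (hε : 0 < ε)
    (h0 : ∀ z : ℝ, |z| < ε → g (z, 0) = 0) :
    ∃ δ : ℝ, 0 < δ ∧ ∃ Q : ℂ × ℂ → ℂ, AnalyticOnNhd ℂ Q (Metric.ball 0 δ) ∧
      ∀ w ∈ Metric.ball (0 : ℝ × ℝ) δ, (w.2 : ℂ) * Q ((w.1 : ℂ), (w.2 : ℂ)) = g w := by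
  obtain ⟨a, A, C, r, hA, hr, ha, hs⟩ := exists_doubleSeries hg
  -- Division by `ρ` lowers the degree and the exponent of `ρ` by one, so the quotient has
  -- coefficients `a (n + 1) (k + 1)`.
  have hb : ∀ n k, ‖a (n + 1) (k + 1)‖ ≤ (C * A) * A ^ n := fun n k => by
    refine (ha _ _).trans_eq ?_
    ring
  obtain ⟨δ, hδ, Q, hQ, hQs⟩ := exists_analytic_doubleSeries hA hb
  refine ⟨min δ (min r ε), lt_min hδ (lt_min hr hε), Q,
    hQ.mono (Metric.ball_subset_ball (min_le_left _ _)), fun w hw => ?_⟩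
  have hw1 : w ∈ Metric.ball (0 : ℝ × ℝ) δ := Metric.ball_subset_ball (min_le_left _ _) hw
  have hw2 : w ∈ Metric.ball (0 : ℝ × ℝ) r :=
    Metric.ball_subset_ball ((min_le_right _ _).trans (min_le_left _ _)) hw
  have hw3 : w ∈ Metric.ball (0 : ℝ × ℝ) ε :=
    Metric.ball_subset_ball ((min_le_right _ _).trans (min_le_right _ _)) hw
  have hz2 : (w.1, (0 : ℝ)) ∈ Metric.ball (0 : ℝ × ℝ) r := by
    simp [Prod.norm_def] at hw2 ⊢
    exact hw2.1
  have hz3 : |w.1| < ε := by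
    simp [Prod.norm_def] at hw3
    exact hw3.1
  -- Subtracting the series at `(z, 0)`, whose sum is zero, cancels the terms with `k = 0`; their
  -- coefficients need not be shown to vanish.
  have h1 := (hs w hw2).sub (hs _ hz2)
  rw [h0 _ hz3, sub_zero] at h1
  have h2 := (hQs _ (ofReal_mem_ball hw1)).mul_left (w.2 : ℂ)
  refine h2.unique ?_
  have h3 := (hasSum_nat_add_iff' 1).2 h1
  simp only [Finset.range_one, Finset.sum_singleton] at h3
  simp only [zero_add, Finset.range_one, Finset.sum_singleton, Nat.sub_zero, pow_zero, sub_self,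
    sub_zero, mul_one] at h3
  refine h3.congr_fun fun n => ?_
  rw [← Finset.sum_sub_distrib, Finset.sum_range_succ' _ (n + 1), Finset.mul_sum]
  simp only [Complex.ofReal_zero, pow_zero, sub_self, add_zero]
  refine Finset.sum_congr rfl fun k _ => ?_
  rw [Nat.add_sub_add_right]
  simp
  ring

/-- A holomorphic function on a polydisc that vanishes at the real points vanishes. -/
lemma eq_zero_of_real_eq_zero {δ : ℝ} {H : ℂ × ℂ → ℂ} (hH : AnalyticOnNhd ℂ H (Metric.ball 0 δ))
    (h0 : ∀ w ∈ Metric.ball (0 : ℝ × ℝ) δ, H ((w.1 : ℂ), (w.2 : ℂ)) = 0) :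
    ∀ w ∈ Metric.ball (0 : ℂ × ℂ) δ, H w = 0 := by
  -- The identity theorem in one variable, as real points accumulate at 0. It is applied in the
  -- second variable with the first one real, then in the first variable.
  have key : ∀ f : ℂ → ℂ, 0 < δ → AnalyticOnNhd ℂ f (Metric.ball 0 δ) →
      (∀ x : ℝ, |x| < δ → f x = 0) → ∀ z ∈ Metric.ball (0 : ℂ) δ, f z = 0 := by
    intro f hδ hf hf0
    have hfr : ∃ᶠ z in nhdsWithin (0 : ℂ) {0}ᶜ, f z = (fun _ => (0 : ℂ)) z := by
      have ht : Filter.Tendsto (fun x : ℝ => (x : ℂ)) (nhdsWithin 0 {0}ᶜ)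
          (nhdsWithin (0 : ℂ) {0}ᶜ) := by
        refine tendsto_nhdsWithin_iff.2 ⟨?_, ?_⟩
        · exact (Complex.continuous_ofReal.tendsto' 0 0 (by simp)).mono_left nhdsWithin_le_nhds
        · filter_upwards [self_mem_nhdsWithin] with x hx
          simpa using hx
      refine ht.frequently (Filter.Eventually.frequently ?_)
      filter_upwards [nhdsWithin_le_nhds (Metric.ball_mem_nhds (0 : ℝ) hδ)] with x hx
      exact hf0 x (by simpa using hx)
    exact hf.eqOn_of_preconnected_of_frequently_eq analyticOnNhd_const
      (convex_ball 0 δ).isPreconnected (Metric.mem_ball_self hδ) hfr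
  intro w hw
  have hδ : 0 < δ := Metric.pos_of_mem_ball hw
  have hw' : ‖w.1‖ < δ ∧ ‖w.2‖ < δ := by simpa [Prod.norm_def] using hw
  have h1 : ∀ x : ℝ, |x| < δ → ∀ z ∈ Metric.ball (0 : ℂ) δ, H ((x : ℂ), z) = 0 := by
    intro x hx
    refine key (fun z => H ((x : ℂ), z)) hδ (fun z hz => ?_) fun t ht => ?_
    · refine AnalyticAt.comp (f := fun z : ℂ => ((x : ℂ), z))
        (hH ((x : ℂ), z) ?_) (analyticAt_const.prod analyticAt_id)
      simp [Prod.norm_def] at hz ⊢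
      exact ⟨hx, hz⟩
    · exact h0 (x, t) (by simp [Prod.norm_def, hx, ht])
  refine key (fun z => H (z, w.2)) hδ (fun z hz => ?_) (fun x hx => h1 x hx _ (by simpa using hw'.2))
    w.1 (by simpa using hw'.1)
  refine AnalyticAt.comp (f := fun z : ℂ => (z, w.2)) (hH (z, w.2) ?_)
    (analyticAt_id.prod analyticAt_const)
  simp [Prod.norm_def] at hz ⊢
  exact ⟨hz, hw'.2⟩

/-! ### Uniqueness of complexifications and restriction to the line `ρ = -ir` -/

lemma IsComplexification.mono {δ ε : ℝ} {g : ℝ × ℝ → ℂ} {G : ℂ × ℂ → ℂ}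
    (h : IsComplexification δ g G) (hε : ε ≤ δ) : IsComplexification ε g G :=
  ⟨h.1.mono (Metric.ball_subset_ball hε), fun w hw => h.2 w (Metric.ball_subset_ball hε hw)⟩

lemma IsComplexification.unique {δ : ℝ} {g : ℝ × ℝ → ℂ} {G G' : ℂ × ℂ → ℂ}
    (h : IsComplexification δ g G) (h' : IsComplexification δ g G') :
    ∀ w ∈ Metric.ball (0 : ℂ × ℂ) δ, G w = G' w := by
  intro w hw
  refine sub_eq_zero.1 (eq_zero_of_real_eq_zero (h.1.sub h'.1) (fun x hx => ?_) w hw)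
  simp [h.2 x hx, h'.2 x hx]

lemma null_mem_ball {r δ : ℝ} (hr : |r| < δ) :
    ((r : ℂ), -Complex.I * (r : ℂ)) ∈ Metric.ball (0 : ℂ × ℂ) δ := by
  simp [Prod.norm_def, hr]

/-- The continuation chosen in the definition and the given one agree on the smaller of their two
polydiscs, which still contains `(r, -ir)`. -/
lemma leadingOrder_eq {δ : ℝ} {g : ℝ × ℝ → ℂ} {G : ℂ × ℂ → ℂ} (h : IsComplexification δ g G)
    {r : ℝ} (hr : |r| < δ) : leadingOrder g r = G ((r : ℂ), -Complex.I * (r : ℂ)) := by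
  have H : ∃ G : ℂ × ℂ → ℂ, ∃ δ : ℝ, |r| < δ ∧ IsComplexification δ g G := ⟨G, δ, hr, h⟩
  rw [leadingOrder, dif_pos H]
  obtain ⟨δ', hr', h'⟩ := H.choose_spec
  exact (h'.mono (min_le_left δ' δ)).unique (h.mono (min_le_right δ' δ)) _
    (null_mem_ball (lt_min hr' hr))

/-- The derivative `(∂_z - i ∂_ρ) g` on the meridian plane. -/
def etaDeriv (g : ℝ × ℝ → ℂ) (w : ℝ × ℝ) : ℂ :=
  fderiv ℝ g w (1, 0) - Complex.I * fderiv ℝ g w (0, 1)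

/-- The derivative `(∂_z - i ∂_ρ) G` of a holomorphic function. -/
def etaDerivC (G : ℂ × ℂ → ℂ) (w : ℂ × ℂ) : ℂ := fderiv ℂ G w (1, -Complex.I)

lemma analyticOnNhd_etaDerivC {s : Set (ℂ × ℂ)} {G : ℂ × ℂ → ℂ} (hG : AnalyticOnNhd ℂ G s) :
    AnalyticOnNhd ℂ (etaDerivC G) s := fun w hw =>
  ((ContinuousLinearMap.apply ℂ ℂ ((1 : ℂ), -Complex.I)).analyticAt _).comp (hG w hw).fderiv

lemma etaDeriv_congr {g f : ℝ × ℝ → ℂ} {w : ℝ × ℝ} (h : g =ᶠ[nhds w] f) :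
    etaDeriv g w = etaDeriv f w := by
  rw [etaDeriv, etaDeriv, h.fderiv_eq]

lemma IsComplexification.etaDeriv {δ : ℝ} {g : ℝ × ℝ → ℂ} {G : ℂ × ℂ → ℂ}
    (h : IsComplexification δ g G) : IsComplexification δ (etaDeriv g) (etaDerivC G) := by
  refine ⟨analyticOnNhd_etaDerivC h.1, fun w hw => ?_⟩
  let L : ℝ × ℝ →L[ℝ] ℂ × ℂ := Complex.ofRealCLM.prodMap Complex.ofRealCLM
  have h1 : HasFDerivAt G (fderiv ℂ G (L w)) (L w) :=
    (h.1 (L w) (ofReal_mem_ball hw)).differentiableAt.hasFDerivAt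
  have h2 : HasFDerivAt (fun x => G (L x)) (((fderiv ℂ G (L w)).restrictScalars ℝ).comp L) w :=
    (h1.restrictScalars ℝ).comp w L.hasFDerivAt
  have h3 : (fun x => G (L x)) =ᶠ[nhds w] g := by
    filter_upwards [Metric.isOpen_ball.mem_nhds hw] with x hx using h.2 x hx
  rw [Multipole.etaDeriv, ← h3.fderiv_eq, h2.fderiv]
  have e1 : L (1, 0) = (1, 0) := by simp [L]
  have e2 : L (0, 1) = (0, 1) := by simp [L]
  simp only [ContinuousLinearMap.comp_apply, ContinuousLinearMap.coe_restrictScalars', e1, e2]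
  rw [etaDerivC]
  have e3 : ((1 : ℂ), -Complex.I) = (1, 0) - Complex.I • ((0 : ℂ), (1 : ℂ)) := by simp
  rw [e3, map_sub, map_smul, smul_eq_mul]
  rfl

/-- The line `r ↦ (r, -ir)` has velocity `(1, -i)`, so restriction to it turns `∂_z - i ∂_ρ` into
`d/dr`. -/
lemma hasDerivAt_null {δ : ℝ} {G : ℂ × ℂ → ℂ} (hG : AnalyticOnNhd ℂ G (Metric.ball 0 δ)) {r : ℝ}
    (hr : |r| < δ) :
    HasDerivAt (fun r : ℝ => G ((r : ℂ), -Complex.I * (r : ℂ)))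
      (etaDerivC G ((r : ℂ), -Complex.I * (r : ℂ))) r := by
  have h1 := (hG _ (null_mem_ball hr)).differentiableAt.hasFDerivAt
  have h2 : HasDerivAt (fun t : ℂ => (t, -Complex.I * t)) (1, -Complex.I) (r : ℂ) := by
    have := (hasDerivAt_id (r : ℂ)).prodMk ((hasDerivAt_id (r : ℂ)).const_mul (-Complex.I))
    simpa using this
  have h3 := h1.comp_hasDerivAt (r : ℂ) h2
  exact h3.comp_ofReal

lemma analyticOnNhd_null {δ : ℝ} {G : ℂ × ℂ → ℂ} (hG : AnalyticOnNhd ℂ G (Metric.ball 0 δ)) :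
    AnalyticOnNhd ℝ (fun r : ℝ => G ((r : ℂ), -Complex.I * (r : ℂ))) (Set.Ioo (-δ) δ) := by
  intro r hr
  have h1 := (hG _ (null_mem_ball (abs_lt.2 hr))).restrictScalars (𝕜 := ℝ)
  refine AnalyticAt.comp (f := fun r : ℝ => ((r : ℂ), -Complex.I * (r : ℂ))) h1 ?_
  exact (Complex.ofRealCLM.analyticAt r).prod
    (analyticAt_const.mul (Complex.ofRealCLM.analyticAt r))

lemma IsComplexification.leadingOrder_eventuallyEq {δ : ℝ} {g : ℝ × ℝ → ℂ} {G : ℂ × ℂ → ℂ}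
    (h : IsComplexification δ g G) {r : ℝ} (hr : r ∈ Set.Ioo (-δ) δ) :
    leadingOrder g =ᶠ[nhds r] fun r : ℝ => G ((r : ℂ), -Complex.I * (r : ℂ)) := by
  filter_upwards [isOpen_Ioo.mem_nhds hr] with t ht using leadingOrder_eq h (abs_lt.2 ht)

lemma IsComplexification.analyticOnNhd_leadingOrder {δ : ℝ} {g : ℝ × ℝ → ℂ} {G : ℂ × ℂ → ℂ}
    (h : IsComplexification δ g G) : AnalyticOnNhd ℝ (leadingOrder g) (Set.Ioo (-δ) δ) :=
  fun r hr => (analyticOnNhd_null h.1 r hr).congr (h.leadingOrder_eventuallyEq hr).symm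

lemma IsComplexification.deriv_leadingOrder {δ : ℝ} {g : ℝ × ℝ → ℂ} {G : ℂ × ℂ → ℂ}
    (h : IsComplexification δ g G) {r : ℝ} (hr : r ∈ Set.Ioo (-δ) δ) :
    deriv (leadingOrder g) r = etaDerivC G ((r : ℂ), -Complex.I * (r : ℂ)) := by
  rw [(h.leadingOrder_eventuallyEq hr).deriv_eq]
  exact (hasDerivAt_null h.1 (abs_lt.2 hr)).deriv

lemma IsComplexification.deriv_deriv_leadingOrder {δ : ℝ} {g : ℝ × ℝ → ℂ} {G : ℂ × ℂ → ℂ}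
    (h : IsComplexification δ g G) {r : ℝ} (hr : r ∈ Set.Ioo (-δ) δ) :
    deriv (deriv (leadingOrder g)) r
      = etaDerivC (etaDerivC G) ((r : ℂ), -Complex.I * (r : ℂ)) := by
  have : deriv (leadingOrder g) =ᶠ[nhds r]
      fun r : ℝ => etaDerivC G ((r : ℂ), -Complex.I * (r : ℂ)) := by
    filter_upwards [isOpen_Ioo.mem_nhds hr] with t ht using h.deriv_leadingOrder ht
  rw [this.deriv_eq]
  exact (hasDerivAt_null (analyticOnNhd_etaDerivC h.1) (abs_lt.2 hr)).deriv

/-! ### Trace-free tensors are determined on null vectors -/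

/-- The tensor `T_{m b}` for a fixed value `m` of the first index. -/
def fixFirst {n : ℕ} (T : Tensor (n + 1)) (m : Fin 3) : Tensor n := fun b => T (Fin.cons m b)

lemma IsSymm.fixFirst {n : ℕ} {T : Tensor (n + 1)} (hT : IsSymm T) (m : Fin 3) :
    IsSymm (fixFirst T m) := by
  intro σ b
  have := hT (Equiv.Perm.decomposeFin.symm (0, σ)) (Fin.cons m b)
  rw [Multipole.fixFirst, Multipole.fixFirst, ← this]
  congr 1
  funext i
  refine Fin.cases ?_ (fun i => ?_) i <;> simp

lemma IsSymm.fixFirst_comm {n : ℕ} {T : Tensor (n + 2)} (hT : IsSymm T) (k m : Fin 3) :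
    Multipole.fixFirst (Multipole.fixFirst T k) m
      = Multipole.fixFirst (Multipole.fixFirst T m) k := by
  funext b
  have := hT (Equiv.swap 0 1) (Fin.cons m (Fin.cons k b))
  simp only [Multipole.fixFirst]
  rw [← this]
  congr 1
  funext i
  refine Fin.cases ?_ (fun i => Fin.cases ?_ (fun i => ?_) i) i
  · rw [Equiv.swap_apply_left]
    rfl
  · have e : Fin.succ (0 : Fin (n + 1)) = 1 := rfl
    rw [e, Equiv.swap_apply_right]
    rfl
  · rw [Equiv.swap_apply_of_ne_of_ne (Fin.succ_ne_zero _)]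
    · rfl
    · intro h
      exact Fin.succ_ne_zero i (Fin.succ_injective _ h)

lemma IsTraceFree.fixFirst {n : ℕ} {h : Matrix (Fin 3) (Fin 3) ℝ} {T : Tensor (n + 1)}
    (hT : IsTraceFree h T) (m : Fin 3) : IsTraceFree h (fixFirst T m) := by
  intro i j hij b
  have := hT i.succ j.succ ((Fin.succ_injective _).ne hij) (Fin.cons m b)
  rw [← this]
  simp only [Multipole.fixFirst, Fin.cons_update]

lemma IsTraceFree.sum_fixFirst {n : ℕ} {T : Tensor (n + 2)} (hT : IsTraceFree 1 T) :
    ∀ b, ∑ k, Multipole.fixFirst (Multipole.fixFirst T k) k b = 0 := by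
  intro b
  have := trace_eq_zero_iff_one.1 hT 0 (Fin.succ 0) (Fin.succ_ne_zero 0).symm
    (Fin.cons 0 (Fin.cons 0 b))
  rw [← this]
  refine Finset.sum_congr rfl fun k _ => ?_
  rw [Fin.update_cons_zero, ← Fin.cons_update, Fin.update_cons_zero]
  rfl

/-- By symmetry all `n + 1` slots contribute equally to the derivative. -/
lemma hasDerivAt_contract {n : ℕ} {T : Tensor (n + 1)} (hT : IsSymm T) {v : ℝ → Fin 3 → ℂ}
    {v' : Fin 3 → ℂ} {t : ℝ} (hv : ∀ m, HasDerivAt (fun t => v t m) (v' m) t) :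
    HasDerivAt (fun t => contract T (v t))
      ((n + 1) * ∑ m, v' m * contract (fixFirst T m) (v t)) t := by
  induction n with
  | zero =>
    have e : ∀ u, contract T u = ∑ m, u m * contract (fixFirst T m) (v t) := by
      intro u
      rw [contract_succ]
      refine Finset.sum_congr rfl fun m _ => ?_
      simp [contract, fixFirst]
    simp only [e]
    have := HasDerivAt.fun_sum (u := Finset.univ) fun m _ =>
      (hv m).mul_const (contract (fixFirst T m) (v t))
    simpa using this
  | succ n ih =>
    have e : ∀ u, contract T u = ∑ m, u m * contract (fixFirst T m) u := contract_succ T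
    simp only [e]
    have := HasDerivAt.fun_sum (u := Finset.univ) fun m _ => (hv m).fun_mul (ih (hT.fixFirst m))
    refine this.congr_deriv ?_
    rw [Finset.sum_add_distrib]
    have h2 : ∑ m, v t m * ((n + 1) * ∑ k, v' k * contract (fixFirst (fixFirst T m) k) (v t))
        = (n + 1) * ∑ m, v' m * contract (fixFirst T m) (v t) := by
      simp only [contract_succ (fixFirst T _)]
      simp only [Finset.mul_sum]
      rw [Finset.sum_comm]
      refine Finset.sum_congr rfl fun k _ => Finset.sum_congr rfl fun m _ => ?_
      change _ = (n + 1) * (v' k * (v t m * contract (fixFirst (fixFirst T k) m) (v t)))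
      rw [hT.fixFirst_comm k m]
      ring
    rw [h2]
    push_cast
    ring

/-- The null vectors `∂_z - i ∂_ρ`, parametrized by the azimuth. -/
def nullVec (t : ℝ) : Fin 3 → ℂ := planeVec (Real.cos t) (Real.sin t)

/-- The derivative of `nullVec`. -/
def nullVec' (t : ℝ) : Fin 3 → ℂ := ![Complex.I * Real.sin t, -Complex.I * Real.cos t, 0]

/-- The second derivative of `nullVec`. -/
def nullVec'' (t : ℝ) : Fin 3 → ℂ := ![Complex.I * Real.cos t, Complex.I * Real.sin t, 0]

lemma hasDerivAt_nullVec (t : ℝ) (m : Fin 3) :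
    HasDerivAt (fun t => nullVec t m) (nullVec' t m) t := by
  have hc := (Real.hasDerivAt_cos t).ofReal_comp
  have hs := (Real.hasDerivAt_sin t).ofReal_comp
  fin_cases m
  · have := hc.const_mul (-Complex.I)
    simpa [nullVec, nullVec', planeVec] using this
  · have := hs.const_mul (-Complex.I)
    simpa [nullVec, nullVec', planeVec] using this
  · simpa [nullVec, nullVec', planeVec] using hasDerivAt_const t (1 : ℂ)

lemma hasDerivAt_nullVec' (t : ℝ) (m : Fin 3) :
    HasDerivAt (fun t => nullVec' t m) (nullVec'' t m) t := by
  have hc := (Real.hasDerivAt_cos t).ofReal_comp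
  have hs := (Real.hasDerivAt_sin t).ofReal_comp
  fin_cases m
  · have := hs.const_mul Complex.I
    simpa [nullVec', nullVec''] using this
  · have := hc.const_mul (-Complex.I)
    simpa [nullVec', nullVec''] using this
  · simpa [nullVec', nullVec''] using hasDerivAt_const t (0 : ℂ)

/-- The vectors `η`, `η'`, `η''` form a basis of `ℂ³`: `η + η''` is the axis direction, while `η'`
and `η''` span the horizontal plane. -/
lemma eq_zero_of_frame {L : Fin 3 → ℂ} {t : ℝ} (h0 : ∑ m, nullVec t m * L m = 0)
    (h1 : ∑ m, nullVec' t m * L m = 0) (h2 : ∑ m, nullVec'' t m * L m = 0) : L = 0 := by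
  have hcs : (Real.cos t : ℂ) ^ 2 + (Real.sin t : ℂ) ^ 2 = 1 := by
    exact_mod_cast Real.cos_sq_add_sin_sq t
  simp only [Fin.sum_univ_three, nullVec, nullVec', nullVec'', planeVec, Matrix.cons_val_zero,
    Matrix.cons_val_one, Matrix.cons_val] at h0 h1 h2
  have hI := Complex.I_sq
  funext m
  fin_cases m
  · change L 0 = 0
    linear_combination -Complex.I * Real.cos t * h2 - Complex.I * Real.sin t * h1 - L 0 * hcs
      + (Real.cos t ^ 2 + Real.sin t ^ 2) * L 0 * hI
  · change L 1 = 0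
    linear_combination -Complex.I * Real.sin t * h2 + Complex.I * Real.cos t * h1 - L 1 * hcs
      + (Real.cos t ^ 2 + Real.sin t ^ 2) * L 1 * hI
  · change L 2 = 0
    linear_combination h0 + h2

/-- In the orthonormal frame of the azimuth, vanishing trace together with `b(η, η) = 0` gives
`b(η', η') = 2 b(η'', η)`. The two terms of `h2` therefore combine to `(1 + 2c) b(η'', η)`. -/
lemma sum_nullVec''_eq_zero {b : Fin 3 → Fin 3 → ℂ} {t : ℝ} {c : ℂ} (hc : 1 + 2 * c ≠ 0)
    (hb : ∀ k m, b k m = b m k) (htr : ∑ k, b k k = 0)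
    (h0 : ∑ m, nullVec t m * ∑ k, nullVec t k * b m k = 0)
    (h2 : ∑ m, nullVec'' t m * ∑ k, nullVec t k * b m k
      + c * ∑ m, nullVec' t m * ∑ k, nullVec' t k * b m k = 0) :
    ∑ m, nullVec'' t m * ∑ k, nullVec t k * b m k = 0 := by
  have hcs : (Real.cos t : ℂ) ^ 2 + (Real.sin t : ℂ) ^ 2 = 1 := by
    exact_mod_cast Real.cos_sq_add_sin_sq t
  have hI := Complex.I_sq
  have key : ∑ m, nullVec' t m * ∑ k, nullVec' t k * b m k
      = 2 * ∑ m, nullVec'' t m * ∑ k, nullVec t k * b m k := by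
    simp only [Fin.sum_univ_three, nullVec, nullVec', nullVec'', planeVec, Matrix.cons_val_zero,
      Matrix.cons_val_one, Matrix.cons_val, hb 1 0, hb 2 0, hb 2 1] at htr h0 ⊢
    linear_combination h0 - htr - (b 0 0 + b 1 1) * hcs
      + ((Real.sin t ^ 2 + Real.cos t ^ 2) * (b 0 0 + b 1 1)) * hI
  rw [key] at h2
  have h3 : (1 + 2 * c) * ∑ m, nullVec'' t m * ∑ k, nullVec t k * b m k = 0 := by
    linear_combination h2
  exact (mul_eq_zero.1 h3).resolve_left hc

/-- A symmetric trace-free tensor that vanishes on all null vectors `∂_z - i ∂_ρ` is zero. -/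
lemma eq_zero_of_contract_nullVec {n : ℕ} {Q : Tensor n} (hs : IsSymm Q) (ht : IsTraceFree 1 Q)
    (hQ : ∀ t, contract Q (nullVec t) = 0) : Q = 0 := by
  induction n with
  | zero =>
    funext a
    have := hQ 0
    simp only [contract, Finset.univ_unique, Finset.univ_eq_empty, Finset.prod_empty, one_mul,
      Finset.sum_singleton] at this
    exact (congrArg Q (Subsingleton.elim a _)).trans this
  | succ n ih =>
    have h0 : ∀ t, ∑ m, nullVec t m * contract (fixFirst Q m) (nullVec t) = 0 := fun t => by
      rw [← hQ t]
      exact (contract_succ Q _).symm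
    -- Differentiating the vanishing full contraction in the azimuth; symmetry supplies the nonzero
    -- factor `n + 1`.
    have h1 : ∀ t, ∑ m, nullVec' t m * contract (fixFirst Q m) (nullVec t) = 0 := by
      intro t
      have hd := hasDerivAt_contract hs (hasDerivAt_nullVec t)
      simp only [hQ] at hd
      have := hd.unique (hasDerivAt_const t (0 : ℂ))
      exact (mul_eq_zero.1 this).resolve_left (by exact_mod_cast n.succ_ne_zero)
    have h2 : ∀ t, ∑ m, nullVec'' t m * contract (fixFirst Q m) (nullVec t) = 0 := by
      intro t
      cases n with
      | zero =>
        -- In rank one the remaining tensor has no slots, so its contraction is independent of the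
        -- vector and `h1` can be differentiated directly.
        have e : ∀ u m, contract (fixFirst Q m) u = contract (fixFirst Q m) (nullVec t) := by
          intro u m
          simp [contract, fixFirst]
        have h1' : ∀ r, ∑ m, nullVec' r m * contract (fixFirst Q m) (nullVec t) = 0 := by
          intro r
          rw [← h1 r]
          simp only [e (nullVec r)]
        have hd := HasDerivAt.fun_sum (u := Finset.univ) fun m _ =>
          (hasDerivAt_nullVec' t m).mul_const (contract (fixFirst Q m) (nullVec t))
        simp only [h1'] at hd
        exact hd.unique (hasDerivAt_const t (0 : ℂ))
      | succ n =>
        have hd := HasDerivAt.fun_sum (u := Finset.univ) fun m _ =>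
          (hasDerivAt_nullVec' t m).fun_mul
            (hasDerivAt_contract (hs.fixFirst m) (hasDerivAt_nullVec t))
        simp only [h1] at hd
        have hd' := hd.unique (hasDerivAt_const t (0 : ℂ))
        have e : ∀ m, contract (fixFirst Q m) (nullVec t)
            = ∑ k, nullVec t k * contract (fixFirst (fixFirst Q m) k) (nullVec t) := fun m =>
          contract_succ _ _
        simp only [e]
        -- Differentiating `h1` gives the `η''` term plus `n + 1` equal terms in `b(η', η')`, one
        -- for each slot left after fixing the first; hence `c = n + 1`.
        refine sum_nullVec''_eq_zero (c := (n : ℂ) + 1) ?_ (fun k m => ?_) ?_ ?_ ?_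
        · have : (1 + 2 * ((n : ℂ) + 1)) = ((2 * n + 3 : ℕ) : ℂ) := by
            push_cast
            ring
          rw [this]
          exact_mod_cast Nat.succ_ne_zero (2 * n + 2)
        · rw [hs.fixFirst_comm k m]
        · simp only [contract]
          rw [Finset.sum_comm]
          refine Finset.sum_eq_zero fun a _ => ?_
          rw [← Finset.mul_sum, ht.sum_fixFirst a, mul_zero]
        · simp only [← e]
          exact h0 t
        · rw [Finset.sum_add_distrib] at hd'
          simp only [← e]
          rw [← hd', Finset.mul_sum]
          congr 1
          exact Finset.sum_congr rfl fun m _ => by ring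
    have hL : ∀ m t, contract (fixFirst Q m) (nullVec t) = 0 := fun m t =>
      congrFun (eq_zero_of_frame (h0 t) (h1 t) (h2 t)) m
    funext a
    have := congrFun (ih (hs.fixFirst (a 0)) (ht.fixFirst (a 0)) (hL (a 0))) (Fin.tail a)
    simpa [fixFirst] using this

/-! ### The recursion on the meridian planes -/

lemma planePt_mem_ball {c s R : ℝ} (hcs : c ^ 2 + s ^ 2 = 1) {w : ℝ × ℝ}
    (hw : w ∈ Metric.ball 0 R) : planePt c s w ∈ Metric.ball (0 : Pt) R := by
  have hR : 0 < R := Metric.pos_of_mem_ball hw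
  have hw' : |w.1| < R ∧ |w.2| < R := by simpa [Prod.norm_def] using hw
  have hc : |c| ≤ 1 := by
    rw [← sq_le_one_iff_abs_le_one]
    nlinarith [sq_nonneg s]
  have hs : |s| ≤ 1 := by
    rw [← sq_le_one_iff_abs_le_one]
    nlinarith [sq_nonneg c]
  rw [mem_ball_zero_iff, pi_norm_lt_iff hR]
  intro i
  fin_cases i
  · simp only [planePt, Real.norm_eq_abs]
    exact (abs_mul w.2 c).trans_lt ((mul_le_of_le_one_right (abs_nonneg _) hc).trans_lt hw'.2)
  · simp only [planePt, Real.norm_eq_abs]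
    exact (abs_mul w.2 s).trans_lt ((mul_le_of_le_one_right (abs_nonneg _) hs).trans_lt hw'.2)
  · exact hw'.1

/-- The linear embedding of a meridian plane. -/
def planeCLM (c s : ℝ) : ℝ × ℝ →L[ℝ] Pt :=
  ContinuousLinearMap.pi ![c • ContinuousLinearMap.snd ℝ ℝ ℝ, s • ContinuousLinearMap.snd ℝ ℝ ℝ,
    ContinuousLinearMap.fst ℝ ℝ ℝ]

lemma planeCLM_apply (c s : ℝ) (w : ℝ × ℝ) : planeCLM c s w = planePt c s w := by
  funext i
  fin_cases i <;> simp [planeCLM, planePt, mul_comm]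

lemma dirDeriv_planePt {g : Pt → ℂ} {c s : ℝ} {w : ℝ × ℝ}
    (hg : DifferentiableAt ℝ g (planePt c s w)) :
    dirDeriv (planeVec c s) g (planePt c s w) = etaDeriv (fun w => g (planePt c s w)) w := by
  have h1 : HasFDerivAt (fun w => g (planePt c s w))
      ((fderiv ℝ g (planePt c s w)).comp (planeCLM c s)) w := by
    have h2 := hg.hasFDerivAt
    rw [← planeCLM_apply] at h2
    have := h2.comp w (planeCLM c s).hasFDerivAt
    have e : g ∘ (planeCLM c s) = fun w => g (planePt c s w) := by
      funext w
      simp [planeCLM_apply]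
    rwa [e, planeCLM_apply] at this
  rw [etaDeriv, h1.fderiv]
  have e1 : planeCLM c s (1, 0) = Pi.single 2 1 := by
    rw [planeCLM_apply]
    funext i
    fin_cases i <;> simp [planePt]
  have e2 : planeCLM c s (0, 1) = c • Pi.single 0 1 + s • Pi.single 1 1 := by
    rw [planeCLM_apply]
    funext i
    fin_cases i <;> simp [planePt]
  simp only [ContinuousLinearMap.comp_apply, e1, e2, map_add, map_smul, Complex.real_smul]
  simp only [dirDeriv, pderiv, Fin.sum_univ_three, planeVec, Matrix.cons_val_zero,
    Matrix.cons_val_one, Matrix.cons_val]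
  ring

lemma rho_planePt {c s : ℝ} (hcs : c ^ 2 + s ^ 2 = 1) (w : ℝ × ℝ) :
    rho (planePt c s w) = |w.2| := by
  rw [rho, ← Real.sqrt_sq_eq_abs]
  congr 1
  simp only [planePt, Matrix.cons_val_zero, Matrix.cons_val_one]
  linear_combination w.2 ^ 2 * hcs

lemma meridian_eq (w : ℝ × ℝ) : meridian w = planePt 1 0 w := by
  simp [meridian, planePt]

lemma IsAxisymmetricOn.planePt_eq {E : Type*} {R : ℝ} {g : Pt → E}
    (hg : IsAxisymmetricOn (Metric.ball 0 R) g) {c s : ℝ} (hcs : c ^ 2 + s ^ 2 = 1) {w : ℝ × ℝ}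
    (hw : w ∈ Metric.ball 0 R) : g (planePt c s w) = g (meridian w) := by
  rw [meridian_eq]
  refine hg _ (planePt_mem_ball hcs hw) _ (planePt_mem_ball (by simp) hw) (by simp [planePt]) ?_
  rw [rho_planePt hcs, rho_planePt (by simp)]

/-- The complement of the axis is dense. Identities derived from the cylindrical form of the metric
extend to the axis in this way. -/
lemma eqOn_ball_of_eqOn_off_axis {R : ℝ} {F G : ℝ × ℝ → ℂ}
    (hF : ContinuousOn F (Metric.ball 0 R)) (hG : ContinuousOn G (Metric.ball 0 R))
    (h : ∀ w ∈ Metric.ball (0 : ℝ × ℝ) R, w.2 ≠ 0 → F w = G w) :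
    ∀ w ∈ Metric.ball (0 : ℝ × ℝ) R, F w = G w := by
  intro w hw
  have hO := Metric.isOpen_ball.mem_nhds hw
  have hd : Dense {x : ℝ × ℝ | x.2 ≠ 0} := by
    have : {x : ℝ × ℝ | x.2 ≠ 0} = Prod.snd ⁻¹' {0}ᶜ := rfl
    rw [this]
    exact (dense_compl_singleton (0 : ℝ)).preimage isOpenMap_snd
  have hne : (nhdsWithin w {x : ℝ × ℝ | x.2 ≠ 0}).NeBot :=
    mem_closure_iff_nhdsWithin_neBot.1 (hd w)
  have t1 : Filter.Tendsto F (nhdsWithin w {x : ℝ × ℝ | x.2 ≠ 0}) (nhds (F w)) :=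
    (hF.continuousAt hO).mono_left nhdsWithin_le_nhds
  have t2 : Filter.Tendsto G (nhdsWithin w {x : ℝ × ℝ | x.2 ≠ 0}) (nhds (G w)) :=
    (hG.continuousAt hO).mono_left nhdsWithin_le_nhds
  refine tendsto_nhds_unique (t1.congr' ?_) t2
  filter_upwards [self_mem_nhdsWithin, nhdsWithin_le_nhds hO] with x hx hx' using h x hx' hx

lemma continuousOn_planePt {E : Type*} [TopologicalSpace E] {R : ℝ} {g : Pt → E}
    (hg : ContinuousOn g (Metric.ball 0 R)) {c s : ℝ} (hcs : c ^ 2 + s ^ 2 = 1) :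
    ContinuousOn (fun w => g (planePt c s w)) (Metric.ball 0 R) := by
  have : ContinuousOn (planePt c s) (Metric.ball 0 R) := by
    have e : planePt c s = planeCLM c s := by
      funext w
      rw [planeCLM_apply]
    rw [e]
    exact (planeCLM c s).continuous.continuousOn
  exact hg.comp this fun w hw => planePt_mem_ball hcs hw

/-! ### The scalar recursion on a meridian plane, axis included -/

section

variable {R : ℝ} {h : Pt → Matrix (Fin 3) (Fin 3) ℝ} {β κ : Pt → ℝ} {c s : ℝ}

lemma metric_planeVec_ball (hh : IsSmoothMetricOn (Metric.ball 0 R) h)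
    (hform : HasAxisymmetricForm (Metric.ball 0 R) h β κ) (hcs : c ^ 2 + s ^ 2 = 1) :
    ∀ w ∈ Metric.ball (0 : ℝ × ℝ) R,
      ∑ k, ∑ l, (h (planePt c s w) k l : ℂ) * planeVec c s k * planeVec c s l = 0 := by
  refine eqOn_ball_of_eqOn_off_axis (G := fun _ => 0) ?_ continuousOn_const fun w hw hw' =>
    metric_planeVec hform hcs (planePt_mem_offAxis hcs (planePt_mem_ball hcs hw) hw')
  refine continuousOn_finsetSum _ fun k _ => continuousOn_finsetSum _ fun l _ =>
    ContinuousOn.mul (ContinuousOn.mul ?_ continuousOn_const) continuousOn_const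
  exact continuousOn_planePt (g := fun p => (h p k l : ℂ))
    (contDiffOn_ofReal (hh.1 k l)).continuousOn hcs

lemma contDiffOn_dirDeriv {U : Set Pt} (hU : IsOpen U) {g : Pt → ℂ} (hg : ContDiffOn ℝ ∞ g U)
    (v : Fin 3 → ℂ) : ContDiffOn ℝ ∞ (dirDeriv v g) U :=
  ContDiffOn.sum fun i _ => contDiffOn_const.mul (ContDiffOn.pderiv hU hg i)

lemma christoffel_planeVec_ball (hh : IsSmoothMetricOn (Metric.ball 0 R) h)
    (hform : HasAxisymmetricForm (Metric.ball 0 R) h β κ)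
    (hβ : ContDiffOn ℝ ∞ β (Metric.ball 0 R)) (hκ : ContDiffOn ℝ ∞ κ (Metric.ball 0 R))
    (hβs : IsAxisymmetricOn (Metric.ball 0 R) β) (hκs : IsAxisymmetricOn (Metric.ball 0 R) κ)
    (hcs : c ^ 2 + s ^ 2 = 1) (k : Fin 3) :
    ∀ w ∈ Metric.ball (0 : ℝ × ℝ) R,
      ∑ i, ∑ j, (christoffel h k i j (planePt c s w) : ℂ) * planeVec c s i * planeVec c s j
        = 2 * dirDeriv (planeVec c s) (fun q => (κ q : ℂ)) (planePt c s w) * planeVec c s k := by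
  refine eqOn_ball_of_eqOn_off_axis ?_ ?_ fun w hw hw' => christoffel_planeVec Metric.isOpen_ball
    hform hβ hκ hβs hκs hcs (planePt_mem_offAxis hcs (planePt_mem_ball hcs hw) hw') k
  · refine continuousOn_finsetSum _ fun i _ => continuousOn_finsetSum _ fun j _ =>
      ContinuousOn.mul (ContinuousOn.mul ?_ continuousOn_const) continuousOn_const
    exact continuousOn_planePt (g := fun p => (christoffel h k i j p : ℂ))
      (contDiffOn_ofReal (contDiffOn_christoffel Metric.isOpen_ball hh k i j)).continuousOn hcs
  · exact (continuousOn_const.mul (continuousOn_planePt (contDiffOn_dirDeriv Metric.isOpen_ball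
      (contDiffOn_ofReal hκ) _).continuousOn hcs)).mul continuousOn_const

/-- The contraction of the `n`-th Geroch–Hansen tensor with `∂_z - i ∂_ρ` on the meridian plane
with azimuth `(c, s)`. -/
def planeFun (h : Pt → Matrix (Fin 3) (Fin 3) ℝ) (φ : Pt → ℂ) (c s : ℝ) (n : ℕ) (w : ℝ × ℝ) : ℂ :=
  contract (gerochHansen h φ n (planePt c s w)) (planeVec c s)

/-- The contraction of the Ricci tensor with `∂_z - i ∂_ρ`. -/
def planeRicci (h : Pt → Matrix (Fin 3) (Fin 3) ℝ) (c s : ℝ) (w : ℝ × ℝ) : ℂ :=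
  ∑ i, ∑ j, (ricci h i j (planePt c s w) : ℂ) * planeVec c s i * planeVec c s j

lemma fFun_eq (h : Pt → Matrix (Fin 3) (Fin 3) ℝ) (φ : Pt → ℂ) (n : ℕ) :
    fFun h φ n = planeFun h φ 1 0 n := by
  have e : eta = planeVec 1 0 := by
    simp [eta, planeVec]
  funext w
  rw [fFun, planeFun, contract, meridian_eq, e]

lemma planeFun_zero (h : Pt → Matrix (Fin 3) (Fin 3) ℝ) (φ : Pt → ℂ) (w : ℝ × ℝ) :
    planeFun h φ c s 0 w = φ (planePt c s w) := by
  simp [planeFun, contract, gerochHansen]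

lemma dirDeriv_contract (hh : IsSmoothMetricOn (Metric.ball 0 R) h) {φ : Pt → ℂ}
    (hφ : ContDiffOn ℝ ∞ φ (Metric.ball 0 R)) (hcs : c ^ 2 + s ^ 2 = 1) (n : ℕ) {w : ℝ × ℝ}
    (hw : w ∈ Metric.ball 0 R) :
    ∑ i, planeVec c s i *
        pderiv i (fun q => contract (gerochHansen h φ n q) (planeVec c s)) (planePt c s w)
      = etaDeriv (planeFun h φ c s n) w := by
  refine dirDeriv_planePt (g := fun q => contract (gerochHansen h φ n q) (planeVec c s)) ?_
  refine DifferentiableAt.fun_sum fun a _ => DifferentiableAt.const_mul ?_ _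
  exact ((contDiffOn_gerochHansen Metric.isOpen_ball hh hφ n a).contDiffAt
    (Metric.isOpen_ball.mem_nhds (planePt_mem_ball hcs hw))).differentiableAt (by simp)

/-- By axisymmetry every meridian plane carries the same function of `(z, ρ)`, so the azimuth drops
out of the derivative. -/
lemma dirDeriv_meridian {g : Pt → ℝ} (hg : ContDiffOn ℝ ∞ g (Metric.ball 0 R))
    (hgs : IsAxisymmetricOn (Metric.ball 0 R) g) (hcs : c ^ 2 + s ^ 2 = 1) {w : ℝ × ℝ}
    (hw : w ∈ Metric.ball 0 R) :
    dirDeriv (planeVec c s) (fun q => (g q : ℂ)) (planePt c s w)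
      = etaDeriv (onMeridian g) w := by
  rw [dirDeriv_planePt]
  · refine etaDeriv_congr ?_
    filter_upwards [Metric.isOpen_ball.mem_nhds hw] with x hx
    rw [onMeridian, hgs.planePt_eq hcs hx]
  · exact ((contDiffOn_ofReal hg).contDiffAt
      (Metric.isOpen_ball.mem_nhds (planePt_mem_ball hcs hw))).differentiableAt (by simp)

lemma dirDeriv_dirDeriv_meridian {g : Pt → ℝ} (hg : ContDiffOn ℝ ∞ g (Metric.ball 0 R))
    (hgs : IsAxisymmetricOn (Metric.ball 0 R) g) (hcs : c ^ 2 + s ^ 2 = 1) {w : ℝ × ℝ}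
    (hw : w ∈ Metric.ball 0 R) :
    dirDeriv (planeVec c s) (dirDeriv (planeVec c s) (fun q => (g q : ℂ))) (planePt c s w)
      = etaDeriv (etaDeriv (onMeridian g)) w := by
  rw [dirDeriv_planePt]
  · refine etaDeriv_congr ?_
    filter_upwards [Metric.isOpen_ball.mem_nhds hw] with x hx using
      dirDeriv_meridian hg hgs hcs hx
  · exact ((contDiffOn_dirDeriv Metric.isOpen_ball (contDiffOn_ofReal hg) _).contDiffAt
      (Metric.isOpen_ball.mem_nhds (planePt_mem_ball hcs hw))).differentiableAt (by simp)

lemma planeFun_one (hh : IsSmoothMetricOn (Metric.ball 0 R) h)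
    (hform : HasAxisymmetricForm (Metric.ball 0 R) h β κ)
    (hβ : ContDiffOn ℝ ∞ β (Metric.ball 0 R)) (hκ : ContDiffOn ℝ ∞ κ (Metric.ball 0 R))
    (hβs : IsAxisymmetricOn (Metric.ball 0 R) β) (hκs : IsAxisymmetricOn (Metric.ball 0 R) κ)
    {φ : Pt → ℂ} (hφ : ContDiffOn ℝ ∞ φ (Metric.ball 0 R))
    (hcs : c ^ 2 + s ^ 2 = 1) {w : ℝ × ℝ} (hw : w ∈ Metric.ball 0 R) :
    planeFun h φ c s 1 w = etaDeriv (planeFun h φ c s 0) w := by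
  rw [← dirDeriv_contract hh hφ hcs 0 hw]
  exact contract_gerochHansen_one Metric.isOpen_ball hh hφ (planePt_mem_ball hcs hw)
    (metric_planeVec_ball hh hform hcs w hw)
    (fun k => christoffel_planeVec_ball hh hform hβ hκ hβs hκs hcs k w hw)

lemma planeFun_add_two (hh : IsSmoothMetricOn (Metric.ball 0 R) h)
    (hform : HasAxisymmetricForm (Metric.ball 0 R) h β κ)
    (hβ : ContDiffOn ℝ ∞ β (Metric.ball 0 R)) (hκ : ContDiffOn ℝ ∞ κ (Metric.ball 0 R))
    (hβs : IsAxisymmetricOn (Metric.ball 0 R) β) (hκs : IsAxisymmetricOn (Metric.ball 0 R) κ)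
    {φ : Pt → ℂ} (hφ : ContDiffOn ℝ ∞ φ (Metric.ball 0 R))
    (hcs : c ^ 2 + s ^ 2 = 1) {w : ℝ × ℝ} (hw : w ∈ Metric.ball 0 R) (n : ℕ) :
    planeFun h φ c s (n + 2) w = etaDeriv (planeFun h φ c s (n + 1)) w
      - ((n : ℂ) + 1) * (2 * etaDeriv (onMeridian κ) w) * planeFun h φ c s (n + 1) w
      - (((n : ℂ) + 1) * (2 * (n : ℂ) + 1) / 2) * planeRicci h c s w * planeFun h φ c s n w := by
  rw [← dirDeriv_contract hh hφ hcs (n + 1) hw, ← dirDeriv_meridian hκ hκs hcs hw]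
  exact contract_gerochHansen_add_two Metric.isOpen_ball hh hφ (planePt_mem_ball hcs hw)
    (metric_planeVec_ball hh hform hcs w hw)
    (fun k => christoffel_planeVec_ball hh hform hβ hκ hβs hκs hcs k w hw) n

lemma planeRicci_eq (hh : IsSmoothMetricOn (Metric.ball 0 R) h)
    (hform : HasAxisymmetricForm (Metric.ball 0 R) h β κ)
    (hβ : ContDiffOn ℝ ∞ β (Metric.ball 0 R)) (hκ : ContDiffOn ℝ ∞ κ (Metric.ball 0 R))
    (hβs : IsAxisymmetricOn (Metric.ball 0 R) β) (hκs : IsAxisymmetricOn (Metric.ball 0 R) κ)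
    (hcs : c ^ 2 + s ^ 2 = 1) {w : ℝ × ℝ} (hw : w ∈ Metric.ball 0 R) (hw' : w.2 ≠ 0) :
    planeRicci h c s w = etaDeriv (etaDeriv (onMeridian β)) w - etaDeriv (onMeridian β) w ^ 2
      - 2 * Complex.I / w.2 * etaDeriv (onMeridian β) w
      - etaDeriv (etaDeriv (onMeridian κ)) w + etaDeriv (onMeridian κ) w ^ 2 := by
  rw [← dirDeriv_meridian hκ hκs hcs hw, ← dirDeriv_meridian hβ hβs hcs hw,
    ← dirDeriv_dirDeriv_meridian hκ hκs hcs hw, ← dirDeriv_dirDeriv_meridian hβ hβs hcs hw]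
  exact ricci_planeVec Metric.isOpen_ball hh hform hβ hκ hβs hκs hcs
    (planePt_mem_offAxis hcs (planePt_mem_ball hcs hw) hw') hw'

lemma continuousOn_planeRicci (hh : IsSmoothMetricOn (Metric.ball 0 R) h)
    (hcs : c ^ 2 + s ^ 2 = 1) : ContinuousOn (planeRicci h c s) (Metric.ball 0 R) := by
  refine continuousOn_finsetSum _ fun i _ => continuousOn_finsetSum _ fun j _ =>
    ContinuousOn.mul (ContinuousOn.mul ?_ continuousOn_const) continuousOn_const
  exact continuousOn_planePt (g := fun p => (ricci h i j p : ℂ))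
    (contDiffOn_ofReal (contDiffOn_ricci Metric.isOpen_ball hh i j)).continuousOn hcs

end

/-! ### Behaviour on the axis -/

/-- On the plane `v = ρ e`, so the `ρ²` in the denominator of the twist cancels, and the resulting
formula persists on the axis by continuity. -/
lemma metric_planePt {R : ℝ} {h : Pt → Matrix (Fin 3) (Fin 3) ℝ} {β κ : Pt → ℝ}
    (hh : IsSmoothMetricOn (Metric.ball 0 R) h)
    (hform : HasAxisymmetricForm (Metric.ball 0 R) h β κ)
    (hβ : ContDiffOn ℝ ∞ β (Metric.ball 0 R)) (hκ : ContDiffOn ℝ ∞ κ (Metric.ball 0 R))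
    {c s : ℝ} (hcs : c ^ 2 + s ^ 2 = 1) (i j : Fin 3) :
    ∀ w ∈ Metric.ball (0 : ℝ × ℝ) R, (h (planePt c s w) i j : ℂ)
      = ((Real.exp (2 * κ (planePt c s w)) * (kron i j
        + (Real.exp (-2 * β (planePt c s w)) - 1) * ![-s, c, 0] i * ![-s, c, 0] j) : ℝ) : ℂ) := by
  have hκ' : ContinuousOn (fun w => κ (planePt c s w)) (Metric.ball 0 R) :=
    continuousOn_planePt hκ.continuousOn hcs
  have hβ' : ContinuousOn (fun w => β (planePt c s w)) (Metric.ball 0 R) :=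
    continuousOn_planePt hβ.continuousOn hcs
  refine eqOn_ball_of_eqOn_off_axis ?_ ?_ fun w hw hw' => ?_
  · exact continuousOn_planePt (g := fun p => (h p i j : ℂ))
      (contDiffOn_ofReal (hh.1 i j)).continuousOn hcs
  · refine Complex.continuous_ofReal.comp_continuousOn ?_
    have e1 := Real.continuous_exp.comp_continuousOn (hκ'.const_mul 2)
    have e2 := Real.continuous_exp.comp_continuousOn (hβ'.const_mul (-2))
    exact e1.mul (continuousOn_const.add
      (((e2.sub continuousOn_const).mul continuousOn_const).mul continuousOn_const))
  · have hp := planePt_mem_offAxis hcs (planePt_mem_ball hcs hw) hw'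
    have hr : planePt c s w 0 ^ 2 + planePt c s w 1 ^ 2 = w.2 ^ 2 := by
      simp only [planePt, Matrix.cons_val_zero, Matrix.cons_val_one]
      linear_combination w.2 ^ 2 * hcs
    rw [metric_eq hform hp.1 hp.2, twist, hr]
    congr 3
    have e : ∀ i, rotField (planePt c s w) i = w.2 * ![-s, c, 0] i := by
      intro i
      fin_cases i <;> simp [rotField, planePt]
    rw [e, e]
    field_simp

lemma planePt_axis (c s z : ℝ) : planePt c s (z, 0) = ![0, 0, z] := by
  simp [planePt]

/-- An axis point lies in all meridian planes. Its `xx` component is `e^{2κ}` computed in the plane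
of azimuth 0 and `e^{2κ - 2β}` in that of azimuth `π/2`. -/
lemma beta_axis {R : ℝ} {h : Pt → Matrix (Fin 3) (Fin 3) ℝ} {β κ : Pt → ℝ}
    (hh : IsSmoothMetricOn (Metric.ball 0 R) h)
    (hform : HasAxisymmetricForm (Metric.ball 0 R) h β κ)
    (hβ : ContDiffOn ℝ ∞ β (Metric.ball 0 R)) (hκ : ContDiffOn ℝ ∞ κ (Metric.ball 0 R))
    {z : ℝ} (hz : |z| < R) : β ![0, 0, z] = 0 := by
  have hw : (z, (0 : ℝ)) ∈ Metric.ball (0 : ℝ × ℝ) R := by simp [Prod.norm_def, hz]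
  have h1 := metric_planePt hh hform hβ hκ (c := 1) (s := 0) (by simp) 0 0 _ hw
  have h2 := metric_planePt hh hform hβ hκ (c := 0) (s := 1) (by simp) 0 0 _ hw
  rw [planePt_axis] at h1 h2
  have h3 := Complex.ofReal_injective (h1.symm.trans h2)
  have h4 := mul_left_cancel₀ (Real.exp_ne_zero _) h3
  simp [kron] at h4
  have h5 : Real.exp (-(2 * β ![0, 0, z])) = 1 := by linarith
  have := (Real.exp_eq_one_iff _).1 h5
  linarith

lemma metric_zero {R : ℝ} (hR : 0 < R) {h : Pt → Matrix (Fin 3) (Fin 3) ℝ} {β κ : Pt → ℝ}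
    (hh : IsSmoothMetricOn (Metric.ball 0 R) h)
    (hform : HasAxisymmetricForm (Metric.ball 0 R) h β κ)
    (hβ : ContDiffOn ℝ ∞ β (Metric.ball 0 R)) (hκ : ContDiffOn ℝ ∞ κ (Metric.ball 0 R))
    (hκ0 : κ 0 = 0) : h 0 = 1 := by
  have e0 : (![0, 0, 0] : Pt) = 0 := by
    funext i
    fin_cases i <;> rfl
  have hb := beta_axis hh hform hβ hκ (z := 0) (by simpa using hR)
  rw [e0] at hb
  ext i j
  have h1 := metric_planePt hh hform hβ hκ (c := 1) (s := 0) (by simp) i j (0, 0)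
    (by simpa using hR)
  rw [planePt_axis, e0, hb, hκ0] at h1
  have h2 := Complex.ofReal_injective h1
  rw [h2]
  simp [kron, Matrix.one_apply]

lemma meridian_axis (z : ℝ) : meridian (z, 0) = ![0, 0, z] := rfl

/-- The `z`-derivative vanishes because `β` is zero along the axis, the `ρ`-derivative because `β`
is even in `ρ`. -/
lemma etaDeriv_onMeridian_axis {R : ℝ} {β : Pt → ℝ}
    (hβ : ContDiffOn ℝ ∞ β (Metric.ball 0 R)) (hβs : IsAxisymmetricOn (Metric.ball 0 R) β)
    (hβ0 : ∀ z : ℝ, |z| < R → β ![0, 0, z] = 0) {z : ℝ} (hz : |z| < R) :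
    etaDeriv (onMeridian β) (z, 0) = 0 := by
  have hw : (z, (0 : ℝ)) ∈ Metric.ball (0 : ℝ × ℝ) R := by simp [Prod.norm_def, hz]
  have hd : DifferentiableAt ℝ (onMeridian β) (z, 0) := by
    have h1 : DifferentiableAt ℝ (fun q => (β q : ℂ)) (planeCLM 1 0 (z, 0)) := by
      rw [planeCLM_apply]
      exact ((contDiffOn_ofReal hβ).contDiffAt (Metric.isOpen_ball.mem_nhds
        (planePt_mem_ball (by simp) hw))).differentiableAt (by simp)
    have h2 := h1.comp (z, (0 : ℝ)) (planeCLM 1 0).differentiableAt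
    have e : (fun q => (β q : ℂ)) ∘ (planeCLM 1 0) = onMeridian β := by
      funext w
      rw [Function.comp_apply, planeCLM_apply, ← meridian_eq, onMeridian]
    rwa [e] at h2
  have h1 : fderiv ℝ (onMeridian β) (z, 0) (1, 0) = 0 := by
    have h2 : HasDerivAt (fun t : ℝ => (t, (0 : ℝ))) (1, 0) z :=
      (hasDerivAt_id z).prodMk (hasDerivAt_const z 0)
    have h3 := hd.hasFDerivAt.comp_hasDerivAt z h2
    have h4 : (onMeridian β ∘ fun t : ℝ => (t, (0 : ℝ))) =ᶠ[nhds z] fun _ => 0 := by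
      have : ∀ᶠ t in nhds z, |t| < R := continuous_abs.continuousAt.eventually_lt_const hz
      filter_upwards [this] with t ht
      simp [onMeridian, meridian_axis, hβ0 t ht]
    exact h3.unique ((hasDerivAt_const z (0 : ℂ)).congr_of_eventuallyEq h4)
  have h5 : fderiv ℝ (onMeridian β) (z, 0) (0, 1) = 0 := by
    have h2 : HasDerivAt (fun t : ℝ => (z, t)) (0, 1) 0 :=
      (hasDerivAt_const 0 z).prodMk (hasDerivAt_id 0)
    have h3 := hd.hasFDerivAt.comp_hasDerivAt 0 h2
    have h6 : HasDerivAt (fun t : ℝ => (z, -t)) (0, -1) 0 :=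
      (hasDerivAt_const 0 z).prodMk (hasDerivAt_neg 0)
    have hd' : HasFDerivAt (onMeridian β) (fderiv ℝ (onMeridian β) (z, 0)) (z, -0) := by
      rw [neg_zero]
      exact hd.hasFDerivAt
    have h7 := hd'.comp_hasDerivAt 0 h6
    have h8 : (onMeridian β ∘ fun t : ℝ => (z, t)) =ᶠ[nhds 0] onMeridian β ∘ fun t => (z, -t) := by
      have : ∀ᶠ t in nhds (0 : ℝ), |t| < R :=
        continuous_abs.continuousAt.eventually_lt_const
          (by simpa using (abs_nonneg z).trans_lt hz)
      filter_upwards [this] with t ht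
      have m1 : (z, t) ∈ Metric.ball (0 : ℝ × ℝ) R := by simp [Prod.norm_def, hz, ht]
      have m2 : (z, -t) ∈ Metric.ball (0 : ℝ × ℝ) R := by simp [Prod.norm_def, hz, ht]
      simp only [Function.comp_apply, onMeridian, meridian_eq]
      have h10 : (1 : ℝ) ^ 2 + 0 ^ 2 = 1 := by norm_num
      rw [hβs _ (planePt_mem_ball h10 m1) _ (planePt_mem_ball h10 m2)
        (by simp [planePt]) (by simp [rho_planePt h10])]
    have h9 := h3.unique (h7.congr_of_eventuallyEq h8)
    have e : ((0 : ℝ), (-1 : ℝ)) = -(0, 1) := by simp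
    rw [e, map_neg] at h9
    exact self_eq_neg.1 h9
  rw [etaDeriv, h1, h5, mul_zero, sub_zero]

/-! ### Complexified recursion and moments -/

/-- The recursion for the complexified contractions `f_n`. -/
def complexRec (Φ K' M : ℂ × ℂ → ℂ) : ℕ → ℂ × ℂ → ℂ
  | 0 => Φ
  | 1 => etaDerivC Φ
  | n + 2 => fun w => etaDerivC (complexRec Φ K' M (n + 1)) w
      - ((n : ℂ) + 1) * (2 * K' w) * complexRec Φ K' M (n + 1) w
      - (((n : ℂ) + 1) * (2 * (n : ℂ) + 1) / 2) * M w * complexRec Φ K' M n w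

lemma analyticOnNhd_complexRec {s : Set (ℂ × ℂ)} {Φ K' M : ℂ × ℂ → ℂ}
    (hΦ : AnalyticOnNhd ℂ Φ s) (hK : AnalyticOnNhd ℂ K' s) (hM : AnalyticOnNhd ℂ M s) (n : ℕ) :
    AnalyticOnNhd ℂ (complexRec Φ K' M n) s := by
  induction n using Nat.twoStepInduction with
  | zero => exact hΦ
  | one => exact analyticOnNhd_etaDerivC hΦ
  | more n h0 h1 =>
    exact ((analyticOnNhd_etaDerivC h1).sub
      ((analyticOnNhd_const.mul (analyticOnNhd_const.mul hK)).mul h1)).sub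
      ((analyticOnNhd_const.mul hM).mul h0)

/-- The recursion uses only derivatives, sums and products of functions holomorphic on the polydisc,
so one `δ` serves all `n`. -/
lemma isComplexification_complexRec {δ : ℝ} {f : ℕ → ℝ × ℝ → ℂ} {k' R : ℝ × ℝ → ℂ}
    {Φ K' M : ℂ × ℂ → ℂ} (hΦ : IsComplexification δ (f 0) Φ) (hK : IsComplexification δ k' K')
    (hM : IsComplexification δ R M)
    (h1 : ∀ w ∈ Metric.ball (0 : ℝ × ℝ) δ, f 1 w = etaDeriv (f 0) w)
    (h2 : ∀ w ∈ Metric.ball (0 : ℝ × ℝ) δ, ∀ n : ℕ, f (n + 2) w = etaDeriv (f (n + 1)) w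
      - ((n : ℂ) + 1) * (2 * k' w) * f (n + 1) w
      - (((n : ℂ) + 1) * (2 * (n : ℂ) + 1) / 2) * R w * f n w) (n : ℕ) :
    IsComplexification δ (f n) (complexRec Φ K' M n) := by
  refine ⟨analyticOnNhd_complexRec hΦ.1 hK.1 hM.1 n, ?_⟩
  induction n using Nat.twoStepInduction with
  | zero => exact hΦ.2
  | one =>
    intro w hw
    rw [h1 w hw]
    exact hΦ.etaDeriv.2 w hw
  | more n ih0 ih1 =>
    intro w hw
    have hc : IsComplexification δ (f (n + 1)) (complexRec Φ K' M (n + 1)) :=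
      ⟨analyticOnNhd_complexRec hΦ.1 hK.1 hM.1 (n + 1), ih1⟩
    rw [h2 w hw, complexRec]
    simp only
    rw [hc.etaDeriv.2 w hw, ih1 w hw, ih0 w hw, hK.2 w hw, hM.2 w hw]

lemma analyticAt_comp_meridian {E : Type*} [NormedAddCommGroup E] [NormedSpace ℝ E] {g : Pt → E}
    (hg : AnalyticAt ℝ g 0) : AnalyticAt ℝ (fun w => g (meridian w)) 0 := by
  have h1 : AnalyticAt ℝ g (planeCLM 1 0 0) := by rwa [map_zero]
  have h2 := h1.comp ((planeCLM 1 0).analyticAt 0)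
  have e : g ∘ (planeCLM 1 0) = fun w => g (meridian w) := by
    funext w
    rw [Function.comp_apply, planeCLM_apply, meridian_eq]
  rwa [e] at h2

lemma analyticAt_onMeridian {g : Pt → ℝ} (hg : AnalyticAt ℝ g 0) :
    AnalyticAt ℝ (onMeridian g) 0 :=
  (Complex.ofRealCLM.analyticAt _).comp (analyticAt_comp_meridian hg)

lemma analyticAt_etaDeriv {g : ℝ × ℝ → ℂ} {w : ℝ × ℝ} (hg : AnalyticAt ℝ g w) :
    AnalyticAt ℝ (etaDeriv g) w := by
  have h := hg.fderiv
  have h1 : ∀ v : ℝ × ℝ, AnalyticAt ℝ (fun x => fderiv ℝ g x v) w := fun v =>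
    ((ContinuousLinearMap.apply ℝ ℂ v).analyticAt _).comp h
  exact (h1 _).sub (analyticAt_const.mul (h1 _))

/-- The contraction `C[z_{a₁} ⋯ z_{aₙ}]` with `∂_z - i ∂_ρ`. -/
lemma contract_stf_dz {n : ℕ} {A : Matrix (Fin 3) (Fin 3) ℝ} (hA : A.PosDef) {c s : ℝ}
    (hnull : ∑ k, ∑ l, (A k l : ℂ) * planeVec c s k * planeVec c s l = 0) :
    contract (stf A (fun a : Fin n → Fin 3 => ∏ i, if a i = 2 then (1 : ℂ) else 0))
      (planeVec c s) = 1 := by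
  rw [(isSTFPart_stf_of_posDef hA _).contract_eq hnull, contract,
    Finset.sum_eq_single (fun _ => 2)]
  · simp [planeVec]
  · intro a _ ha
    obtain ⟨i, hi⟩ := Function.ne_iff.1 ha
    rw [Finset.prod_eq_zero (f := fun i => if a i = 2 then (1 : ℂ) else 0) (Finset.mem_univ i)
      (if_neg hi), mul_zero]
  · simp

/-- The candidate identity is tested on the whole null circle. `P - y C[z ⋯ z]` is symmetric,
trace-free for the flat metric at the origin, and vanishes on every `nullVec t`; conversely one null
vector already determines `m`. -/
lemma isMoment_iff {h : Pt → Matrix (Fin 3) (Fin 3) ℝ} {U : Set Pt} (h0 : (0 : Pt) ∈ U)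
    (hh : IsSmoothMetricOn U h) (hone : h 0 = 1) {φ : Pt → ℂ} {n : ℕ} {y : ℂ}
    (hnull : ∀ t, ∑ k, ∑ l, (h 0 k l : ℂ) * nullVec t k * nullVec t l = 0)
    (hy : ∀ t, contract (gerochHansen h φ n 0) (nullVec t) = y) (m : ℂ) :
    IsMoment h φ n m ↔ m = y := by
  have hz : ∀ t, contract (stf (h 0) (fun a : Fin n → Fin 3 =>
      ∏ i, if a i = 2 then (1 : ℂ) else 0)) (nullVec t) = 1 := fun t =>
    contract_stf_dz (hh.2 0 h0) (hnull t)
  constructor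
  · intro hm
    rw [IsMoment] at hm
    rw [← hy 0, hm, contract_smul, hz, mul_one]
  · rintro rfl
    have hP := isSymm_isTraceFree_gerochHansen hh φ n h0
    have hC := isSTFPart_stf_of_posDef (hh.2 0 h0) (fun a : Fin n → Fin 3 =>
      ∏ i, if a i = 2 then (1 : ℂ) else 0)
    have ht := hP.2.add (hC.2.1.smul (-m))
    rw [hone] at ht
    have := eq_zero_of_contract_nullVec (hP.1.add (hC.1.smul (-m))) (by rwa [hone]) fun t => by
      rw [contract_add, contract_smul, hy, hz]
      ring
    rw [neg_smul, add_neg_eq_zero] at this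
    exact this

lemma planePt_zero (c s : ℝ) : planePt c s 0 = 0 := by
  rw [← planeCLM_apply, map_zero]

end Multipole

end

/-! ### Assembly of the recursion and the moments -/

open Multipole in
theorem mainTheorem2
    (U : Set Multipole.Pt) (hU : IsOpen U) (h0 : (0 : Multipole.Pt) ∈ U)
    (h : Multipole.Pt → Matrix (Fin 3) (Fin 3) ℝ) (β κ : Multipole.Pt → ℝ)
    (φ : Multipole.Pt → ℂ)
    (hh : Multipole.IsSmoothMetricOn U h)
    (hform : Multipole.HasAxisymmetricForm U h β κ)
    (hβ : AnalyticOnNhd ℝ β U) (hκ : AnalyticOnNhd ℝ κ U) (hφ : AnalyticOnNhd ℝ φ U)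
    (hβs : Multipole.IsAxisymmetricOn U β) (hκs : Multipole.IsAxisymmetricOn U κ)
    (hφs : Multipole.IsAxisymmetricOn U φ)
    (hκ0 : κ 0 = 0)
    (βL κL : ℝ → ℂ) (y : ℕ → ℝ → ℂ)
    (hβL : βL = Multipole.leadingOrder (Multipole.onMeridian β))
    (hκL : κL = Multipole.leadingOrder (Multipole.onMeridian κ))
    (hy : ∀ n, y n = Multipole.leadingOrder (Multipole.fFun h φ n)) :
    (∃ δ : ℝ, 0 < δ ∧
      -- the leading order functions are well defined and analytic on `(-δ, δ)`
      (∃ B, Multipole.IsComplexification δ (Multipole.onMeridian β) B) ∧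
      (∃ K, Multipole.IsComplexification δ (Multipole.onMeridian κ) K) ∧
      (∀ n, ∃ F, Multipole.IsComplexification δ (Multipole.fFun h φ n) F) ∧
      AnalyticOnNhd ℝ βL (Set.Ioo (-δ) δ) ∧
      AnalyticOnNhd ℝ κL (Set.Ioo (-δ) δ) ∧
      (∀ n, AnalyticOnNhd ℝ (y n) (Set.Ioo (-δ) δ)) ∧
      -- `M` is the analytic function given by the formula for `r ≠ 0`
      ∃ M : ℝ → ℂ, AnalyticOnNhd ℝ M (Set.Ioo (-δ) δ) ∧
        (∀ r ∈ Set.Ioo (-δ) δ, r ≠ 0 →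
          M r = deriv (deriv βL) r - (deriv βL r) ^ 2 + 2 / (r : ℂ) * deriv βL r
            - deriv (deriv κL) r + (deriv κL r) ^ 2) ∧
        -- for `n = 1` the last term has coefficient `0`
        ∀ n : ℕ, 1 ≤ n → ∀ r ∈ Set.Ioo (-δ) δ,
          y n r = deriv (y (n - 1)) r
            - 2 * ((n : ℂ) - 1) * deriv κL r * y (n - 1) r
            - ((n : ℂ) - 1) * (2 * (n : ℂ) - 3) / 2 * M r * y (n - 2) r) ∧
    -- the `n`-th moment exists, is unique, and equals `y n 0`
    ∀ (n : ℕ) (m : ℂ), Multipole.IsMoment h φ n m ↔ m = y n 0 := by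
  subst hβL hκL
  obtain rfl : y = fun n => leadingOrder (fFun h φ n) := funext hy
  -- restriction to a ball
  obtain ⟨R, hR, hRU⟩ := Metric.isOpen_iff.1 hU 0 h0
  have hh' : IsSmoothMetricOn (Metric.ball 0 R) h :=
    ⟨fun i j => (hh.1 i j).mono hRU, fun p hp => hh.2 p (hRU hp)⟩
  have hform' : HasAxisymmetricForm (Metric.ball 0 R) h β κ := fun p hp => hform p (hRU hp)
  have cβ : ContDiffOn ℝ ∞ β (Metric.ball 0 R) := fun p hp =>
    (hβ p (hRU hp)).contDiffAt.contDiffWithinAt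
  have cκ : ContDiffOn ℝ ∞ κ (Metric.ball 0 R) := fun p hp =>
    (hκ p (hRU hp)).contDiffAt.contDiffWithinAt
  have cφ : ContDiffOn ℝ ∞ φ (Metric.ball 0 R) := fun p hp =>
    (hφ p (hRU hp)).contDiffAt.contDiffWithinAt
  have sβ := hβs.mono hRU
  have sκ := hκs.mono hRU
  have sφ := hφs.mono hRU
  have hβ0 : ∀ z : ℝ, |z| < R → β ![0, 0, z] = 0 := fun z hz => beta_axis hh' hform' cβ cκ hz
  -- complexifications
  have aβ := analyticAt_onMeridian (hβ 0 h0)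
  obtain ⟨δ₁, hδ₁, B, hB⟩ := exists_isComplexification aβ
  obtain ⟨δ₂, hδ₂, K, hK⟩ := exists_isComplexification (analyticAt_onMeridian (hκ 0 h0))
  obtain ⟨δ₃, hδ₃, Φ, hΦ⟩ := exists_isComplexification (analyticAt_comp_meridian (hφ 0 h0))
  obtain ⟨δ₄, hδ₄, Q, hQ, hQβ⟩ := exists_eq_mul_of_axis_eq_zero (analyticAt_etaDeriv aβ) hR
    (fun z hz => etaDeriv_onMeridian_axis cβ sβ hβ0 hz)
  obtain ⟨δ, hδ, l1, l2, l3, l4, l5⟩ :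
      ∃ δ : ℝ, 0 < δ ∧ δ ≤ δ₁ ∧ δ ≤ δ₂ ∧ δ ≤ δ₃ ∧ δ ≤ δ₄ ∧ δ ≤ R :=
    ⟨min δ₁ (min δ₂ (min δ₃ (min δ₄ R))), by positivity, by simp, by simp, by simp, by simp,
      by simp⟩
  replace hB := hB.mono l1
  replace hK := hK.mono l2
  replace hΦ := hΦ.mono l3
  replace hQ := hQ.mono (Metric.ball_subset_ball l4)
  replace hQβ : ∀ w ∈ Metric.ball (0 : ℝ × ℝ) δ,
      (w.2 : ℂ) * Q ((w.1 : ℂ), (w.2 : ℂ)) = etaDeriv (onMeridian β) w := fun w hw =>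
    hQβ w (Metric.ball_subset_ball l4 hw)
  have hball : ∀ {w : ℝ × ℝ}, w ∈ Metric.ball (0 : ℝ × ℝ) δ → w ∈ Metric.ball (0 : ℝ × ℝ) R :=
    fun hw => Metric.ball_subset_ball l5 hw
  -- the complexified Ricci term
  let Mc : ℂ × ℂ → ℂ := fun w => etaDerivC (etaDerivC B) w - etaDerivC B w ^ 2
    - 2 * Complex.I * Q w - etaDerivC (etaDerivC K) w + etaDerivC K w ^ 2
  have hMc : AnalyticOnNhd ℂ Mc (Metric.ball 0 δ) :=
    (((hB.etaDeriv.etaDeriv.1.sub (hB.etaDeriv.1.pow 2)).sub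
      (analyticOnNhd_const.mul hQ)).sub hK.etaDeriv.etaDeriv.1).add (hK.etaDeriv.1.pow 2)
  have hRic : ∀ c s : ℝ, c ^ 2 + s ^ 2 = 1 → IsComplexification δ (planeRicci h c s) Mc := by
    intro c s hcs
    refine ⟨hMc, eqOn_ball_of_eqOn_off_axis (F := fun w => Mc ((w.1 : ℂ), (w.2 : ℂ))) ?_
      ((continuousOn_planeRicci hh' hcs).mono (Metric.ball_subset_ball l5)) fun w hw hw' => ?_⟩
    · refine hMc.continuousOn.comp (f := fun w : ℝ × ℝ => ((w.1 : ℂ), (w.2 : ℂ))) ?_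
        fun w hw => ofReal_mem_ball hw
      exact (by fun_prop : Continuous fun w : ℝ × ℝ => ((w.1 : ℂ), (w.2 : ℂ))).continuousOn
    · have hw2 : (w.2 : ℂ) ≠ 0 := by exact_mod_cast hw'
      rw [planeRicci_eq hh' hform' cβ cκ sβ sκ hcs (hball hw) hw']
      simp only [Mc]
      rw [hB.etaDeriv.etaDeriv.2 w hw, hB.etaDeriv.2 w hw, hK.etaDeriv.etaDeriv.2 w hw,
        hK.etaDeriv.2 w hw]
      have hq : 2 * Complex.I / w.2 * etaDeriv (onMeridian β) w
          = 2 * Complex.I * Q ((w.1 : ℂ), (w.2 : ℂ)) := by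
        rw [← hQβ w hw]
        field_simp
      rw [hq]
  -- the complexified contractions
  let F : ℕ → ℂ × ℂ → ℂ := complexRec Φ (etaDerivC K) Mc
  -- `F n` does not involve the azimuth: its data `Φ`, `K` and `Mc` are common to all meridian
  -- planes. The moment argument depends on this.
  have hF : ∀ c s : ℝ, c ^ 2 + s ^ 2 = 1 → ∀ n,
      IsComplexification δ (planeFun h φ c s n) (F n) := by
    intro c s hcs n
    refine isComplexification_complexRec (f := planeFun h φ c s) ⟨hΦ.1, fun w hw => ?_⟩
      hK.etaDeriv (hRic c s hcs)
      (fun w hw => planeFun_one hh' hform' cβ cκ sβ sκ cφ hcs (hball hw))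
      (fun w hw n => planeFun_add_two hh' hform' cβ cκ sβ sκ cφ hcs (hball hw) n) n
    rw [hΦ.2 w hw, planeFun_zero, sφ.planePt_eq hcs (hball hw)]
  have hf : ∀ n, IsComplexification δ (fFun h φ n) (F n) := fun n => by
    rw [fFun_eq]
    exact hF 1 0 (by norm_num) n
  refine ⟨⟨δ, hδ, ⟨B, hB⟩, ⟨K, hK⟩, fun n => ⟨F n, hf n⟩, hB.analyticOnNhd_leadingOrder,
    hK.analyticOnNhd_leadingOrder, fun n => (hf n).analyticOnNhd_leadingOrder,
    fun r => Mc ((r : ℂ), -Complex.I * (r : ℂ)), analyticOnNhd_null hMc, ?_, ?_⟩, ?_⟩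
  · intro r hr hr0
    rw [hB.deriv_deriv_leadingOrder hr, hB.deriv_leadingOrder hr,
      hK.deriv_deriv_leadingOrder hr, hK.deriv_leadingOrder hr]
    have hQc : IsComplexification δ (etaDeriv (onMeridian β)) (fun w => w.2 * Q w) :=
      ⟨analyticOnNhd_snd.mul hQ, hQβ⟩
    -- The factorization `ηβ = ρ Q`, known at real points, extends to the polydisc by uniqueness of
    -- the complexification.
    have e := hB.etaDeriv.unique hQc _ (null_mem_ball (abs_lt.2 hr))
    have hr' : (r : ℂ) ≠ 0 := by exact_mod_cast hr0
    -- On the line `ρ = -ir` the quotient `(2/r) ρ Q` is `-2i Q`, the analytic term already present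
    -- in `Mc`.
    have e2 : 2 / (r : ℂ) * etaDerivC B ((r : ℂ), -Complex.I * (r : ℂ))
        = -2 * Complex.I * Q ((r : ℂ), -Complex.I * (r : ℂ)) := by
      rw [e]
      field_simp
    rw [e2]
    simp only [Mc]
    ring
  · intro n hn r hr
    have hr' := abs_lt.2 hr
    match n, hn with
    | 1, _ =>
      simp only [Nat.sub_self]
      rw [(hf 0).deriv_leadingOrder hr, leadingOrder_eq (hf 1) hr']
      simp [F, complexRec]
    | n + 2, _ =>
      simp only [Nat.add_sub_cancel, show n + 2 - 1 = n + 1 from rfl]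
      rw [(hf (n + 1)).deriv_leadingOrder hr, leadingOrder_eq (hf (n + 2)) hr',
        leadingOrder_eq (hf (n + 1)) hr', leadingOrder_eq (hf n) hr', hK.deriv_leadingOrder hr]
      simp only [F, complexRec]
      push_cast
      ring
  · intro n m
    have hcs : ∀ t : ℝ, Real.cos t ^ 2 + Real.sin t ^ 2 = 1 := Real.cos_sq_add_sin_sq
    have m0 : (0 : ℝ × ℝ) ∈ Metric.ball (0 : ℝ × ℝ) δ := Metric.mem_ball_self hδ
    refine isMoment_iff h0 hh (metric_zero hR hh' hform' cβ cκ hκ0) (fun t => ?_) (fun t => ?_) m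
    · have := metric_planeVec_ball hh' hform' (hcs t) 0 (hball m0)
      rwa [planePt_zero] at this
    · have e1 := (hF _ _ (hcs t) n).2 0 m0
      rw [planeFun, planePt_zero] at e1
      have e2 := leadingOrder_eq (hf n) (r := 0) (by simpa using hδ)
      rw [nullVec, ← e1]
      change _ = leadingOrder (fFun h φ n) 0
      rw [e2]
      simp
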